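/- Let $n>1$ be an integer, $G=\mathrm{GL}_n(\mathbb{C})$, $T\le G$ the diagonal torus, and $U_+$ (resp. $U_-$) the group of upper (resp. lower) triangular matrices with $1$'s on the diagonal. Let $\xi\in T$ have pairwise distinct diagonal entries and be generic: if a subspace $V\subseteq\mathbb{C}^n$ is stable under some conjugate $X$ of $\xi$ and $\det(X|_V)=1$, then $V=0$ or $V=\mathbb{C}^n$. The wild character variety of genus $g=0$ with $k=0$ tame punctures, $m=1$ irregular puncture and $r_1=1$ is $$\mathcal{M}_B^{\emptyset,(1)}=\operatorname{Spec}\mathbb{C}[\mathcal{U}]^{G\times T},\qquad \mathcal{U}=\{(C,S_1,S_2,t)\in G\times U_+\times U_-\times T \;:\; C^{-1}\xi S_2S_1C=I_n,\ t=\xi\},$$ where $(y,x)\in G\times T$ acts by $(C,S_1,S_2,t)\mapsto(xCy^{-1},xS_1x^{-1},xS_2x^{-1},t)$. For partitions $\mu^1,\dots,\mu^k$ of $n$ and integers $g,r\ge 0$ put $$\mathbb{H}_{\mu,r}(z,w)=(-1)^{rn}(z^2-1)(1-w^2)\Big\langle \operatorname{Log}\Big(\sum_{\lambda}\mathcal{H}^{g,r}_\lambda(z,w)\prod_{i=1}^k\tilde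 H_\lambda(z^2,w^2;\mathbf{x}_i)\Big),\ h_{\mu^1}(\mathbf{x}_1)\cdots h_{\mu^k}(\mathbf{x}_k)\Big\rangle\in\mathbb{Q}(z,w),$$ $$\mathcal{H}^{g,r}_\lambda(z,w)=\prod_{s\in\lambda}\frac{(-z^{2a(s)}w^{2l(s)})^r\,(z^{2a(s)+1}-w^{2l(s)+1})^{2g}}{(z^{2a(s)+2}-w^{2l(s)})(z^{2a(s)}-w^{2l(s)+2})},$$ where $\lambda$ runs over all partitions, $a(s)$ and $l(s)$ are the arm and leg lengths of the box $s$ of $\lambda$, $\tilde H_\lambda(q,t;\mathbf{x})$ are the Garsia–Haiman modified Macdonald polynomials, $h_\mu$ are the complete symmetric functions, $\operatorname{Log}$ is the plethystic logarithm and $\langle\ ,\ \rangle$ is the Hall pairing. Then: 1. $\mathcal{M}_B^{\emptyset,(1)}=\emptyset$. 2. For $g=0$, $k=1$, $\mu^1=(1^n)$ and $r=1$ one has $\mathbb{H}_{(1^n),1}(z,w)=0$. 3. With $d=2-2n$, the value for these parameters of $d_{\mu,\mathbf r}=(2g+k-2)n^2-\sum_{j,p}(\mu^j_p)^2+n(n-1)(m+\sum_\alpha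 r_\alpha)+2$, one has $$WH(\mathcal{M}_B^{\emptyset,(1)};q,t)=(qt^2)^{d}\,\mathbb{H}_{(1^n),1}(q^{-1/2},-tq^{1/2}),$$ where $WH(X;q,t)=\sum_{w,k}\dim \mathrm{Gr}^W_{w}H^k(X;\mathbb{Q})\,q^{w/2}t^k$ is the mixed Hodge polynomial, $W$ being Deligne's weight filtration. The same identity holds with the compactly supported cohomology $H_c^k(X;\mathbb{Q})$ in place of $H^k(X;\mathbb{Q})$. -/

import Mathlib

namespace WildChar

noncomputable section

open CategoryTheory AlgebraicGeometry MvPolynomial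

/-! ### Symmetric functions

`Λ ⊗ F = F[p₁, p₂, …]` for a field `F` of characteristic `0`: the variable `r` is the power sum
`p_r`. For several alphabets indexed by `ι`, the variable `(i, r)` is `p_r(x_i)`. -/

/-- Symmetric functions over `F` in one alphabet. -/
abbrev Sym (F : Type*) [CommRing F] : Type _ := MvPolynomial ℕ+ F

/-- Functions over `F` separately symmetric in the alphabets `x_i`, `i : ι`. -/
abbrev MultiSym (ι F : Type*) [CommRing F] : Type _ := MvPolynomial (ι × ℕ+) F

/-- The bilinear form for which the monomials in the variables are orthogonal and the square length
of `∏ X_s ^ e_s` is `∏ ω_s ^ e_s * e_s !`. -/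
def pairing {σ F : Type*} [Field F] (ω : σ → F) (f g : MvPolynomial σ F) : F :=
  ∑ d ∈ f.support, coeff d f * coeff d g * d.prod fun s e => ω s ^ e * (e.factorial : F)

/-- The Hall pairing on `Λ(x_i : i : ι)`: `⟨p_λ, p_μ⟩ = δ_{λμ} z_λ` in every alphabet. -/
def hall {ι F : Type*} [Field F] (f g : MultiSym ι F) : F :=
  pairing (fun s : ι × ℕ+ => ((s.2 : ℕ) : F)) f g

/-- The Macdonald pairing
`⟨p_λ, p_μ⟩_{q,t} = δ_{λμ} z_λ ∏ (1 - q ^ λ_i) / (1 - t ^ λ_i)`. -/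
def qtPairing {F : Type*} [Field F] (q t : F) (f g : Sym F) : F :=
  pairing (fun r : ℕ+ => ((r : ℕ) : F) * ((1 - q ^ (r : ℕ)) / (1 - t ^ (r : ℕ)))) f g

/-- The power sum `p_r(x_i)` for `r ≥ 1`. -/
def powerSum {ι F : Type*} [Field F] (i : ι) (r : ℕ) : MultiSym ι F := X (i, r.toPNat')

/-- `z_λ = ∏_a a ^ m_a * m_a !`, with `m_a` the multiplicity of `a` in `λ`. -/
def zee {n : ℕ} (lam : n.Partition) : ℕ :=
  ∏ a ∈ lam.parts.toFinset, a ^ lam.parts.count a * (lam.parts.count a).factorial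

/-- The complete symmetric function `h_n(x_i) = ∑_{λ ⊢ n} z_λ⁻¹ p_λ(x_i)`. -/
def complete {ι F : Type*} [Field F] (i : ι) (n : ℕ) : MultiSym ι F :=
  ∑ lam : n.Partition, C ((zee lam : F)⁻¹) * (lam.parts.map (powerSum i)).prod

/-- `h_μ(x_i) = ∏_j h_{μ_j}(x_i)`. -/
def completePart {ι F : Type*} [Field F] (i : ι) {n : ℕ} (mu : n.Partition) : MultiSym ι F :=
  (mu.parts.map (complete i)).prod

/-- The parts of a partition in weakly decreasing order. -/
def rows {n : ℕ} (lam : n.Partition) : List ℕ := lam.parts.sort (· ≥ ·)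

/-- The monomial symmetric function `m_λ`, with `λ = (λ_1, …, λ_ℓ)`, in terms of power sums:
Möbius inversion on the lattice of set partitions `π` of `{1, …, ℓ}` gives
`∏_a m_a ! * m_λ = ∑_{i_1, …, i_ℓ distinct} ∏_j x_{i_j} ^ λ_j
  = ∑_π ∏_{B ∈ π} (-1) ^ (|B| - 1) (|B| - 1)! p_{∑_{j ∈ B} λ_j}`. -/
def monomialSym {F : Type*} [Field F] {n : ℕ} (lam : n.Partition) : Sym F :=
  C (((∏ a ∈ lam.parts.toFinset, (lam.parts.count a).factorial : ℕ) : F)⁻¹) *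
    ∑ π : Finpartition (Finset.univ : Finset (Fin (rows lam).length)),
      ∏ B ∈ π.parts, C ((-1) ^ (B.card - 1) * ((B.card - 1).factorial : F)) *
        X (∑ j ∈ B, (rows lam).get j).toPNat'

/-- The lexicographic order on partitions of `n`, a total order that refines dominance. -/
def lexLT (n : ℕ) (mu lam : n.Partition) : Prop := rows mu < rows lam

instance (n : ℕ) : IsTrans (n.Partition) (lexLT n) := ⟨fun _ _ _ h h' => lt_trans h h'⟩

instance (n : ℕ) : Std.Irrefl (lexLT n) := ⟨fun lam => lt_irrefl (rows lam)⟩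

theorem lexLT_wf (n : ℕ) : WellFounded (lexLT n) :=
  Finite.wellFounded_of_trans_of_irrefl _

open Classical in
/-- Macdonald's symmetric functions `P_λ(q, t)`: the Gram–Schmidt orthogonalization of the `m_λ`,
`P_λ = m_λ + lower terms`, for the `(q, t)`-pairing. -/
def macdonaldP {F : Type*} [Field F] (q t : F) {n : ℕ} : n.Partition → Sym F :=
  (lexLT_wf n).fix fun lam P => monomialSym lam -
    ∑ mu : {mu : n.Partition // lexLT n mu lam},
      C (qtPairing q t (monomialSym lam) (P mu.1 mu.2) /
        qtPairing q t (P mu.1 mu.2) (P mu.1 mu.2)) * P mu.1 mu.2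

/-- The boxes `(i, j)` (row, column; both from `0`) of the Young diagram. -/
def boxes {n : ℕ} (lam : n.Partition) : Finset (ℕ × ℕ) :=
  (Finset.range n ×ˢ Finset.range n).filter fun s => s.2 < (rows lam).getD s.1 0

/-- The arm length: boxes to the right in the same row. -/
def arm {n : ℕ} (lam : n.Partition) (s : ℕ × ℕ) : ℕ := (rows lam).getD s.1 0 - s.2 - 1

/-- The leg length: boxes below in the same column. -/
def leg {n : ℕ} (lam : n.Partition) (s : ℕ × ℕ) : ℕ :=
  (lam.parts.filter fun a => s.2 < a).card - s.1 - 1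

/-- `n(λ) = ∑_i (i - 1) λ_i`. -/
def nStat {n : ℕ} (lam : n.Partition) : ℕ := ∑ i ∈ Finset.range n, i * (rows lam).getD i 0

/-- The integral form `J_λ(q, t) = ∏ (1 - q ^ a t ^ (l + 1)) P_λ(q, t)`. -/
def macdonaldJ {F : Type*} [Field F] (q t : F) {n : ℕ} (lam : n.Partition) : Sym F :=
  C (∏ s ∈ boxes lam, (1 - q ^ arm lam s * t ^ (leg lam s + 1))) * macdonaldP q t lam

/-- The Garsia–Haiman (twisted) Macdonald polynomial
`H̃_λ(q, t; x) = t ^ n(λ) J_λ[X / (1 - t⁻¹); q, t⁻¹] = ∑_μ K̃_{μλ}(q, t) s_μ`; the plethysm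
`X / (1 - t⁻¹)` is `p_r ↦ p_r / (1 - t⁻ʳ)`. -/
def macdonaldH {F : Type*} [Field F] (q t : F) {n : ℕ} (lam : n.Partition) : Sym F :=
  C (t ^ nStat lam) *
    aeval (fun r : ℕ+ => C ((1 - t⁻¹ ^ (r : ℕ))⁻¹) * (X r : Sym F)) (macdonaldJ q t⁻¹ lam)

/-! ### The rational functions `ℍ_{μ,r}(z, w)` -/

/-- The field `ℚ(z, w)` of rational functions in two variables. -/
abbrev RatFun2 : Type := FractionRing (MvPolynomial (Fin 2) ℚ)

/-- The two variables. -/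
def var (i : Fin 2) : RatFun2 := algebraMap (MvPolynomial (Fin 2) ℚ) RatFun2 (X i)

/-- The Adams operation on `ℚ(z, w)`: `z ↦ z ^ d`, `w ↦ w ^ d`. -/
def adamsCoeff (d : ℕ+) : RatFun2 →+* RatFun2 :=
  IsFractionRing.map (A := MvPolynomial (Fin 2) ℚ) (B := MvPolynomial (Fin 2) ℚ)
    (j := (expand (d : ℕ) : MvPolynomial (Fin 2) ℚ →ₐ[ℚ] MvPolynomial (Fin 2) ℚ).toRingHom)
    (expand_injective d.pos)

/-- The Adams operation on `Λ ⊗ ℚ(z, w)`: every variable is replaced by its `d`-th power, so that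
`p_r(x_i) ↦ p_{dr}(x_i)`. -/
def adams {ι : Type*} (d : ℕ+) : MultiSym ι RatFun2 →+* MultiSym ι RatFun2 :=
  eval₂Hom (C.comp (adamsCoeff d)) fun s => X (s.1, d * s.2)

/-- The logarithm of a power series with constant term `1`. -/
def seriesLog {A : Type*} [CommRing A] [Algebra ℚ A] (f : PowerSeries A) : PowerSeries A :=
  PowerSeries.mk fun n => ∑ j ∈ Finset.Icc 1 n,
    ((-1 : ℚ) ^ (j - 1) / (j : ℚ)) • PowerSeries.coeff n ((f - 1) ^ j)

/-- The plethystic logarithm `Log F = ∑_{d ≥ 1} (μ(d) / d) ψ_d (log F)`, where `ψ_d` raises all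
variables, including the grading variable `T` of the power series, to the power `d`. -/
def plethLog {ι : Type*} (f : PowerSeries (MultiSym ι RatFun2)) :
    PowerSeries (MultiSym ι RatFun2) :=
  PowerSeries.mk fun n => ∑ d ∈ n.divisors,
    ((ArithmeticFunction.moebius d : ℚ) / (d : ℚ)) •
      adams d.toPNat' (PowerSeries.coeff (n / d) (seriesLog f))

/-- The hook function `𝓗_λ^{g,r}(z, w)`. -/
def hook (g r : ℕ) {n : ℕ} (lam : n.Partition) : RatFun2 :=
  ∏ s ∈ boxes lam,
    ((-(var 0 ^ (2 * arm lam s) * var 1 ^ (2 * leg lam s))) ^ r *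
        (var 0 ^ (2 * arm lam s + 1) - var 1 ^ (2 * leg lam s + 1)) ^ (2 * g)) /
      ((var 0 ^ (2 * arm lam s + 2) - var 1 ^ (2 * leg lam s)) *
        (var 0 ^ (2 * arm lam s) - var 1 ^ (2 * leg lam s + 2)))

/-- The Cauchy kernel `Ω_k^{g,r} = ∑_λ 𝓗_λ^{g,r}(z, w) ∏_i H̃_λ(z², w²; x_i)`; the variable of the
power series records `|λ|`. -/
def cauchyKernel (g r k : ℕ) : PowerSeries (MultiSym (Fin k) RatFun2) :=
  PowerSeries.mk fun n => ∑ lam : n.Partition, C (hook g r lam) *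
    ∏ i : Fin k, rename (fun s => (i, s)) (macdonaldH (var 0 ^ 2) (var 1 ^ 2) lam)

/-- `ℍ_{μ,r}(z, w) = (-1) ^ (r n) (z² - 1) (1 - w²) ⟨Log Ω_k^{g,r}, h_{μ¹} ⊗ ⋯ ⊗ h_{μᵏ}⟩`,
in genus `g`. -/
def HH (g r : ℕ) {k n : ℕ} (mu : Fin k → n.Partition) : RatFun2 :=
  (-1) ^ (r * n) * (var 0 ^ 2 - 1) * (1 - var 1 ^ 2) *
    hall (PowerSeries.coeff n (plethLog (cauchyKernel g r k))) (∏ i, completePart i (mu i))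

/-- The partition `(1ⁿ)`. -/
def ones (n : ℕ) : n.Partition where
  parts := Multiset.replicate n 1
  parts_pos h := by rw [Multiset.eq_of_mem_replicate h]; exact one_pos
  parts_sum := by simp

/-! ### Wild character varieties -/

/-- Diagonal matrices: the maximal torus `T`. -/
def IsTorus {n : ℕ} (M : GL (Fin n) ℂ) : Prop := M.val.IsDiag

/-- Diagonal matrices with pairwise distinct diagonal entries: `T^reg`. -/
def IsRegularTorus {n : ℕ} (M : GL (Fin n) ℂ) : Prop :=
  IsTorus M ∧ Function.Injective fun i => M.val i i

/-- Upper triangular matrices with `1` on the diagonal: `U₊`. -/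
def IsUpperUnipotent {n : ℕ} (M : GL (Fin n) ℂ) : Prop :=
  (∀ i, M.val i i = 1) ∧ ∀ i j, j < i → M.val i j = 0

/-- Lower triangular matrices with `1` on the diagonal: `U₋`. -/
def IsLowerUnipotent {n : ℕ} (M : GL (Fin n) ℂ) : Prop :=
  (∀ i, M.val i i = 1) ∧ ∀ i j, i < j → M.val i j = 0

/-- Genericity of a tuple of conjugacy classes. -/
def IsGeneric {n k : ℕ} (cl : Fin k → ConjClasses (GL (Fin n) ℂ)) : Prop :=
  ∀ (V : Submodule ℂ (Fin n → ℂ)) (M : Fin k → GL (Fin n) ℂ),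
    (∀ i, M i ∈ (cl i).carrier) →
    ∀ hV : ∀ i, ∀ v ∈ V, Matrix.toLin' (M i).val v ∈ V,
    ∏ i, LinearMap.det ((Matrix.toLin' (M i).val).restrict (hV i)) = 1 →
    V = ⊥ ∨ V = ⊤

/-- Tuples `(A_i, B_i, X_j, C_α, S^α, t_α)` of invertible matrices. -/
@[ext]
structure Tuple (n g k m : ℕ) (r : Fin m → ℕ) where
  A : Fin g → GL (Fin n) ℂ
  B : Fin g → GL (Fin n) ℂ
  X : Fin k → GL (Fin n) ℂ
  C : Fin m → GL (Fin n) ℂ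
  S : (α : Fin m) → Fin (2 * r α) → GL (Fin n) ℂ
  t : Fin m → GL (Fin n) ℂ

variable {n k m : ℕ}

/-- The variety `𝓤` of tuples with `X_j ∈ 𝓒_j`, `S^α_i ∈ U₊` for odd and `∈ U₋` for even `i`
(counted from `1`; here `S^α_{i + 1}` is `S α i`), `t_α ∈ T`, `t_α = ξ_α` and
`∏ (A_i, B_i) ∏ X_j ∏ C_α⁻¹ ξ_α S^α_{2 r_α} ⋯ S^α_1 C_α = 1`. -/
def solutionSet (g : ℕ) (cl : Fin k → ConjClasses (GL (Fin n) ℂ)) (r : Fin m → ℕ)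
    (ξ : Fin m → GL (Fin n) ℂ) : Set (Tuple n g k m r) :=
  {u | (∀ j, u.X j ∈ (cl j).carrier) ∧
    (∀ (α : Fin m) (i : Fin (2 * r α)), if Even (i : ℕ) then IsUpperUnipotent (u.S α i) else IsLowerUnipotent (u.S α i)) ∧
    (∀ α, IsTorus (u.t α)) ∧
    (List.ofFn fun i => u.A i * u.B i * (u.A i)⁻¹ * (u.B i)⁻¹).prod * (List.ofFn u.X).prod *
      (List.ofFn fun α => (u.C α)⁻¹ * ξ α * (List.ofFn (u.S α)).reverse.prod * u.C α).prod = 1 ∧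
    ∀ α, u.t α = ξ α}

/-- The action of `(y, x) ∈ G × T^m` on tuples. -/
def act {g : ℕ} {r : Fin m → ℕ} (y : GL (Fin n) ℂ) (x : Fin m → GL (Fin n) ℂ)
    (u : Tuple n g k m r) : Tuple n g k m r where
  A i := y * u.A i * y⁻¹
  B i := y * u.B i * y⁻¹
  X j := y * u.X j * y⁻¹
  C α := x α * u.C α * y⁻¹
  S α i := x α * u.S α i * (x α)⁻¹
  t := u.t

/-- All the matrices in a tuple. -/
inductive Slot (g k m : ℕ) (r : Fin m → ℕ) : Type
  | A (i : Fin g)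
  | B (i : Fin g)
  | X (j : Fin k)
  | C (α : Fin m)
  | S (α : Fin m) (i : Fin (2 * r α))
  | t (α : Fin m)

/-- The matrix of a tuple in a given slot. -/
def Tuple.get {g : ℕ} {r : Fin m → ℕ} (u : Tuple n g k m r) : Slot g k m r → GL (Fin n) ℂ
  | .A i => u.A i
  | .B i => u.B i
  | .X j => u.X j
  | .C α => u.C α
  | .S α i => u.S α i
  | .t α => u.t α

/-- The coordinate ring `ℂ[𝓤]`: the functions on `𝓤` that are polynomials in the entries of the
matrices and of their inverses. -/
def coordinateRing (g : ℕ) (cl : Fin k → ConjClasses (GL (Fin n) ℂ)) (r : Fin m → ℕ)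
    (ξ : Fin m → GL (Fin n) ℂ) : Subalgebra ℂ (solutionSet g cl r ξ → ℂ) :=
  Algebra.adjoin ℂ {f | ∃ (s : Slot g k m r) (i j : Fin n),
    (f = fun u => (u.1.get s).val i j) ∨ (f = fun u => ((u.1.get s)⁻¹).val i j)}

/-- The functions on `𝓤` that are constant along the action of `G × T^m`. -/
def invariantFunctions (g : ℕ) (cl : Fin k → ConjClasses (GL (Fin n) ℂ)) (r : Fin m → ℕ)
    (ξ : Fin m → GL (Fin n) ℂ) : Subalgebra ℂ (solutionSet g cl r ξ → ℂ) where
  carrier := {f | ∀ (y : GL (Fin n) ℂ) (x : Fin m → GL (Fin n) ℂ), (∀ α, IsTorus (x α)) →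
    ∀ u v : solutionSet g cl r ξ, v.1 = act y x u.1 → f v = f u}
  mul_mem' hf hf' y x hx u v h := by
    simp only [Pi.mul_apply, hf y x hx u v h, hf' y x hx u v h]
  add_mem' hf hf' y x hx u v h := by
    simp only [Pi.add_apply, hf y x hx u v h, hf' y x hx u v h]
  algebraMap_mem' _ _ _ _ _ _ _ := rfl

/-- The invariant ring `ℂ[𝓤]^{G × T^m}`. -/
def invariantRing (g : ℕ) (cl : Fin k → ConjClasses (GL (Fin n) ℂ)) (r : Fin m → ℕ)
    (ξ : Fin m → GL (Fin n) ℂ) : Subalgebra ℂ (solutionSet g cl r ξ → ℂ) :=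
  coordinateRing g cl r ξ ⊓ invariantFunctions g cl r ξ

/-- The wild character variety `𝓜_B = Spec ℂ[𝓤]^{G × T^m}` of genus `g`. -/
def wildVariety (g : ℕ) (cl : Fin k → ConjClasses (GL (Fin n) ℂ)) (r : Fin m → ℕ)
    (ξ : Fin m → GL (Fin n) ℂ) : Scheme.{0} :=
  Spec (CommRingCat.of (invariantRing g cl r ξ))

/-- The structure morphism of the wild character variety. -/
def wildVarietyMap (g : ℕ) (cl : Fin k → ConjClasses (GL (Fin n) ℂ)) (r : Fin m → ℕ)
    (ξ : Fin m → GL (Fin n) ℂ) : wildVariety g cl r ξ ⟶ Spec (CommRingCat.of ℂ) :=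
  Spec.map (CommRingCat.ofHom (algebraMap ℂ (invariantRing g cl r ξ)))

/-- `d_{μ,r} = (2g + k - 2) n² - ∑_j ∑_p (μ^j_p)² + n (n - 1) (m + ∑ r_α) + 2`. -/
def dimension (g : ℕ) (mu : Fin k → n.Partition) (r : Fin m → ℕ) : ℤ :=
  (2 * g + k - 2) * n ^ 2 - ((∑ j, ((mu j).parts.map (· ^ 2)).sum : ℕ) : ℤ) +
    n * (n - 1) * (m + ((∑ α, r α : ℕ) : ℤ)) + 2

/-! ### Complex points with the analytic topology -/

/-- The complex points of a scheme over `ℂ`. -/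
def CPoint {Z : Scheme.{0}} (f : Z ⟶ Spec (CommRingCat.of ℂ)) : Type :=
  {x : Spec (CommRingCat.of ℂ) ⟶ Z // x ≫ f = 𝟙 _}

/-- The analytic topology: the coarsest one for which `{x ∈ U(ℂ) | a(x) ∈ V}` is open for every
regular function `a` on a Zariski open `U` and every open `V ⊆ ℂ`. -/
instance {Z : Scheme.{0}} (f : Z ⟶ Spec (CommRingCat.of ℂ)) : TopologicalSpace (CPoint f) :=
  TopologicalSpace.generateFrom {O | ∃ (U : Z.Opens) (a : Γ(Z, U)) (V : Set ℂ), IsOpen V ∧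
    O = {x | ∃ h : ⊤ ≤ x.1 ⁻¹ᵁ U,
      (Scheme.ΓSpecIso (CommRingCat.of ℂ)).hom (x.1.appLE U ⊤ h a) ∈ V}}

/-- The map on complex points of a morphism over `ℂ`. -/
def CPoint.map {Z Z' : Scheme.{0}} {f : Z ⟶ Spec (CommRingCat.of ℂ)}
    {f' : Z' ⟶ Spec (CommRingCat.of ℂ)} (j : Z ⟶ Z') (hj : j ≫ f' = f) (x : CPoint f) :
    CPoint f' :=
  ⟨x.1 ≫ j, by rw [Category.assoc, hj, x.2]⟩

/-- A smooth compactification of `f : Z ⟶ Spec ℂ` whose boundary is a divisor with simple normal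
crossings, with components `D i`. -/
structure GoodCompactification {Z : Scheme.{0}} (f : Z ⟶ Spec (CommRingCat.of ℂ)) where
  Zbar : Scheme.{0}
  fbar : Zbar ⟶ Spec (CommRingCat.of ℂ)
  proper : IsProper fbar
  smooth : Smooth fbar
  j : Z ⟶ Zbar
  isOpen : IsOpenImmersion j
  comm : j ≫ fbar = f
  N : ℕ
  D : Fin N → Set Zbar
  range_eq : Set.range j = (⋃ i, D i)ᶜ
  /-- Around every point `x` the `D i` are cut out by functions `a i`, and those among them that
  vanish at `x` have linearly independent classes in the cotangent space `𝔪_x / 𝔪_x²`. -/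
  snc : ∀ x : Zbar, ∃ (U : Zbar.Opens) (hx : x ∈ U) (a : Fin N → Γ(Zbar, U)),
    (∀ i, ∀ y ∈ U, y ∈ D i ↔ y ∉ Zbar.basicOpen (a i)) ∧
    ∃ h : ∀ i : {i // x ∈ D i}, Zbar.presheaf.germ U x hx (a i.1) ∈
        IsLocalRing.maximalIdeal (Zbar.presheaf.stalk x),
      LinearIndependent (IsLocalRing.ResidueField (Zbar.presheaf.stalk x))
        fun i : {i // x ∈ D i} =>
          ((IsLocalRing.maximalIdeal (Zbar.presheaf.stalk x)).toCotangent ⟨_, h i⟩ :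
            IsLocalRing.CotangentSpace (Zbar.presheaf.stalk x))

/-! ### Singular cohomology and the weight filtration -/

/-- Singular `q`-simplices. -/
abbrev Simplex (Y : Type) [TopologicalSpace Y] (q : ℕ) : Type :=
  C(stdSimplex ℝ (Fin (q + 1)), Y)

/-- The `i`-th face of a singular simplex. -/
def face {Y : Type} [TopologicalSpace Y] {q : ℕ} (i : Fin (q + 2)) (σ : Simplex Y (q + 1)) :
    Simplex Y q :=
  σ.comp ⟨stdSimplex.map i.succAbove, stdSimplex.continuous_map _⟩

/-- The singular coboundary. -/
def coboundary (Y : Type) [TopologicalSpace Y] (q : ℕ) :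
    (Simplex Y q → ℚ) →ₗ[ℚ] (Simplex Y (q + 1) → ℚ) where
  toFun c σ := ∑ i : Fin (q + 2), (-1) ^ (i : ℕ) * c (face i σ)
  map_add' c c' := by
    funext σ
    simp [mul_add, Finset.sum_add_distrib]
  map_smul' a c := by
    funext σ
    simp [Finset.mul_sum, mul_left_comm]

/-- Rational cochains of `Y` that vanish on the simplices inside `A`. -/
def relCochains (Y : Type) [TopologicalSpace Y] (A : Set Y) (q : ℕ) :
    Submodule ℚ (Simplex Y q → ℚ) where
  carrier := {c | ∀ σ : Simplex Y q, Set.range σ ⊆ A → c σ = 0}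
  add_mem' h h' σ hσ := by simp [h σ hσ, h' σ hσ]
  zero_mem' _ _ := rfl
  smul_mem' a _ h σ hσ := by simp [h σ hσ]

/-- Relative cocycles. -/
def cocycles (Y : Type) [TopologicalSpace Y] (A : Set Y) (q : ℕ) :
    Submodule ℚ (Simplex Y q → ℚ) :=
  relCochains Y A q ⊓ LinearMap.ker (coboundary Y q)

/-- Relative coboundaries. -/
def coboundaries (Y : Type) [TopologicalSpace Y] (A : Set Y) :
    (q : ℕ) → Submodule ℚ (Simplex Y q → ℚ)
  | 0 => ⊥
  | q + 1 => (relCochains Y A q).map (coboundary Y q)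

/-- Singular cohomology `H^q(Y, A; ℚ)`; the absolute one is `A = ∅`. -/
abbrev Coh (Y : Type) [TopologicalSpace Y] (A : Set Y) (q : ℕ) : Type :=
  cocycles Y A q ⧸ (coboundaries Y A q).submoduleOf (cocycles Y A q)

/-- Families `b^{p,q}(I, σ)` indexed by tuples `I` of length `e + p` and singular `q`-simplices.
With a family `V` of subsets of `Y`, only the values for `σ` inside all `V (I i)` are used, so
that `b^{p,q}` is a cochain in `∏_I C^q(⋂ V_{I i})`. -/
abbrev DoubleCochain (e N : ℕ) (Y : Type) [TopologicalSpace Y] : Type :=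
  (p q : ℕ) → (Fin (e + p) → Fin N) → Simplex Y q → ℚ

/-- The Čech differential. -/
def cechD {e N : ℕ} {Y : Type} [TopologicalSpace Y] (b : DoubleCochain e N Y) :
    DoubleCochain e N Y
  | 0, _ => fun _ _ => 0
  | p + 1, q => fun I σ =>
    ∑ i : Fin (e + p + 1), (-1) ^ (i : ℕ) * b p q (fun j => I (i.succAbove j)) σ

/-- The singular differential. -/
def singD {e N : ℕ} {Y : Type} [TopologicalSpace Y] (b : DoubleCochain e N Y) :
    DoubleCochain e N Y
  | _, 0 => fun _ _ => 0
  | p, q + 1 => fun I σ => coboundary Y q (b p q I) σ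

/-- The differential of the total complex. -/
def totalD {e N : ℕ} {Y : Type} [TopologicalSpace Y] (b : DoubleCochain e N Y) :
    DoubleCochain e N Y :=
  fun p q I σ => cechD b p q I σ + (-1) ^ p * singD b p q I σ

/-- The `k`-cocycle `c`, as a cocycle of the total complex of `∏_I C^q(⋂ V_{I i})` in bidegree
`(0, k)`, is cohomologous to a total cocycle whose components of singular degree `q > l` vanish. -/
def Representable (e : ℕ) {N : ℕ} {Y : Type} [TopologicalSpace Y] (V : Fin N → Set Y) {k : ℕ}
    (c : Simplex Y k → ℚ) (l : ℤ) : Prop :=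
  ∃ b : DoubleCochain e N Y,
    (l < k → ∀ (I : Fin (e + 0) → Fin N) (σ : Simplex Y k),
      (∀ i, Set.range σ ⊆ V (I i)) → totalD b 0 k I σ = c σ) ∧
    ∀ p q : ℕ, p + 1 + q = k → l < q → ∀ (I : Fin (e + (p + 1)) → Fin N) (σ : Simplex Y q),
      (∀ i, Set.range σ ⊆ V (I i)) → totalD b (p + 1) q I σ = 0

section Weight

variable {Z : Scheme.{0}} {f : Z ⟶ Spec (CommRingCat.of ℂ)} (K : GoodCompactification f)

/-- Deligne's weight filtration on `H^k(Z(ℂ); ℚ)`, for smooth `Z`: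
`W_w H^k(Z) = im (ℍ^k(Z̄, τ_{≤ w - k} Rj_* ℚ) → H^k(Z))`, the Leray filtration of `j : Z → Z̄` with
the shift by `k`. The hypercohomology is the Čech hypercohomology, over the (finite) open covers
`U` of the compact space `Z̄(ℂ)`, of the truncated singular cochains `O ↦ C^*(j⁻¹ O)`; a total
cocycle is in the truncation if and only if its components of singular degree `> w - k` vanish. -/
def weight (k : ℕ) (w : ℤ) : Submodule ℚ (Coh (CPoint f) ∅ k) :=
  Submodule.span ℚ {x | ∃ c : cocycles (CPoint f) ∅ k, x = Submodule.Quotient.mk c ∧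
    ∃ (N : ℕ) (U : Fin N → Set (CPoint K.fbar)), (∀ i, IsOpen (U i)) ∧ (⋃ i, U i) = Set.univ ∧
      Representable 1 (fun i => CPoint.map K.j K.comm ⁻¹' U i) c.1 (w - k)}

/-- The complex points of the boundary component `D i`. -/
def boundary (i : Fin K.N) : Set (CPoint K.fbar) := {x | Set.range x.1 ⊆ K.D i}

/-- Compactly supported cohomology `H_c^k(Z(ℂ); ℚ) = H^k(Z̄(ℂ), D(ℂ); ℚ)`. -/
abbrev CohC (k : ℕ) : Type := Coh (CPoint K.fbar) (⋃ i, boundary K i) k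

/-- Deligne's weight filtration on `H_c^k(Z(ℂ); ℚ)`, for smooth `Z`: `H_c^k(Z)` is the cohomology
of the total complex of `C^*(Z̄) → ∏ C^*(D_i) → ∏ C^*(D_{i₁} ∩ D_{i₂}) → ⋯`, and `W_w` consists of
the classes of the total cocycles without components of singular degree `> w`. -/
def weightC (k : ℕ) (w : ℤ) : Submodule ℚ (CohC K k) :=
  Submodule.span ℚ {x | ∃ c : cocycles (CPoint K.fbar) (⋃ i, boundary K i) k,
    x = Submodule.Quotient.mk c ∧ Representable 0 (boundary K) c.1 w}

end Weight

/-- The dimension of `Gr^W_w` for an increasing filtration `W`. -/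
def grDim {H : Type} [AddCommGroup H] [Module ℚ H] (W : ℤ → Submodule ℚ H) (w : ℤ) : ℕ :=
  Module.finrank ℚ (W w ⧸ (W (w - 1)).submoduleOf (W w))

/-- `P = ∑_{w,k} dim Gr^W_w H^k(Z) q^{w/2} t^k` is the mixed Hodge polynomial `WH(Z; q, t)` of a
smooth variety `Z`; `q^{1/2}` and `t` are the variables `var 0` and `var 1`. -/
def IsWH {Z : Scheme.{0}} (f : Z ⟶ Spec (CommRingCat.of ℂ)) (P : RatFun2) : Prop :=
  Nonempty (GoodCompactification f) ∧ ∀ K : GoodCompactification f,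
    (∀ k, Module.Finite ℚ (Coh (CPoint f) ∅ k)) ∧
    {k | Nontrivial (Coh (CPoint f) ∅ k)}.Finite ∧
    P = ∑ᶠ s : ℕ × ℕ, (grDim (weight K s.2) s.1 : RatFun2) * (var 0 ^ s.1 * var 1 ^ s.2)

/-- `P = ∑_{w,k} dim Gr^W_w H_c^k(Z) q^{w/2} t^k` is the compactly supported mixed Hodge
polynomial of a smooth variety `Z`, in the same variables. -/
def IsWHc {Z : Scheme.{0}} (f : Z ⟶ Spec (CommRingCat.of ℂ)) (P : RatFun2) : Prop :=
  Nonempty (GoodCompactification f) ∧ ∀ K : GoodCompactification f,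
    (∀ k, Module.Finite ℚ (CohC K k)) ∧
    {k | Nontrivial (CohC K k)}.Finite ∧
    P = ∑ᶠ s : ℕ × ℕ, (grDim (weightC K s.2) s.1 : RatFun2) * (var 0 ^ s.1 * var 1 ^ s.2)

/-- The value `F(a, b)` of a rational function `F(z, w)`, through its reduced fraction. -/
def evalRat (F a b : RatFun2) : RatFun2 :=
  aeval ![a, b] (IsFractionRing.num (MvPolynomial (Fin 2) ℚ) F) /
    aeval ![a, b] (IsFractionRing.den (MvPolynomial (Fin 2) ℚ) F : MvPolynomial (Fin 2) ℚ)

/-- The right-hand side `(q t²) ^ d_{μ,r} ℍ_{μ̃,r}(q^{-1/2}, -t q^{1/2})` of the conjecture, with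
`μ̃ = (μ¹, …, μᵏ, (1ⁿ), …, (1ⁿ))` and `r = ∑ r_α`, in the variables `q^{1/2} = var 0` and
`t = var 1`. -/
def conjecturedWH (g : ℕ) (mu : Fin k → n.Partition) (r : Fin m → ℕ) : RatFun2 :=
  (var 0 ^ 2 * var 1 ^ 2) ^ dimension g mu r *
    evalRat (HH g (∑ α, r α) (Fin.append mu fun _ : Fin m => ones n))
      (var 0)⁻¹ (-(var 1 * var 0))

end

end WildChar

open WildChar

namespace WildChar

noncomputable section

open CategoryTheory AlgebraicGeometry MvPolynomial

set_option linter.unusedSectionVars false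

/-! ### Emptiness of the wild character variety -/

/-! Geometry. Conjugating the defining equation by `C` gives `ξ S₂ S₁ = 1` with `S₂` lower and `S₁`
upper unipotent. Uniqueness in the diagonal-lower-upper factorization forces `ξ = 1`, which is
impossible for a regular `ξ` when `n > 1`. So `𝓤` is empty, its ring of functions is the zero ring,
and the variety is the empty scheme. For every good compactification both cohomologies vanish, so
both mixed Hodge polynomials are `0`, and it remains to see that `ℍ` is `0`.

Combinatorics. Put `q = z²`, `τ = w⁻²`. The crucial fact is that for `g = 0`, `k = 1`, `r = 1` the
kernel is a plethystic exponential: its degree `n` part is `τⁿ (-1)ⁿ e_n[X / ((1 - q)(1 - τ))]`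
(`coeff_cauchyKernel`). Since `h_{(1ⁿ)} = p_1ⁿ`, the Hall pairing reads off the coefficient of
`p_1ⁿ`, so all `p_r` with `r > 1` may be set to `0`. This kills the positive-degree part of the
Adams operations `ψ_d`, `d > 1`, and turns the kernel into `exp(aT)`. Its logarithm is linear in
`T`, hence nothing is left in degree `n > 1` (`HH_eq_zero`).

Box by box, the kernel formula is the expansion `elemCoeff_eq_sum` of `(-1)ⁿ e_n[X / (1 - q)]` in
Macdonald's `P_λ(q, τ)`. It rests on the generating function `D(Y)` of Macdonald's `q`-difference
operators; `polyOp` is `D(Y)` multiplied by the Vandermonde determinant.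

The `P_λ` are given by Gram–Schmidt, so they must be shown to be eigenvectors of `D(Y)`. This
follows from triangularity (`polyOp_triangular`) and self-adjointness (`polyOp_adjoint`); the latter
says that `D(Y)` acts in the same way on both alphabets of the Cauchy kernel (`altOp_kernel_symm`),
which comes down to the symmetry of a Cauchy-type determinant. Setting variables to zero carries the
eigenvalue equation to any number `M` of variables. There `P_λ` vanishes if `λ` has more than `M`
rows, and equals `x_1 ⋯ x_M P_μ` if `λ` is `μ` with a column of length `M` added.

Finally, in `M` variables `D(-1)` maps `e_{m+M}[X / (1 - q)]` to `x_1 ⋯ x_M e_m[X / (1 - q)]` up to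
an explicit scalar (`polyOp_elemCoeff`). Comparing coefficients gives a recursion that strips the
first column of `λ` (`coeff_recursion`), and each step contributes exactly the factors of the boxes
in that column. -/

/-- The product of a diagonal, a lower and an upper unipotent matrix is `1` only if the diagonal
matrix is `1`. -/
theorem diag_eq_one_of_mul_eq_one {n : ℕ} {ξ L U : GL (Fin n) ℂ} (hξ : IsTorus ξ)
    (hL : IsLowerUnipotent L) (hU : IsUpperUnipotent U) (h : ξ * L * U = 1) (i : Fin n) :
    ξ.val i i = 1 := by
  have h1 : ξ.val * L.val * U.val = 1 := by simpa using congrArg Units.val h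
  have hξ' : ∀ a b, a ≠ b → ξ.val a b = 0 := fun a b hab => hξ hab
  have hξL : ∀ a b, (ξ.val * L.val) a b = ξ.val a a * L.val a b := fun a b => by
    rw [Matrix.mul_apply, Finset.sum_eq_single a]
    · intro c _ hc
      rw [hξ' a c (Ne.symm hc), zero_mul]
    · simp
  induction i using WellFoundedLT.induction with
  | _ i ih =>
    -- In the entry `(i, b)` of `ξ L U`, the terms `c < b` vanish by induction and the terms `c > b`
    -- because `U` is upper triangular. What remains is `ξ_ii L_ib = 0`, and `ξ_ii ≠ 0` since
    -- otherwise row `i` of the product would be zero.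
    have hrow : ∀ b : Fin n, b < i → L.val i b = 0 := by
      intro b
      induction b using WellFoundedLT.induction with
      | _ b ihb =>
        intro hb
        have h2 := congrFun (congrFun h1 i) b
        rw [Matrix.mul_apply, Finset.sum_eq_single b, hξL, hU.1 b, mul_one,
          Matrix.one_apply_ne hb.ne'] at h2
        · have hne : ξ.val i i ≠ 0 := by
            intro h0
            have h3 := congrFun (congrFun h1 i) i
            rw [Matrix.mul_apply, Finset.sum_eq_zero] at h3
            · simp at h3
            · intro c _
              rw [hξL, h0]; simp
          exact (mul_eq_zero.mp h2).resolve_left hne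
        · intro c _ hc
          rcases lt_or_gt_of_ne hc with hc | hc
          · rw [hξL, ihb c hc (hc.trans hb)]; simp
          · rw [hU.2 c b hc, mul_zero]
        · simp
    have h3 := congrFun (congrFun h1 i) i
    rw [Matrix.mul_apply, Finset.sum_eq_single i, hξL, hU.1 i, hL.1 i, Matrix.one_apply_eq] at h3
    · simpa using h3
    · intro c _ hc
      rcases lt_or_gt_of_ne hc with hc | hc
      · rw [hξL, hrow c hc]; simp
      · rw [hU.2 c i hc, mul_zero]
    · simp

theorem isEmpty_solutionSet {n : ℕ} (hn : 1 < n) {ξ : GL (Fin n) ℂ} (hreg : IsRegularTorus ξ) :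
    IsEmpty (solutionSet 0 (![] : Fin 0 → ConjClasses (GL (Fin n) ℂ)) ![1] ![ξ]) := by
  refine ⟨fun ⟨u, _, hS, _, hprod, _⟩ => ?_⟩
  -- Indices start at `0`: slot `0` is `S₁ ∈ U₊` and slot `1` is `S₂ ∈ U₋`. The reversed list has
  -- product `S₂ S₁`.
  have hU : IsUpperUnipotent (u.S 0 (0 : Fin 2)) := by simpa using hS 0 (0 : Fin 2)
  have hL : IsLowerUnipotent (u.S 0 (1 : Fin 2)) := by simpa using hS 0 (1 : Fin 2)
  have hrev : (List.ofFn (u.S 0)).reverse.prod = u.S 0 (1 : Fin 2) * u.S 0 (0 : Fin 2) := by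
    have h2 : ∀ s : Fin 2 → GL (Fin n) ℂ, List.ofFn s = [s 0, s 1] := fun s => by
      simp [List.ofFn_succ]
    have : List.ofFn (u.S 0) = [u.S 0 (0 : Fin 2), u.S 0 (1 : Fin 2)] := h2 (u.S 0)
    rw [this]; simp
  have h1 : ξ * u.S 0 (1 : Fin 2) * u.S 0 (0 : Fin 2) = 1 := by
    have h2 : (u.C 0)⁻¹ * ξ * (List.ofFn (u.S 0)).reverse.prod * u.C 0 = 1 := by
      simpa [List.ofFn_succ] using hprod
    rw [hrev] at h2
    have h3 := congrArg (fun m => u.C 0 * m * (u.C 0)⁻¹) h2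
    simpa [mul_assoc] using h3
  have h := diag_eq_one_of_mul_eq_one hreg.1 hL hU h1
  have := hreg.2 ((h ⟨0, by omega⟩).trans (h ⟨1, hn⟩).symm)
  simp at this

/-- On an empty set any two functions agree, so the invariant ring is the zero ring and has no
primes. -/
theorem isEmpty_wildVariety {n k m g : ℕ} {cl : Fin k → ConjClasses (GL (Fin n) ℂ)}
    {r : Fin m → ℕ} {ξ : Fin m → GL (Fin n) ℂ} (h : IsEmpty (solutionSet g cl r ξ)) :
    IsEmpty (wildVariety g cl r ξ) := by
  have : Subsingleton (invariantRing g cl r ξ) := ⟨fun a b => Subtype.ext (Subsingleton.elim _ _)⟩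
  change IsEmpty (PrimeSpectrum (invariantRing g cl r ξ))
  infer_instance

/-! ### Cohomology of the empty variety -/

/-- A relative cochain vanishes on all simplices inside `A`. Serves twice: an empty space has no
simplices, and for compact supports the boundary is all of `Z̄(ℂ)`. -/
theorem subsingleton_coh_of_relCochains {Y : Type} [TopologicalSpace Y] {A : Set Y} {q : ℕ}
    (h : ∀ σ : Simplex Y q, Set.range σ ⊆ A) : Subsingleton (Coh Y A q) := by
  have : Subsingleton (cocycles Y A q) := by
    refine ⟨fun a b => Subtype.ext (funext fun σ => ?_)⟩
    rw [a.2.1 σ (h σ), b.2.1 σ (h σ)]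
  infer_instance

theorem isEmpty_cPoint {Z : Scheme.{0}} (hZ : IsEmpty Z) (f : Z ⟶ Spec (CommRingCat.of ℂ)) :
    IsEmpty (CPoint f) := by
  refine ⟨fun x => ?_⟩
  have y : Spec (CommRingCat.of ℂ) := (⊥ : PrimeSpectrum ℂ)
  exact hZ.elim (x.1 y)

theorem subsingleton_coh_of_isEmpty {Y : Type} [TopologicalSpace Y] [IsEmpty Y] (q : ℕ) :
    Subsingleton (Coh Y ∅ q) := by
  refine subsingleton_coh_of_relCochains fun σ => ?_
  have y : stdSimplex ℝ (Fin (q + 1)) := Classical.arbitrary _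
  exact isEmptyElim (σ y)

/-- The complement of the components is the image of `Z`, which is empty. A complex point has a
single image point because `Spec ℂ` has one point, so it lies entirely in one component. This holds
for every compactification, so `H_c` is the cohomology of a space relative to itself. -/
theorem iUnion_boundary {Z : Scheme.{0}} (hZ : IsEmpty Z) {f : Z ⟶ Spec (CommRingCat.of ℂ)}
    (K : GoodCompactification f) : ⋃ i, boundary K i = Set.univ := by
  have h : ⋃ i, K.D i = Set.univ := by
    rw [← compl_compl (⋃ i, K.D i), ← K.range_eq, Set.range_eq_empty, Set.compl_empty]
  refine Set.eq_univ_of_forall fun x => ?_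
  have y : Spec (CommRingCat.of ℂ) := (⊥ : PrimeSpectrum ℂ)
  obtain ⟨i, hi⟩ := Set.mem_iUnion.mp (h.symm ▸ Set.mem_univ (x.1 y))
  refine Set.mem_iUnion.mpr ⟨i, ?_⟩
  rintro _ ⟨y', rfl⟩
  have : Subsingleton (Spec (CommRingCat.of ℂ)) :=
    inferInstanceAs (Subsingleton (PrimeSpectrum ℂ))
  rwa [Subsingleton.elim y' y]

/-- The empty scheme compactifies itself without boundary: its morphism to `Spec ℂ` is both a closed
immersion, hence proper, and an open immersion, hence smooth. -/
theorem nonempty_goodCompactification {Z : Scheme.{0}} (hZ : IsEmpty Z)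
    (f : Z ⟶ Spec (CommRingCat.of ℂ)) : Nonempty (GoodCompactification f) := by
  have := hZ
  refine ⟨⟨Z, f, ?_, ?_, 𝟙 Z, inferInstance, Category.id_comp f, 0, Fin.elim0, ?_,
    fun x => hZ.elim x⟩⟩
  · have : IsClosedImmersion f := inferInstance
    infer_instance
  · have : IsOpenImmersion f := inferInstance
    infer_instance
  · ext x; exact hZ.elim x

theorem grDim_of_subsingleton {H : Type} [AddCommGroup H] [Module ℚ H] [Subsingleton H]
    (W : ℤ → Submodule ℚ H) (w : ℤ) : grDim W w = 0 := by
  have : Subsingleton (W w ⧸ (W (w - 1)).submoduleOf (W w)) := inferInstance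
  exact Module.finrank_zero_of_subsingleton

theorem isWH_of_isEmpty {Z : Scheme.{0}} (hZ : IsEmpty Z) (f : Z ⟶ Spec (CommRingCat.of ℂ)) :
    IsWH f 0 := by
  refine ⟨nonempty_goodCompactification hZ f, fun K => ?_⟩
  have := isEmpty_cPoint hZ f
  have hs := subsingleton_coh_of_isEmpty (Y := CPoint f)
  refine ⟨fun k => inferInstance, ?_, ?_⟩
  · convert Set.finite_empty
    ext k
    simp [not_nontrivial]
  · simp [grDim_of_subsingleton]

theorem isWHc_of_isEmpty {Z : Scheme.{0}} (hZ : IsEmpty Z) (f : Z ⟶ Spec (CommRingCat.of ℂ)) :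
    IsWHc f 0 := by
  refine ⟨nonempty_goodCompactification hZ f, fun K => ?_⟩
  have hs : ∀ k, Subsingleton (CohC K k) := fun k =>
    subsingleton_coh_of_relCochains fun σ => by rw [iUnion_boundary hZ K]; exact Set.subset_univ _
  refine ⟨fun k => inferInstance, ?_, ?_⟩
  · convert Set.finite_empty
    ext k
    simp [not_nontrivial]
  · simp [grDim_of_subsingleton]

theorem conjecturedWH_eq_zero {n : ℕ} (h : HH 0 1 (fun _ : Fin 1 => ones n) = 0) :
    conjecturedWH 0 (![] : Fin 0 → n.Partition) ![1] = 0 := by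
  have h1 : HH 0 (∑ α, (![1] : Fin 1 → ℕ) α)
      (Fin.append (![] : Fin 0 → n.Partition) fun _ : Fin 1 => ones n) = 0 := by
    have h2 : ∑ α, (![1] : Fin 1 → ℕ) α = 1 := by simp
    rw [h2, ← h]
    congr 1
    funext i
    have : i = Fin.natAdd 0 (0 : Fin 1) := Subsingleton.elim (α := Fin 1) _ _
    rw [this, Fin.append_right]
  -- The reduced numerator of `0` is `0`, so the value of the denominator plays no role.
  rw [conjecturedWH, h1, evalRat]
  simp

/-! ### Sums over set partitions -/

/-- A set partition is its block `B` through `a` together with a partition of the rest. This is the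
recursion that drives the Möbius inversion. -/
theorem sum_finpartition_eq {α R : Type*} [Fintype α] [DecidableEq α] [CommSemiring R]
    (g : Finset α → R) {s : Finset α} {a : α} (ha : a ∈ s) :
    ∑ π : Finpartition s, ∏ B ∈ π.parts, g B =
      ∑ B ∈ s.powerset with a ∈ B,
        g B * ∑ π : Finpartition (s \ B), ∏ C ∈ π.parts, g C := by
  simp_rw [Finset.mul_sum]
  rw [Finset.sum_sigma']
  symm
  have key : ∀ x ∈ (s.powerset.filter (a ∈ ·)).sigma
      (fun B => (Finset.univ : Finset (Finpartition (s \ B)))), a ∈ x.1 ∧ x.1 ⊆ s := by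
    intro x hx
    simp only [Finset.mem_sigma, Finset.mem_filter, Finset.mem_powerset] at hx
    exact ⟨hx.1.2, hx.1.1⟩
  have hnm : ∀ (B : Finset α) (π : Finpartition (s \ B)), a ∈ B → B ∉ π.parts := fun B π hB h =>
    (Finset.mem_sdiff.mp (π.subset h hB)).2 hB
  refine Finset.sum_bij (fun x hx => x.2.extend (b := x.1) (c := s)
    (Finset.nonempty_iff_ne_empty.mp ⟨a, (key x hx).1⟩) Finset.sdiff_disjoint
    (Finset.sdiff_union_of_subset (key x hx).2)) (fun _ _ => Finset.mem_univ _) ?_ ?_ ?_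
  · rintro ⟨B, π⟩ hx ⟨B', π'⟩ hx' h
    have hp : insert B π.parts = insert B' π'.parts := congrArg Finpartition.parts h
    have hB := (key _ hx).1
    have hB' := (key _ hx').1
    have hBB : B = B' := by
      have h1 : B ∈ insert B' π'.parts := hp ▸ Finset.mem_insert_self _ _
      rcases Finset.mem_insert.mp h1 with h1 | h1
      · exact h1
      · exact absurd hB' (Finset.mem_sdiff.mp (π'.subset h1 hB)).2
    subst hBB
    have : π = π' := by
      apply Finpartition.ext
      rw [← Finset.erase_insert (hnm B π hB), hp, Finset.erase_insert (hnm B π' hB)]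
    rw [this]
  · intro π _
    have hm : π.part a ∈ π.parts := π.part_mem.mpr ha
    have hs : (π.parts.erase (π.part a)).sup id = s \ π.part a := by
      ext b
      simp only [Finset.mem_sup, Finset.mem_erase, id, Finset.mem_sdiff]
      constructor
      · rintro ⟨t, ⟨ht, htp⟩, hb⟩
        exact ⟨π.subset htp hb, fun hb' => ht (π.eq_of_mem_parts htp hm hb hb')⟩
      · rintro ⟨hb, hb'⟩
        obtain ⟨t, ht, hbt⟩ := π.exists_mem hb
        exact ⟨t, ⟨fun h => hb' (h ▸ hbt), ht⟩, hbt⟩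
    refine ⟨⟨π.part a, π.ofSubset (Finset.erase_subset _ _) hs⟩, ?_, ?_⟩
    · simp [ha, π.part_subset]
    · apply Finpartition.ext
      exact Finset.insert_erase hm
  · rintro ⟨B, π⟩ hx
    change g B * _ = ∏ C ∈ insert B π.parts, g C
    rw [Finset.prod_insert (hnm B π (key _ hx).1)]

open Classical in
/-- Möbius inversion on the partition lattice: the signed count of the set partitions that refine
the fibres of `f`. -/
theorem sum_finpartition_moebius {α β F : Type*} [Fintype α] [DecidableEq α] [Field F]
    (f : α → β) (s : Finset α) :
    ∑ π : Finpartition s, ∏ B ∈ π.parts,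
      (if ∀ x ∈ B, ∀ y ∈ B, f x = f y then (-1) ^ (B.card - 1) * ((B.card - 1).factorial : F)
        else 0) = if Set.InjOn f s then 1 else 0 := by
  induction s using Finset.strongInduction with
  | H s ih =>
    rcases s.eq_empty_or_nonempty with rfl | ⟨a, ha⟩
    · have : Unique (Finpartition (∅ : Finset α)) :=
        inferInstanceAs (Unique (Finpartition (⊥ : Finset α)))
      have h0 : (default : Finpartition (∅ : Finset α)).parts = ∅ := by
        rw [Finpartition.parts_eq_empty_iff]; rfl
      simp [h0]
    -- Let `C` be the fibre of `f` through `a`. By induction a block `B ∋ a` contributes only if `B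
    -- ⊆ C` and `f` is injective off `B`, that is, if `B` is `C` or `C` without one point other than
    -- `a`.
    rw [sum_finpartition_eq _ ha]
    set C := s.filter (fun x => f x = f a) with hC
    have haC : a ∈ C := by simp [hC, ha]
    have hstep : ∀ B ∈ s.powerset.filter (a ∈ ·),
        (if ∀ x ∈ B, ∀ y ∈ B, f x = f y then
          (-1) ^ (B.card - 1) * ((B.card - 1).factorial : F) else 0) *
        ∑ π : Finpartition (s \ B), ∏ B ∈ π.parts,
          (if ∀ x ∈ B, ∀ y ∈ B, f x = f y then
            (-1) ^ (B.card - 1) * ((B.card - 1).factorial : F) else 0) =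
        if B ⊆ C ∧ Set.InjOn f ↑(s \ B) then
          (-1) ^ (B.card - 1) * ((B.card - 1).factorial : F) else 0 := by
      intro B hB
      simp only [Finset.mem_filter, Finset.mem_powerset] at hB
      rw [ih (s \ B) (Finset.sdiff_ssubset hB.1 ⟨a, hB.2⟩)]
      have h1 : (∀ x ∈ B, ∀ y ∈ B, f x = f y) ↔ B ⊆ C := by
        constructor
        · intro h x hx
          simp [hC, hB.1 hx, h x hx a hB.2]
        · intro h x hx y hy
          have hx' := h hx
          have hy' := h hy
          simp only [hC, Finset.mem_filter] at hx' hy'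
          rw [hx'.2, hy'.2]
      rw [if_congr h1 rfl rfl]
      by_cases h2 : B ⊆ C <;> by_cases h3 : Set.InjOn f ↑(s \ B) <;> simp [h2, h3]
    rw [Finset.sum_congr rfl hstep]
    by_cases hinj : Set.InjOn f ↑(s \ C)
    swap
    · rw [Finset.sum_eq_zero, if_neg]
      · exact fun h => hinj (h.mono (by simp))
      · intro B _
        rw [if_neg]
        rintro ⟨h1, h2⟩
        exact hinj (h2.mono (Finset.coe_subset.mpr (Finset.sdiff_subset_sdiff subset_rfl h1)))
    have hCs : C ⊆ s := Finset.filter_subset _ _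
    -- the sets that contribute are `C` and `C \ {x}`
    have hiff : ∀ B ∈ s.powerset.filter (a ∈ ·), (B ⊆ C ∧ Set.InjOn f ↑(s \ B)) ↔
        B ∈ insert C ((C.erase a).image fun x => C.erase x) := by
      intro B hB
      simp only [Finset.mem_filter, Finset.mem_powerset] at hB
      simp only [Finset.mem_insert, Finset.mem_image, Finset.mem_erase]
      constructor
      · rintro ⟨h1, h2⟩
        by_cases h3 : B = C
        · exact Or.inl h3
        · obtain ⟨x, hxC, hxB⟩ := Finset.exists_of_ssubset (lt_of_le_of_ne h1 h3)
          refine Or.inr ⟨x, ⟨fun h => hxB (h ▸ hB.2), hxC⟩, ?_⟩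
          ext y
          simp only [Finset.mem_erase]
          constructor
          · rintro ⟨hy, hyC⟩
            by_contra hyB
            refine hy (h2 ?_ ?_ ?_)
            · simp [hCs hyC, hyB]
            · simp [hCs hxC, hxB]
            · rw [(Finset.mem_filter.mp hyC).2, (Finset.mem_filter.mp hxC).2]
          · intro hyB
            exact ⟨fun h => hxB (h ▸ hyB), h1 hyB⟩
      · rintro (rfl | ⟨x, ⟨hxa, hxC⟩, rfl⟩)
        · exact ⟨subset_rfl, hinj⟩
        · refine ⟨Finset.erase_subset _ _, ?_⟩
          have hfx : ∀ y ∈ (↑(s \ C.erase x) : Set α), f y = f a → y = x := by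
            intro y hy hya
            simp only [Finset.coe_sdiff, Set.mem_sdiff, Finset.mem_coe, Finset.mem_erase, not_and]
              at hy
            by_contra hyx
            exact hy.2 hyx (Finset.mem_filter.mpr ⟨hy.1, hya⟩)
          have hxa' := (Finset.mem_filter.mp hxC).2
          intro y hy z hz hyz
          by_cases hya : f y = f a
          · rw [hfx y hy hya, hfx z hz (hyz ▸ hya)]
          · have hza : f z ≠ f a := hyz ▸ hya
            refine hinj ?_ ?_ hyz
            · have := (Finset.mem_sdiff.mp (Finset.mem_coe.mp hy)).1
              simp [hC, this, hya]
            · have := (Finset.mem_sdiff.mp (Finset.mem_coe.mp hz)).1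
              simp [hC, this, hza]
    rw [← Finset.sum_filter, Finset.filter_congr hiff]
    have hset : Finset.filter (fun B => B ∈ insert C ((C.erase a).image fun x => C.erase x))
        (s.powerset.filter (a ∈ ·)) = insert C ((C.erase a).image fun x => C.erase x) := by
      rw [Finset.filter_mem_eq_inter, Finset.inter_eq_right]
      intro B hB
      simp only [Finset.mem_insert, Finset.mem_image, Finset.mem_erase] at hB
      rcases hB with rfl | ⟨x, ⟨hxa, hxC⟩, rfl⟩
      · simp [hCs, haC]
      · simp [haC, Ne.symm hxa, (Finset.erase_subset x C).trans hCs]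
    rw [hset, Finset.sum_insert, Finset.sum_image]
    · have hcard : ∀ x ∈ C.erase a, (-1) ^ ((C.erase x).card - 1) *
          (((C.erase x).card - 1).factorial : F) =
          (-1) ^ (C.card - 2) * ((C.card - 2).factorial : F) := by
        intro x hx
        rw [Finset.card_erase_of_mem (Finset.mem_of_mem_erase hx), Nat.sub_sub]
      -- With `c = |C|` the total is `(-1)^(c-1) (c-1)! + (c-1) (-1)^(c-2) (c-2)!`, which cancels
      -- unless `c = 1`.
      rw [Finset.sum_congr rfl hcard, Finset.sum_const, Finset.card_erase_of_mem haC]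
      have hiff2 : Set.InjOn f ↑s ↔ C.card = 1 := by
        rw [Finset.card_eq_one]
        constructor
        · intro h
          refine ⟨a, ?_⟩
          ext x
          simp only [hC, Finset.mem_filter, Finset.mem_singleton]
          constructor
          · rintro ⟨hx, hxa⟩
            exact h hx ha hxa
          · rintro rfl
            exact ⟨ha, rfl⟩
        · rintro ⟨b, hb⟩
          have hba : a = b := by
            have := haC
            rw [hb] at this
            simpa using this
          subst hba
          have hfa : ∀ y ∈ s, f y = f a → y = a := by
            intro y hy hya
            have : y ∈ C := Finset.mem_filter.mpr ⟨hy, hya⟩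
            rw [hb] at this
            simpa using this
          intro y hy z hz hyz
          by_cases hya : f y = f a
          · rw [hfa y hy hya, hfa z hz (hyz ▸ hya)]
          · have hza : f z ≠ f a := hyz ▸ hya
            refine hinj ?_ ?_ hyz
            · have := Finset.mem_coe.mp hy
              simp [hC, this, hya]
            · have := Finset.mem_coe.mp hz
              simp [hC, this, hza]
      rw [if_congr hiff2 rfl rfl]
      have hpos : 1 ≤ C.card := Finset.card_pos.mpr ⟨a, haC⟩
      obtain ⟨c, hc⟩ : ∃ c, C.card = c + 1 := ⟨C.card - 1, by omega⟩
      rw [hc]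
      rcases c with _ | c
      · simp
      · simp only [Nat.add_sub_cancel, show c + 1 + 1 - 2 = c by omega, nsmul_eq_mul,
          Nat.factorial_succ, Nat.cast_mul, pow_succ]
        rw [if_neg (by omega)]
        ring
    · intro x hx y hy hxy
      by_contra hne
      have h1 : y ∈ C.erase x := Finset.mem_erase.mpr ⟨Ne.symm hne, (Finset.mem_erase.mp hy).2⟩
      change C.erase x = C.erase y at hxy
      rw [hxy] at h1
      simp at h1
    · simp only [Finset.mem_image, not_exists, not_and]
      intro x hx h
      have := Finset.mem_of_mem_erase hx
      rw [← h] at this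
      simp at this

/-! ### Monomial symmetric functions in finitely many variables -/

theorem prod_parts_eq {α M : Type*} [DecidableEq α] [CommMonoid M] {s : Finset α}
    (π : Finpartition s) (h : α → M) : ∏ B ∈ π.parts, ∏ j ∈ B, h j = ∏ j ∈ s, h j := by
  conv_rhs => rw [← π.biUnion_parts]
  exact (Finset.prod_biUnion π.supIndep.pairwiseDisjoint).symm

-- Expanding the product chooses one variable for each block, which is the same as a map on `α` that
-- is constant on blocks.
open Classical in
theorem prod_sum_parts {α β R : Type*} [Fintype α] [DecidableEq α] [Fintype β] [CommSemiring R]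
    (π : Finpartition (Finset.univ : Finset α)) (x : β → R) (l : α → ℕ) :
    ∏ B ∈ π.parts, ∑ i, x i ^ (∑ j ∈ B, l j) =
      ∑ f : α → β with ∀ B ∈ π.parts, ∀ a ∈ B, ∀ b ∈ B, f a = f b, ∏ j, x (f j) ^ l j := by
  rw [← Finset.prod_coe_sort π.parts fun B => ∑ i, x i ^ (∑ j ∈ B, l j), Fintype.prod_sum]
  have hp : ∀ j, π.part j ∈ π.parts := fun j => π.part_mem.mpr (Finset.mem_univ j)
  refine Finset.sum_bij' (fun g _ j => g ⟨π.part j, hp j⟩)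
    (fun f _ B => f (π.nonempty_of_mem_parts B.2).choose) ?_ (fun _ _ => Finset.mem_univ _)
    ?_ ?_ ?_
  · intro g _
    simp only [Finset.mem_filter, Finset.mem_univ, true_and]
    intro B hB a ha b hb
    congr 2
    rw [π.part_eq_of_mem hB ha, π.part_eq_of_mem hB hb]
  · intro g _
    funext B
    change g _ = g _
    congr 1
    exact Subtype.ext (π.part_eq_of_mem B.2 (π.nonempty_of_mem_parts B.2).choose_spec)
  · intro f hf
    simp only [Finset.mem_filter, Finset.mem_univ, true_and] at hf
    funext j
    exact hf _ (hp j) _ (π.nonempty_of_mem_parts (hp j)).choose_spec _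
      (π.mem_part_self.mpr (Finset.mem_univ j))
  · intro g _
    rw [← prod_parts_eq π, ← Finset.prod_coe_sort π.parts]
    refine Finset.prod_congr rfl fun B _ => ?_
    rw [← Finset.prod_pow_eq_pow_sum]
    refine Finset.prod_congr rfl fun j hj => ?_
    congr 3
    exact Subtype.ext (π.part_eq_of_mem B.2 hj).symm

open Classical in
/-- Power sums of set partitions, weighted by the Möbius function, give the sum over injective
maps. -/
theorem sum_moebius_psum {α β F : Type*} [Fintype α] [DecidableEq α] [Fintype β] [Field F]
    {R : Type*} [CommRing R] [Algebra F R] (x : β → R) (l : α → ℕ) :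
    ∑ π : Finpartition (Finset.univ : Finset α), ∏ B ∈ π.parts,
      (algebraMap F R ((-1) ^ (B.card - 1) * ((B.card - 1).factorial : F)) *
        ∑ i, x i ^ (∑ j ∈ B, l j)) =
      ∑ f : α → β with Function.Injective f, ∏ j, x (f j) ^ l j := by
  -- After exchanging the sums, the coefficient attached to a fixed `f` is the Möbius count of
  -- partitions refining its fibres: `1` if `f` is injective and `0` otherwise.
  simp_rw [Finset.prod_mul_distrib, prod_sum_parts, Finset.sum_filter, Finset.mul_sum]
  rw [Finset.sum_comm]
  refine Finset.sum_congr rfl fun f _ => ?_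
  have h := congrArg (algebraMap F R) (sum_finpartition_moebius (F := F) f Finset.univ)
  rw [map_sum] at h
  have hterm : ∀ π : Finpartition (Finset.univ : Finset α),
      ((∏ B ∈ π.parts, algebraMap F R ((-1) ^ (B.card - 1) * ((B.card - 1).factorial : F))) *
        if ∀ B ∈ π.parts, ∀ a ∈ B, ∀ b ∈ B, f a = f b then ∏ j, x (f j) ^ l j else 0) =
      algebraMap F R (∏ B ∈ π.parts, if ∀ a ∈ B, ∀ b ∈ B, f a = f b then
        (-1) ^ (B.card - 1) * ((B.card - 1).factorial : F) else 0) * ∏ j, x (f j) ^ l j := by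
    intro π
    split_ifs with h1
    · rw [map_prod]
      congr 1
      refine Finset.prod_congr rfl fun B hB => ?_
      rw [if_pos (h1 B hB)]
    · push Not at h1
      obtain ⟨B, hB, a, ha, b, hb, hab⟩ := h1
      rw [mul_zero, Finset.prod_eq_zero hB (if_neg fun h => hab (h a ha b hb)), map_zero, zero_mul]
  rw [Finset.sum_congr rfl fun π _ => hterm π, ← Finset.sum_mul, h]
  simp only [Finset.coe_univ, Set.injOn_univ]
  split_ifs <;> simp

section

variable {F : Type*} [Field F]

/-- A symmetric function as a symmetric polynomial in `N` variables. -/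
def toPoly (F : Type*) [Field F] (N : ℕ) : Sym F →ₐ[F] MvPolynomial (Fin N) F :=
  aeval fun r : ℕ+ => psum (Fin N) F r

@[simp] theorem toPoly_X (N : ℕ) (r : ℕ+) : toPoly F N (X r) = psum (Fin N) F r := by
  simp [toPoly]

theorem isSymmetric_toPoly (N : ℕ) (f : Sym F) : (toPoly F N f).IsSymmetric := by
  induction f using MvPolynomial.induction_on with
  | C a => rw [algHom_C]; exact IsSymmetric.C a
  | add p q hp hq => rw [map_add]; exact hp.add hq
  | mul_X p r hp => rw [map_mul, toPoly_X]; exact hp.mul (psum_isSymmetric _ _ _)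

/-- The exponent of the leading monomial of `m_λ` in `N` variables. -/
def expo (N : ℕ) {n : ℕ} (lam : n.Partition) : Fin N →₀ ℕ :=
  Finsupp.equivFunOnFinite.symm fun i => (rows lam).getD i 0

@[simp] theorem expo_apply (N : ℕ) {n : ℕ} (lam : n.Partition) (i : Fin N) :
    expo N lam i = (rows lam).getD i 0 := rfl

theorem coe_rows {n : ℕ} (lam : n.Partition) : (rows lam : Multiset ℕ) = lam.parts :=
  Multiset.sort_eq _ _

theorem rows_injective {n : ℕ} : Function.Injective (rows : n.Partition → List ℕ) := by
  intro lam mu h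
  apply Nat.Partition.ext
  rw [← coe_rows, h, coe_rows]

theorem mem_rows {n : ℕ} {lam : n.Partition} {a : ℕ} : a ∈ rows lam ↔ a ∈ lam.parts := by
  rw [← coe_rows, Multiset.mem_coe]

theorem rows_get_pos {n : ℕ} (lam : n.Partition) (j : Fin (rows lam).length) :
    0 < (rows lam).get j :=
  lam.parts_pos (mem_rows.mp (List.get_mem _ _))

theorem rows_sorted {n : ℕ} (lam : n.Partition) : (rows lam).Pairwise (· ≥ ·) :=
  Multiset.pairwise_sort _ _

theorem rows_sum {n : ℕ} (lam : n.Partition) : (rows lam).sum = n := by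
  rw [← Multiset.sum_coe, coe_rows, lam.parts_sum]

theorem length_rows_le {n : ℕ} (lam : n.Partition) : (rows lam).length ≤ n := by
  conv_rhs => rw [← rows_sum lam]
  refine List.length_le_sum_of_one_le _ fun a ha => ?_
  exact lam.parts_pos (mem_rows.mp ha)

theorem map_get_eq {n : ℕ} (lam : n.Partition) :
    (Finset.univ : Finset (Fin (rows lam).length)).val.map (rows lam).get = lam.parts := by
  rw [← coe_rows, Fin.univ_val_map, List.ofFn_get]

/-- The exponent of a monomial given by the positions of the parts. -/
def posExpo {ι : Type*} {n : ℕ} (lam : n.Partition) (f : Fin (rows lam).length → ι) : ι →₀ ℕ :=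
  ∑ j, Finsupp.single (f j) ((rows lam).get j)

theorem posExpo_apply_of_injective {ι : Type*} {n : ℕ} {lam : n.Partition}
    {f : Fin (rows lam).length → ι} (hf : Function.Injective f) (j) :
    posExpo lam f (f j) = (rows lam).get j := by
  classical
  rw [posExpo, Finsupp.finsetSum_apply, Finset.sum_eq_single j]
  · simp
  · intro b _ hb
    rw [Finsupp.single_apply, if_neg (hf.ne hb)]
  · simp

theorem posExpo_apply_of_notMem {ι : Type*} {n : ℕ} {lam : n.Partition}
    {f : Fin (rows lam).length → ι} {i : ι} (hi : i ∉ Set.range f) : posExpo lam f i = 0 := by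
  classical
  rw [posExpo, Finsupp.finsetSum_apply, Finset.sum_eq_zero]
  intro j _
  rw [Finsupp.single_apply, if_neg]
  exact fun h => hi ⟨j, h⟩

/-- The multiset of nonzero exponents. -/
def shape {N : ℕ} (α : Fin N →₀ ℕ) : Multiset ℕ := (Finset.univ.val.map α).filter (0 < ·)

theorem shape_posExpo {N n : ℕ} {lam : n.Partition} {f : Fin (rows lam).length → Fin N}
    (hf : Function.Injective f) : shape (posExpo lam f) = lam.parts := by
  classical
  have h1 : shape (posExpo lam f) = (Finset.univ.image f).val.map (posExpo lam f) := by
    rw [shape, Multiset.filter_map, ← Finset.filter_val]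
    congr 2
    ext i
    simp only [Finset.mem_filter, Finset.mem_univ, true_and, Finset.mem_image, Function.comp]
    constructor
    · intro h
      by_contra h2
      rw [posExpo_apply_of_notMem] at h
      · exact lt_irrefl _ h
      · rintro ⟨j, hj⟩; exact h2 ⟨j, hj⟩
    · rintro ⟨j, rfl⟩
      rw [posExpo_apply_of_injective hf]
      exact rows_get_pos _ _
  rw [h1, Finset.image_val_of_injOn hf.injOn, Multiset.map_map, ← map_get_eq lam]
  exact Multiset.map_congr rfl fun j _ => posExpo_apply_of_injective hf j

theorem expo_eq_posExpo {N n : ℕ} (lam : n.Partition) (h : (rows lam).length ≤ N) :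
    expo N lam = posExpo lam (Fin.castLE h) := by
  ext i
  by_cases hi : (i : ℕ) < (rows lam).length
  · have : i = Fin.castLE h ⟨i, hi⟩ := rfl
    rw [this, posExpo_apply_of_injective (Fin.castLE_injective h)]
    simp [hi]
  · rw [posExpo_apply_of_notMem]
    · exact List.getD_eq_default _ _ (not_lt.mp hi)
    · rintro ⟨j, rfl⟩
      exact hi j.2

theorem shape_expo {N n : ℕ} (lam : n.Partition) (h : (rows lam).length ≤ N) :
    shape (expo N lam) = lam.parts := by
  rw [expo_eq_posExpo lam h, shape_posExpo (Fin.castLE_injective h)]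

-- Möbius inversion turns the power-sum definition of `m_λ` into a sum over injective placements of
-- the parts, from which coefficients can be read off.
open Classical in
theorem toPoly_monomialSym (N : ℕ) {n : ℕ} (lam : n.Partition) :
    toPoly F N (monomialSym lam) =
      C (((∏ a ∈ lam.parts.toFinset, (lam.parts.count a).factorial : ℕ) : F)⁻¹) *
        ∑ f : Fin (rows lam).length → Fin N with Function.Injective f,
          monomial (posExpo lam f) 1 := by
  rw [monomialSym, map_mul, algHom_C, map_sum]
  congr 1
  have h := sum_moebius_psum (F := F) (X : Fin N → MvPolynomial (Fin N) F) (rows lam).get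
  rw [Finset.sum_congr rfl (g := fun f : Fin (rows lam).length → Fin N =>
    monomial (posExpo lam f) (1 : F))] at h
  · refine Eq.trans (Finset.sum_congr rfl fun π _ => ?_) (h.trans (by congr!))
    rw [map_prod]
    refine Finset.prod_congr rfl fun B hB => ?_
    rw [map_mul, algHom_C, toPoly_X, psum]
    have hpos : 0 < ∑ j ∈ B, (rows lam).get j :=
      Finset.sum_pos (fun j _ => rows_get_pos lam j) (π.nonempty_of_mem_parts hB)
    rw [PNat.toPNat'_coe hpos]
  · intro f _
    rw [posExpo, monomial_sum_one]
    exact Finset.prod_congr rfl fun j _ => by rw [X_pow_eq_monomial]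

open Classical in
theorem coeff_toPoly_monomialSym (N : ℕ) {n : ℕ} (lam : n.Partition) (α : Fin N →₀ ℕ) :
    coeff α (toPoly F N (monomialSym lam)) =
      ((∏ a ∈ lam.parts.toFinset, (lam.parts.count a).factorial : ℕ) : F)⁻¹ *
        ((Finset.univ.filter fun f : Fin (rows lam).length → Fin N =>
          Function.Injective f ∧ posExpo lam f = α).card : F) := by
  rw [toPoly_monomialSym, coeff_C_mul, coeff_sum]
  simp_rw [coeff_monomial]
  rw [← Finset.sum_filter, Finset.filter_filter, Finset.sum_const, nsmul_eq_mul, mul_one]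

theorem shape_eq_of_coeff_ne_zero {N n : ℕ} {lam : n.Partition} {α : Fin N →₀ ℕ}
    (h : coeff α (toPoly F N (monomialSym lam)) ≠ 0) : shape α = lam.parts := by
  classical
  rw [coeff_toPoly_monomialSym] at h
  have h1 : (Finset.univ.filter fun f : Fin (rows lam).length → Fin N =>
      Function.Injective f ∧ posExpo lam f = α).Nonempty := by
    rw [Finset.nonempty_iff_ne_empty]
    intro h0
    rw [h0] at h
    simp at h
  obtain ⟨f, hf⟩ := h1
  simp only [Finset.mem_filter, Finset.mem_univ, true_and] at hf
  rw [← hf.2, shape_posExpo hf.1]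

/-- The placements that give the leading monomial are the permutations preserving the list of parts.
There are `∏ m_a !` of them, which cancels the normalization. -/
theorem coeff_expo_toPoly_monomialSym_self [CharZero F] {N n : ℕ} {lam : n.Partition}
    (h : (rows lam).length ≤ N) : coeff (expo N lam) (toPoly F N (monomialSym lam)) = 1 := by
  classical
  rw [coeff_toPoly_monomialSym]
  have hcard : (Finset.univ.filter fun f : Fin (rows lam).length → Fin N =>
      Function.Injective f ∧ posExpo lam f = expo N lam).card =
      ∏ a ∈ lam.parts.toFinset, (lam.parts.count a).factorial := by
    have h1 := DomMulAct.stabilizer_card' (rows lam).get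
    have himg : Finset.univ.image (rows lam).get = lam.parts.toFinset := by
      ext a
      simp [← mem_rows, List.mem_iff_get]
    have hcnt : ∀ a, Fintype.card {j // (rows lam).get j = a} = lam.parts.count a := by
      intro a
      rw [Fintype.card_subtype, ← map_get_eq lam, Multiset.count_map, ← Finset.filter_val,
        Finset.card_val]
      congr 1
      ext j
      simp [eq_comm]
    rw [himg] at h1
    simp_rw [hcnt] at h1
    rw [← h1, Fintype.card_subtype]
    symm
    refine Finset.card_bij (fun σ _ j => Fin.castLE h (σ j)) ?_ ?_ ?_
    · intro σ hσ
      simp only [Finset.mem_filter, Finset.mem_univ, true_and] at hσ ⊢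
      refine ⟨(Fin.castLE_injective h).comp σ.injective, ?_⟩
      rw [expo_eq_posExpo lam h, posExpo, posExpo, ← Equiv.sum_comp σ
        fun j => Finsupp.single (Fin.castLE h j) ((rows lam).get j)]
      exact Finset.sum_congr rfl fun j _ => by
        have := congrFun hσ j
        simp only [Function.comp] at this
        rw [this]
    · intro σ _ σ' _ hσ
      ext j
      have := congrFun hσ j
      simpa [Fin.ext_iff] using this
    · intro f hf
      simp only [Finset.mem_filter, Finset.mem_univ, true_and] at hf
      have hlt : ∀ j, ((f j : Fin N) : ℕ) < (rows lam).length := by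
        intro j
        by_contra hj
        have h2 := posExpo_apply_of_injective hf.1 j
        rw [hf.2, expo_apply, List.getD_eq_default _ _ (not_lt.mp hj)] at h2
        exact (rows_get_pos lam j).ne h2
      have hinj : Function.Injective fun j => (⟨f j, hlt j⟩ : Fin (rows lam).length) := by
        intro a b hab
        apply hf.1
        simpa [Fin.ext_iff] using hab
      refine ⟨Equiv.ofBijective _ (Finite.injective_iff_bijective.mp hinj), ?_, ?_⟩
      · simp only [Finset.mem_filter, Finset.mem_univ, true_and]
        funext j
        have h2 := posExpo_apply_of_injective hf.1 j
        rw [hf.2, expo_apply] at h2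
        rw [← h2]
        simp [hlt j]
      · rfl
  rw [hcard, inv_mul_cancel₀]
  rw [Nat.cast_ne_zero, Finset.prod_ne_zero_iff]
  exact fun a _ => Nat.factorial_ne_zero _

end

/-! ### Partitions and exponents -/

theorem card_map_univ_eq_shape {N : ℕ} (α : Fin N →₀ ℕ) :
    Finset.univ.val.map α = shape α + Multiset.replicate (N - (shape α).card) 0 := by
  have h := Multiset.filter_add_not (fun a => 0 < a) (Finset.univ.val.map α)
  have h2 : (Finset.univ.val.map α).filter (fun a => ¬ 0 < a) =
      Multiset.replicate (N - (shape α).card) 0 := by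
    refine Multiset.eq_replicate.mpr ⟨?_, fun b hb => ?_⟩
    · have h3 := congrArg Multiset.card h
      rw [Multiset.card_add, Multiset.card_map, Finset.card_val, Finset.card_univ,
        Fintype.card_fin] at h3
      rw [shape]
      omega
    · have := (Multiset.mem_filter.mp hb).2
      omega
  rw [← h2]
  exact h.symm

theorem eq_of_shape_eq {N : ℕ} {α β : Fin N →₀ ℕ} (hα : Antitone α) (hβ : Antitone β)
    (h : shape α = shape β) : α = β := by
  have h1 : Finset.univ.val.map α = Finset.univ.val.map β := by
    rw [card_map_univ_eq_shape, h, ← card_map_univ_eq_shape]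
  rw [Fin.univ_val_map, Fin.univ_val_map, Multiset.coe_eq_coe] at h1
  have h2 : List.ofFn α = List.ofFn β := by
    refine List.Perm.eq_of_pairwise (le := (· ≥ ·)) (fun a b _ _ h h' => le_antisymm h' h) ?_ ?_ h1
    · exact List.pairwise_ofFn.mpr fun i j hij => hα hij.le
    · exact List.pairwise_ofFn.mpr fun i j hij => hβ hij.le
  exact DFunLike.coe_injective (List.ofFn_injective h2)

theorem getD_rows_antitone {n : ℕ} (lam : n.Partition) :
    Antitone fun i => (rows lam).getD i 0 := by
  intro i j hij
  rcases hij.eq_or_lt with rfl | hij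
  · exact le_rfl
  by_cases hj : j < (rows lam).length
  · have := List.pairwise_iff_getElem.mp (rows_sorted lam) i j (hij.trans hj) hj hij
    change (rows lam).getD j 0 ≤ (rows lam).getD i 0
    rwa [List.getD_eq_getElem _ _ hj, List.getD_eq_getElem _ _ (hij.trans hj)]
  · change (rows lam).getD j 0 ≤ _
    rw [List.getD_eq_default _ _ (not_lt.mp hj)]
    exact Nat.zero_le _

theorem expo_antitone (N : ℕ) {n : ℕ} (lam : n.Partition) : Antitone (expo N lam) :=
  fun _ _ hij => getD_rows_antitone lam hij

theorem sum_shape {N : ℕ} (α : Fin N →₀ ℕ) : (shape α).sum = ∑ i, α i := by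
  have h := congrArg Multiset.sum (card_map_univ_eq_shape α)
  rw [Multiset.sum_add] at h
  simp only [Multiset.sum_replicate, smul_zero, add_zero] at h
  exact h.symm

/-- An exponent with weakly decreasing entries comes from a partition. -/
theorem exists_expo_eq {N n : ℕ} {α : Fin N →₀ ℕ} (hα : Antitone α) (hn : ∑ i, α i = n) :
    ∃ nu : n.Partition, (rows nu).length ≤ N ∧ expo N nu = α := by
  let nu : n.Partition :=
    { parts := shape α
      parts_pos := fun h => (Multiset.mem_filter.mp h).2
      parts_sum := by rw [sum_shape, hn] }
  have hl : (rows nu).length ≤ N := by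
    have h1 : (rows nu).length = (shape α).card := by
      rw [← Multiset.coe_card, coe_rows]
    have h2 := Multiset.card_le_card (Multiset.filter_le (0 < ·) (Finset.univ.val.map α))
    rw [h1]
    simpa [shape] using h2
  exact ⟨nu, hl, eq_of_shape_eq (expo_antitone N nu) hα (shape_expo nu hl)⟩

theorem exists_antitone_comp {N : ℕ} (α : Fin N →₀ ℕ) :
    ∃ σ : Equiv.Perm (Fin N), Antitone (α.mapDomain σ) := by
  refine ⟨(Tuple.sort (OrderDual.toDual ∘ α)).symm, ?_⟩
  have h := Tuple.monotone_sort (OrderDual.toDual ∘ α)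
  intro i j hij
  rw [← Finsupp.equivMapDomain_eq_mapDomain]
  exact h hij

theorem coeff_mapDomain_of_isSymmetric {N : ℕ} {F : Type*} [CommSemiring F]
    {f : MvPolynomial (Fin N) F} (hf : f.IsSymmetric) (σ : Equiv.Perm (Fin N)) (α : Fin N →₀ ℕ) :
    coeff (α.mapDomain σ) f = coeff α f := by
  conv_lhs => rw [← hf σ]
  exact coeff_rename_mapDomain _ σ.injective _ _

theorem degree_expo {N n : ℕ} (lam : n.Partition) (h : (rows lam).length ≤ N) :
    ∑ i, expo N lam i = n := by
  rw [← sum_shape, shape_expo lam h, lam.parts_sum]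

theorem expo_injective {N n : ℕ} {lam mu : n.Partition} (h : (rows lam).length ≤ N)
    (h' : (rows mu).length ≤ N) (he : expo N lam = expo N mu) : lam = mu := by
  apply Nat.Partition.ext
  rw [← shape_expo lam h, he, shape_expo mu h']

theorem lexLT_trichotomous {n : ℕ} (mu lam : n.Partition) :
    lexLT n mu lam ∨ mu = lam ∨ lexLT n lam mu := by
  rcases lt_trichotomy (rows mu) (rows lam) with h | h | h
  · exact Or.inl h
  · exact Or.inr (Or.inl (rows_injective h))
  · exact Or.inr (Or.inr h)

/-- Only the larger partition has to fit into `N` variables: the first difference always occurs at a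
row of `λ`, with missing rows of `μ` counted as `0`. -/
theorem toLex_expo_lt {N n : ℕ} {mu lam : n.Partition} (hN : (rows lam).length ≤ N)
    (h : lexLT n mu lam) : toLex (expo N mu) < toLex (expo N lam) := by
  rw [Finsupp.Lex.lt_iff]
  rcases List.lt_iff_exists.mp h with ⟨h1, h2⟩ | ⟨i, hi, hi', h1, h2⟩
  · refine ⟨⟨(rows mu).length, h2.trans_le hN⟩, ?_, ?_⟩
    · intro j hj
      have hj' : (j : ℕ) < (rows mu).length := hj
      have h3 : (rows mu)[(j : ℕ)]? = (rows lam)[(j : ℕ)]? := by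
        conv_lhs => rw [h1]
        rw [List.getElem?_take, if_pos hj']
      simp [h3]
    · have := rows_get_pos lam ⟨_, h2⟩
      simp only [ofLex_toLex, expo_apply]
      rw [List.getD_eq_default _ _ le_rfl, List.getD_eq_getElem _ _ h2]
      exact this
  · refine ⟨⟨i, hi'.trans_le hN⟩, ?_, ?_⟩
    · intro j hj
      have hj' : (j : ℕ) < i := hj
      simp only [ofLex_toLex, expo_apply]
      rw [List.getD_eq_getElem _ _ (hj'.trans hi), List.getD_eq_getElem _ _ (hj'.trans hi')]
      exact h1 j hj'
    · simp only [ofLex_toLex, expo_apply]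
      rw [List.getD_eq_getElem _ _ hi, List.getD_eq_getElem _ _ hi']
      exact h2

/-! ### Homogeneous symmetric functions -/

section

variable {F : Type*} [Field F]

/-- The symmetric functions that are homogeneous of degree `n`. -/
def homSym (F : Type*) [Field F] (n : ℕ) : Submodule F (Sym F) :=
  weightedHomogeneousSubmodule F (fun r : ℕ+ => (r : ℕ)) n

theorem mul_mem_homSym {m n : ℕ} {f g : Sym F} (hf : f ∈ homSym F m) (hg : g ∈ homSym F n) :
    f * g ∈ homSym F (m + n) :=
  IsWeightedHomogeneous.mul hf hg

theorem X_mem_homSym (r : ℕ+) : (X r : Sym F) ∈ homSym F r :=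
  isWeightedHomogeneous_X F (fun r : ℕ+ => (r : ℕ)) r

theorem one_mem_homSym : (1 : Sym F) ∈ homSym F 0 :=
  isWeightedHomogeneous_one F (fun r : ℕ+ => (r : ℕ))

theorem monomialSym_mem_homSym {n : ℕ} (lam : n.Partition) :
    (monomialSym lam : Sym F) ∈ homSym F n := by
  rw [monomialSym, ← smul_eq_C_mul]
  refine Submodule.smul_mem _ _ (Submodule.sum_mem _ fun π _ => ?_)
  have h1 : ∑ B ∈ π.parts, ∑ j ∈ B, (rows lam).get j = n := by
    have h2 : ∑ B ∈ π.parts, ∑ j ∈ B, (rows lam).get j = ∑ j, (rows lam).get j := by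
      conv_rhs => rw [← π.biUnion_parts]
      exact (Finset.sum_biUnion π.supIndep.pairwiseDisjoint).symm
    rw [h2]
    change (Finset.univ.val.map (rows lam).get).sum = n
    rw [map_get_eq, lam.parts_sum]
  have h := IsWeightedHomogeneous.prod (w := fun r : ℕ+ => (r : ℕ)) π.parts
    (fun B => C ((-1) ^ (B.card - 1) * ((B.card - 1).factorial : F)) *
        X (∑ j ∈ B, (rows lam).get j).toPNat') (fun B => ∑ j ∈ B, (rows lam).get j) ?_
  · rw [h1] at h
    exact h
  · intro B hB
    have hpos : 0 < ∑ j ∈ B, (rows lam).get j :=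
      Finset.sum_pos (fun j _ => rows_get_pos lam j) (π.nonempty_of_mem_parts hB)
    rw [← smul_eq_C_mul]
    refine Submodule.smul_mem (weightedHomogeneousSubmodule F (fun r : ℕ+ => (r : ℕ)) _) _ ?_
    have := X_mem_homSym (F := F) (∑ j ∈ B, (rows lam).get j).toPNat'
    rw [PNat.toPNat'_coe hpos] at this
    exact this

theorem sum_map_toMultiset (d : ℕ+ →₀ ℕ) :
    ((Finsupp.toMultiset d).map (fun r : ℕ+ => (r : ℕ))).sum =
      Finsupp.weight (fun r : ℕ+ => (r : ℕ)) d := by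
  induction d using Finsupp.induction_linear with
  | zero => simp
  | add f g hf hg => rw [map_add, Multiset.map_add, Multiset.sum_add, hf, hg, map_add]
  | single a b => simp [Multiset.map_nsmul, Multiset.sum_nsmul, Finsupp.weight_apply]

theorem homSym_le_span_range (n : ℕ) :
    homSym F n ≤ Submodule.span F (Set.range fun lam : n.Partition =>
      ((lam.parts.map fun a => (X a.toPNat' : Sym F)).prod)) := by
  intro f hf
  rw [f.as_sum]
  refine Submodule.sum_mem _ fun d hd => ?_
  have hw : Finsupp.weight (fun r : ℕ+ => (r : ℕ)) d = n := hf (mem_support_iff.mp hd)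
  have h1 : monomial d (coeff d f) = coeff d f • monomial d 1 := by
    rw [smul_monomial, smul_eq_mul, mul_one]
  rw [h1]
  refine Submodule.smul_mem _ _ (Submodule.subset_span ⟨⟨(Finsupp.toMultiset d).map (↑), ?_, ?_⟩, ?_⟩)
  · intro a ha
    obtain ⟨r, -, rfl⟩ := Multiset.mem_map.mp ha
    exact r.pos
  · rw [← hw, sum_map_toMultiset]
  · simp only [Multiset.map_map, Function.comp_def, PNat.coe_toPNat']
    rw [Finsupp.toMultiset_map, Finsupp.prod_toMultiset, Finsupp.prod_mapDomain_index,
      monomial_eq, C_1, one_mul]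
    · simp
    · intro a b c; rw [pow_add]

variable [CharZero F]

theorem coeff_expo_toPoly_monomialSym {N n : ℕ} {lam mu : n.Partition}
    (h : (rows mu).length ≤ N) :
    coeff (expo N mu) (toPoly F N (monomialSym lam)) = if lam = mu then 1 else 0 := by
  split_ifs with hl
  · subst hl
    exact coeff_expo_toPoly_monomialSym_self h
  · by_contra h0
    have := shape_eq_of_coeff_ne_zero h0
    rw [shape_expo mu h] at this
    exact hl (Nat.Partition.ext this.symm)

theorem coeff_expo_toPoly_sum {N n : ℕ} {mu : n.Partition} (h : (rows mu).length ≤ N)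
    (c : n.Partition → F) :
    coeff (expo N mu) (toPoly F N (∑ lam, c lam • monomialSym lam)) = c mu := by
  simp [coeff_sum, coeff_expo_toPoly_monomialSym h]

theorem linearIndependent_monomialSym (n : ℕ) :
    LinearIndependent F (monomialSym : n.Partition → Sym F) := by
  rw [Fintype.linearIndependent_iff]
  intro c hc mu
  rw [← coeff_expo_toPoly_sum (length_rows_le mu) c, hc]
  simp

/-- A dimension count: the `m_λ` are independent elements of `homSym`, and the products of power
sums, indexed by the same partitions, already span it. -/
theorem homSym_eq_span (n : ℕ) :
    homSym F n = Submodule.span F (Set.range (monomialSym : n.Partition → Sym F)) := by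
  symm
  have hfin : FiniteDimensional F (Submodule.span F (Set.range fun lam : n.Partition =>
      ((lam.parts.map fun a => (X a.toPNat' : Sym F)).prod))) :=
    FiniteDimensional.span_of_finite F (Set.finite_range _)
  have : FiniteDimensional F (homSym F n) :=
    Submodule.finiteDimensional_of_le (homSym_le_span_range n)
  refine Submodule.eq_of_le_of_finrank_le ?_ ?_
  · rw [Submodule.span_le]
    rintro _ ⟨lam, rfl⟩
    exact monomialSym_mem_homSym lam
  · rw [finrank_span_eq_card (linearIndependent_monomialSym n)]
    exact (Submodule.finrank_mono (homSym_le_span_range n)).trans (finrank_range_le_card _)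

theorem exists_eq_sum_monomialSym {n : ℕ} {f : Sym F} (hf : f ∈ homSym F n) :
    ∃ c : n.Partition → F, f = ∑ lam, c lam • monomialSym lam := by
  rw [homSym_eq_span, Submodule.mem_span_range_iff_exists_fun] at hf
  obtain ⟨c, hc⟩ := hf
  exact ⟨c, hc.symm⟩

/-- With at least `n` variables every partition of `n` fits, and the coefficient at its leading
exponent recovers that of `m_μ`. -/
theorem toPoly_injOn {N n : ℕ} (h : n ≤ N) {f : Sym F} (hf : f ∈ homSym F n)
    (h0 : toPoly F N f = 0) : f = 0 := by
  obtain ⟨c, rfl⟩ := exists_eq_sum_monomialSym hf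
  refine Finset.sum_eq_zero fun mu _ => ?_
  rw [← coeff_expo_toPoly_sum ((length_rows_le mu).trans h) c, h0]
  simp

theorem isHomogeneous_toPoly {N n : ℕ} {f : Sym F} (hf : f ∈ homSym F n) :
    (toPoly F N f).IsHomogeneous n := by
  obtain ⟨c, rfl⟩ := exists_eq_sum_monomialSym hf
  rw [map_sum]
  refine IsHomogeneous.sum _ _ _ fun lam _ => ?_
  rw [map_smul]
  refine Submodule.smul_mem (homogeneousSubmodule (Fin N) F n) _ ?_
  intro α hα
  have h1 := shape_eq_of_coeff_ne_zero hα
  have h2 := sum_shape α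
  rw [h1, lam.parts_sum] at h2
  rw [h2, Finsupp.weight_apply, Finsupp.sum_fintype _ _ (by simp)]
  simp

/-- A homogeneous symmetric polynomial in at least `n` variables, in terms of monomial symmetric
functions. -/
theorem eq_toPoly_sum_monomialSym {N n : ℕ} {g : MvPolynomial (Fin N) F}
    (hs : g.IsSymmetric) (hh : g.IsHomogeneous n) :
    g = toPoly F N (∑ nu : n.Partition, coeff (expo N nu) g • monomialSym nu) := by
  set f := ∑ nu : n.Partition, coeff (expo N nu) g • (monomialSym nu : Sym F) with hf
  have hmem : f ∈ homSym F n :=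
    Submodule.sum_mem _ fun nu _ => Submodule.smul_mem _ _ (monomialSym_mem_homSym nu)
  rw [← sub_eq_zero]
  have hs' : (g - toPoly F N f).IsSymmetric := hs.sub (isSymmetric_toPoly N f)
  have hh' : (g - toPoly F N f).IsHomogeneous n := hh.sub (isHomogeneous_toPoly hmem)
  ext α
  rw [coeff_zero]
  by_contra hα
  have hdeg := hh' hα
  -- By symmetry the exponent may be sorted. It then belongs to a partition, where the two
  -- polynomials agree by construction.
  obtain ⟨σ, hσ⟩ := exists_antitone_comp α
  rw [← coeff_mapDomain_of_isSymmetric hs' σ] at hα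
  have hdeg' := hh' hα
  rw [Finsupp.weight_apply, Finsupp.sum_fintype _ _ (by simp)] at hdeg'
  obtain ⟨nu, hl, hnu⟩ := exists_expo_eq hσ (by simpa using hdeg')
  rw [← hnu, coeff_sub, hf, coeff_expo_toPoly_sum hl, sub_self] at hα
  exact hα rfl

end

/-! ### Macdonald's operator before division by the Vandermonde determinant -/

section

variable {S S' : Type*} [CommRing S] [CommRing S'] {N : ℕ}

/-- `∑_w sign(w) x^w ∏_i (1 + Y τ ^ w_i T_i) f`, where `T_I` plays the role of `∏_{i ∈ I} T_i`. -/
def altOp (x : Fin N → S) (T : Finset (Fin N) → S →+* S) (τ Y f : S) : S :=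
  ∑ w : Equiv.Perm (Fin N), Equiv.Perm.sign w • ((∏ i, x i ^ (w i : ℕ)) *
    ∑ I : Finset (Fin N), Y ^ I.card * τ ^ (∑ i ∈ I, (w i : ℕ)) * T I f)

theorem map_altOp (h : S →+* S') (x : Fin N → S) (T : Finset (Fin N) → S →+* S)
    (T' : Finset (Fin N) → S' →+* S') (τ Y f : S) (hT : ∀ I, h (T I f) = T' I (h f)) :
    h (altOp x T τ Y f) = altOp (fun i => h (x i)) T' (h τ) (h Y) (h f) := by
  simp only [altOp, map_sum, Units.smul_def, map_zsmul, map_mul, map_prod, map_pow, hT]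

theorem altOp_mul_of_invariant (x : Fin N → S) (T : Finset (Fin N) → S →+* S) (τ Y f g : S)
    (hg : ∀ I, T I g = g) : altOp x T τ Y (f * g) = altOp x T τ Y f * g := by
  simp only [altOp, map_mul, hg, Finset.sum_mul, smul_mul_assoc, ← mul_assoc, Finset.mul_sum]

theorem altOp_sum {ι : Type*} (s : Finset ι) (x : Fin N → S) (T : Finset (Fin N) → S →+* S)
    (τ Y : S) (f : ι → S) :
    altOp x T τ Y (∑ a ∈ s, f a) = ∑ a ∈ s, altOp x T τ Y (f a) := by
  simp only [altOp, map_sum, Finset.mul_sum, Finset.smul_sum]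
  rw [Finset.sum_comm (s := s)]
  refine Finset.sum_congr rfl fun w _ => ?_
  rw [Finset.sum_comm]

theorem altOp_mul (x : Fin N → S) (T : Finset (Fin N) → S →+* S) (τ Y c f g : S)
    (hg : ∀ I, T I g = c ^ I.card * g) :
    altOp x T τ Y (g * f) = g * altOp x T τ (Y * c) f := by
  simp only [altOp, map_mul, hg, Finset.mul_sum, mul_smul_comm, mul_pow]
  refine Finset.sum_congr rfl fun w _ => ?_
  congr 1
  refine Finset.sum_congr rfl fun I _ => ?_
  ring

/-- The effect of `altOp` on a function on which the `T_I` act by multiplication. -/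
theorem altOp_eq_det (x : Fin N → S) (T : Finset (Fin N) → S →+* S) (τ Y f : S) (ρ σ : Fin N → S)
    (hT : ∀ I, (∏ i ∈ I, σ i) * T I f = f * ∏ i ∈ I, ρ i) :
    (∏ i, σ i) * altOp x T τ Y f = f * Matrix.det (Matrix.of fun k i : Fin N =>
      x i ^ (k : ℕ) * (σ i + Y * τ ^ (k : ℕ) * ρ i)) := by
  rw [altOp, Matrix.det_apply, Finset.mul_sum, Finset.mul_sum]
  refine Finset.sum_congr rfl fun w _ => ?_
  rw [mul_smul_comm, mul_smul_comm]
  congr 1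
  simp only [Matrix.of_apply, Finset.prod_mul_distrib]
  rw [mul_left_comm, mul_left_comm f]
  congr 1
  -- Here `T_I f = f ∏_{i ∈ I} ρ_i / σ_i` with denominators cleared. Expanding `∏_i (Y τ^{w_i} ρ_i +
  -- σ_i)` over subsets `I` reproduces the sum in `altOp`.
  rw [Finset.mul_sum, Finset.prod_congr rfl fun i _ => add_comm (σ i) _, Finset.prod_add,
    Finset.mul_sum, Finset.powerset_univ]
  refine Finset.sum_congr rfl fun I _ => ?_
  have h1 : ∏ i, σ i = (∏ i ∈ I, σ i) * ∏ i ∈ Finset.univ \ I, σ i := by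
    rw [mul_comm, Finset.prod_sdiff (Finset.subset_univ I)]
  rw [h1, Finset.prod_mul_distrib, Finset.prod_mul_distrib, Finset.prod_const,
    Finset.prod_pow_eq_pow_sum]
  linear_combination (Y ^ I.card * τ ^ (∑ i ∈ I, (w i : ℕ)) * ∏ i ∈ Finset.univ \ I, σ i) * hT I

end

/-! ### The operator on polynomials: `q`-shifts and leading exponents -/

section

variable {F : Type*} [Field F] {N : ℕ}

/-- `x_i ↦ q x_i` for `i ∈ I`. -/
def shift {σ : Type*} [DecidableEq σ] (q : F) (I : Finset σ) :
    MvPolynomial σ F →ₐ[F] MvPolynomial σ F :=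
  aeval fun i => if i ∈ I then C q * X i else X i

theorem shift_X {σ : Type*} [DecidableEq σ] (q : F) (I : Finset σ) (i : σ) :
    shift q I (X i) = if i ∈ I then C q * X i else X i := by
  simp [shift]

theorem coeff_shift (q : F) (I : Finset (Fin N)) (f : MvPolynomial (Fin N) F) (α : Fin N →₀ ℕ) :
    coeff α (shift q I f) = q ^ (∑ i ∈ I, α i) * coeff α f := by
  induction f using MvPolynomial.induction_on' with
  | monomial β c =>
    have h : shift q I (monomial β c) = monomial β (q ^ (∑ i ∈ I, β i) * c) := by
      rw [monomial_eq, monomial_eq, map_mul, algHom_C, Finsupp.prod_fintype _ _ (by simp),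
        map_prod, C_mul, mul_comm (C (q ^ _)), mul_assoc, algebraMap_eq]
      congr 1
      rw [← Finset.prod_pow_eq_pow_sum, map_prod, ← Fintype.prod_ite_mem I,
        ← Finset.prod_mul_distrib]
      refine Finset.prod_congr rfl fun i _ => ?_
      rw [map_pow, shift_X]
      split_ifs <;> simp [mul_pow]
    rw [h, coeff_monomial, coeff_monomial]
    split_ifs with hβ
    · rw [hβ]
    · simp
  | add f g hf hg => rw [map_add, coeff_add, hf, hg, coeff_add, mul_add]

theorem shift_empty (q : F) (f : MvPolynomial (Fin N) F) : shift q ∅ f = f := by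
  ext α
  simp [coeff_shift]

/-- `altOp` for polynomials with `T_i` the `q`-shift of the `i`-th variable. -/
def polyOp (q τ Y : F) (f : MvPolynomial (Fin N) F) : MvPolynomial (Fin N) F :=
  altOp X (fun I => (shift q I : MvPolynomial (Fin N) F →+* MvPolynomial (Fin N) F))
    (C τ) (C Y) f

theorem polyOp_sum {ι : Type*} (s : Finset ι) (q τ Y : F) (f : ι → MvPolynomial (Fin N) F) :
    polyOp q τ Y (∑ a ∈ s, f a) = ∑ a ∈ s, polyOp q τ Y (f a) :=
  altOp_sum _ _ _ _ _ _

theorem polyOp_C_mul (q τ Y c : F) (f : MvPolynomial (Fin N) F) :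
    polyOp q τ Y (C c * f) = C c * polyOp q τ Y f := by
  have h := altOp_mul X (fun I => (shift q I : MvPolynomial (Fin N) F →+* MvPolynomial (Fin N) F))
    (C τ) (C Y) 1 f (C c) (by intro I; simp [algHom_C])
  rw [mul_one] at h
  exact h

theorem polyOp_add (q τ Y : F) (f g : MvPolynomial (Fin N) F) :
    polyOp q τ Y (f + g) = polyOp q τ Y f + polyOp q τ Y g := by
  have h := polyOp_sum Finset.univ q τ Y (fun b : Bool => if b then f else g)
  simpa using h

theorem polyOp_sub (q τ Y : F) (f g : MvPolynomial (Fin N) F) :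
    polyOp q τ Y (f - g) = polyOp q τ Y f - polyOp q τ Y g := by
  have h := polyOp_C_mul q τ Y (-1) g
  simp only [C_neg, C_1, neg_mul, one_mul] at h
  rw [sub_eq_add_neg, polyOp_add, h, sub_eq_add_neg]

theorem polyOp_prod_X_mul (q τ Y : F) (f : MvPolynomial (Fin N) F) :
    polyOp q τ Y ((∏ i, X i) * f) = (∏ i, X i) * polyOp q τ (Y * q) f := by
  rw [polyOp, altOp_mul (c := C q), ← C_mul, polyOp]
  intro I
  change shift q I _ = _
  rw [map_prod, Finset.prod_congr rfl fun i _ => shift_X q I i]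
  have : ∀ i : Fin N, (if i ∈ I then C q * X i else X i : MvPolynomial (Fin N) F) =
      (if i ∈ I then C q else 1) * X i := fun i => by split_ifs <;> simp
  rw [Finset.prod_congr rfl fun i _ => this i, Finset.prod_mul_distrib,
    Fintype.prod_ite_mem, Finset.prod_const]

/-- The Vandermonde determinant. -/
def vdm (N : ℕ) (F : Type*) [Field F] : MvPolynomial (Fin N) F :=
  (Matrix.vandermonde (X : Fin N → MvPolynomial (Fin N) F)).det

theorem vdm_eq : vdm N F = Matrix.det (Matrix.of fun k i : Fin N =>
    (X i ^ (k : ℕ) : MvPolynomial (Fin N) F)) := by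
  rw [vdm, ← Matrix.det_transpose]; rfl

theorem vdm_ne_zero : vdm N F ≠ 0 :=
  Matrix.det_vandermonde_ne_zero_iff.mpr X_injective

/-- At `Y = 0` only `I = ∅` survives. Writing `vdm * f` in this form lets one formula for leading
coefficients serve both sides of an eigenvalue equation. -/
theorem polyOp_zero (q τ : F) (f : MvPolynomial (Fin N) F) : polyOp q τ 0 f = vdm N F * f := by
  rw [polyOp, altOp, vdm_eq, Matrix.det_apply, Finset.sum_mul]
  refine Finset.sum_congr rfl fun w _ => ?_
  rw [smul_mul_assoc]
  congr 2
  rw [Finset.sum_eq_single ∅]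
  · simp [shift_empty]
  · intro I _ hI
    rw [C_0, zero_pow (Finset.card_ne_zero.mpr (Finset.nonempty_iff_ne_empty.mpr hI))]
    simp
  · simp

/-- The exponent `(w 0, w 1, …)`. -/
def permExpo (w : Equiv.Perm (Fin N)) : Fin N →₀ ℕ :=
  Finsupp.equivFunOnFinite.symm fun i => (w i : ℕ)

@[simp] theorem permExpo_apply (w : Equiv.Perm (Fin N)) (i : Fin N) : permExpo w i = w i := rfl

/-- The term of `w` sends `x^α` to `x^{α + w} ∏ (1 + Y τ^{w_i} q^{α_i})`. The test `≤` guards the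
truncated subtraction. -/
theorem coeff_polyOp (q τ Y : F) (f : MvPolynomial (Fin N) F) (β : Fin N →₀ ℕ) :
    coeff β (polyOp q τ Y f) = ∑ w : Equiv.Perm (Fin N), Equiv.Perm.sign w •
      if permExpo w ≤ β then
        (∏ i, (1 + Y * τ ^ (w i : ℕ) * q ^ (β - permExpo w) i)) * coeff (β - permExpo w) f
      else 0 := by
  rw [polyOp, altOp, coeff_sum]
  refine Finset.sum_congr rfl fun w _ => ?_
  rw [Units.smul_def, coeff_smul, ← Units.smul_def]
  congr 1
  have h1 : ∏ i, (X i : MvPolynomial (Fin N) F) ^ (w i : ℕ) = monomial (permExpo w) 1 := by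
    rw [monomial_eq, Finsupp.prod_fintype _ _ (by simp)]
    simp
  rw [h1, coeff_monomial_mul']
  congr 1
  rw [one_mul, coeff_sum, Finset.prod_one_add, Finset.powerset_univ, Finset.sum_mul]
  refine Finset.sum_congr rfl fun I _ => ?_
  rw [← C_pow, ← C_pow, ← C_mul, coeff_C_mul]
  change _ * coeff _ (shift q I f) = _
  rw [coeff_shift, Finset.prod_mul_distrib, Finset.prod_mul_distrib, Finset.prod_const,
    Finset.prod_pow_eq_pow_sum, Finset.prod_pow_eq_pow_sum]
  ring

/-- The reversal `(N-1, …, 0)` is the lexicographically largest exponent among permutations: at the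
first deviation all larger values are already used up. -/
theorem exists_lt_revPerm {w : Equiv.Perm (Fin N)} (hw : w ≠ Fin.revPerm) :
    ∃ i, (∀ j < i, w j = Fin.rev j) ∧ w i < Fin.rev i := by
  have hne : ∃ i, w i ≠ Fin.rev i := by
    by_contra h
    push Not at h
    exact hw (Equiv.ext h)
  obtain ⟨i, hi, hmin⟩ := WellFounded.has_min (wellFounded_lt (α := Fin N))
    {i | w i ≠ Fin.rev i} hne
  have hlt : ∀ j < i, w j = Fin.rev j := fun j hj => by
    by_contra h
    exact hmin j h hj
  refine ⟨i, hlt, lt_of_le_of_ne ?_ hi⟩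
  by_contra hgt
  push Not at hgt
  have h1 : Fin.rev (w i) < i := by
    rw [← Fin.rev_rev i, Fin.rev_lt_rev, Fin.rev_rev]
    exact hgt
  have h2 := hlt _ h1
  rw [Fin.rev_rev] at h2
  exact h1.ne (w.injective h2)

/-- The leading coefficient of `polyOp f`. -/
theorem coeff_polyOp_add (q τ Y : F) {f : MvPolynomial (Fin N) F} {ν : Fin N →₀ ℕ}
    (hf : ∀ α, toLex ν < toLex α → coeff α f = 0) :
    coeff (ν + permExpo Fin.revPerm) (polyOp q τ Y f) = Equiv.Perm.sign (Fin.revPerm (n := N)) •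
      ((∏ i, (1 + Y * τ ^ (Fin.rev i : ℕ) * q ^ ν i)) * coeff ν f) := by
  rw [coeff_polyOp, Finset.sum_eq_single Fin.revPerm]
  · rw [if_pos (by simp), add_tsub_cancel_right]
    rfl
  · intro w _ hw
    split_ifs with hle
    swap
    · simp
    -- For any other `w`, the exponent `ν + rev - w` lies strictly above `ν`, where `f` has no
    -- terms.
    obtain ⟨i, hi, hlt⟩ := exists_lt_revPerm hw
    rw [hf, mul_zero, smul_zero]
    rw [Finsupp.Lex.lt_iff]
    refine ⟨i, ?_, ?_⟩
    · intro j hj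
      simp [hi j hj]
    · have h2 : (w i : ℕ) < (Fin.rev i : ℕ) := hlt
      have h3 : (permExpo (Fin.revPerm (n := N))) i = (Fin.rev i : ℕ) := rfl
      simp only [ofLex_toLex, Finsupp.tsub_apply, Finsupp.add_apply, h3, permExpo_apply]
      omega
  · simp

/-- A nonzero polynomial has a leading exponent. -/
theorem exists_leading {f : MvPolynomial (Fin N) F} (hf : f ≠ 0) :
    ∃ ν, coeff ν f ≠ 0 ∧ ∀ α, toLex ν < toLex α → coeff α f = 0 := by
  obtain ⟨ν, hν, hmax⟩ := Finset.exists_max_image f.support (fun α => toLex α)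
    (support_nonempty.mpr hf)
  refine ⟨ν, mem_support_iff.mp hν, fun α hα => ?_⟩
  by_contra h
  exact absurd (hmax α (mem_support_iff.mpr h)) (not_le.mpr hα)

theorem sign_smul_inj {G : Type*} [AddCommGroup G] (u : ℤˣ) {a b : G} (h : u • a = u • b) :
    a = b := by
  have := congrArg (fun c => u⁻¹ • c) h
  simpa using this

/-- The eigenvalue of `polyOp` is determined by a leading exponent. -/
theorem exists_eigenvalue_eq (q τ : F) {f : MvPolynomial (Fin N) F} (hf : f ≠ 0) :
    ∃ ν, coeff ν f ≠ 0 ∧ ∀ Y κ e : F, C κ * polyOp q τ Y f = C e * (vdm N F * f) →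
      κ * ∏ i, (1 + Y * τ ^ (Fin.rev i : ℕ) * q ^ ν i) = e := by
  obtain ⟨ν, hν, hmax⟩ := exists_leading hf
  refine ⟨ν, hν, fun Y κ e h => ?_⟩
  have h1 := congrArg (coeff (ν + permExpo Fin.revPerm)) h
  rw [← polyOp_zero q τ, coeff_C_mul, coeff_C_mul, coeff_polyOp_add _ _ _ hmax,
    coeff_polyOp_add _ _ _ hmax, mul_smul_comm, mul_smul_comm] at h1
  have h2 := sign_smul_inj _ h1
  simp only [zero_mul, add_zero, Finset.prod_const_one, one_mul] at h2
  rw [← mul_assoc] at h2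
  exact mul_right_cancel₀ hν h2

end

/-! ### Divisibility by the Vandermonde determinant -/

section

variable {F : Type*} [Field F] {N : ℕ}

theorem rename_shift (q : F) (σ : Equiv.Perm (Fin N)) (I : Finset (Fin N))
    (f : MvPolynomial (Fin N) F) :
    rename σ (shift q I f) = shift q (I.map σ.toEmbedding) (rename σ f) := by
  have h : (rename σ).comp (shift q I) =
      (shift q (I.map σ.toEmbedding)).comp (rename (R := F) σ) := by
    ext1 i
    simp only [AlgHom.comp_apply, shift_X, rename_X, Finset.mem_map_equiv, Equiv.symm_apply_apply]
    split_ifs <;> simp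
  exact DFunLike.congr_fun h f

/-- Reindexing by `w ↦ w σ` and `I ↦ σ(I)` shows that the image of a symmetric polynomial is
alternating. This is what makes division by the Vandermonde determinant possible. -/
theorem rename_polyOp (q τ Y : F) {f : MvPolynomial (Fin N) F} (hf : f.IsSymmetric)
    (σ : Equiv.Perm (Fin N)) :
    rename σ (polyOp q τ Y f) = Equiv.Perm.sign σ • polyOp q τ Y f := by
  rw [polyOp, altOp, map_sum, Finset.smul_sum, ← Equiv.sum_comp (Equiv.mulRight σ)]
  refine Finset.sum_congr rfl fun w _ => ?_
  rw [Units.smul_def, map_zsmul, ← Units.smul_def, smul_smul, Equiv.coe_mulRight,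
    Equiv.Perm.sign_mul, mul_comm]
  congr 1
  rw [map_mul, map_prod, map_sum]
  congr 1
  · rw [← Equiv.prod_comp σ fun i => (X i : MvPolynomial (Fin N) F) ^ (w i : ℕ)]
    simp
  · rw [← Equiv.sum_comp (Equiv.finsetCongr σ) fun I => (C Y : MvPolynomial (Fin N) F) ^ I.card *
      C τ ^ (∑ i ∈ I, (w i : ℕ)) * _]
    refine Finset.sum_congr rfl fun I _ => ?_
    simp only [map_mul, map_pow, rename_C, Equiv.finsetCongr_apply, Finset.card_map,
      Finset.sum_map, Equiv.toEmbedding_apply]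
    congr 1
    change rename σ (shift q I f) = shift q (I.map σ.toEmbedding) f
    rw [rename_shift, hf σ]

/-- The substitution `x_i ↦ x_j`. -/
def identify (F : Type*) [Field F] (i j : Fin N) :
    MvPolynomial (Fin N) F →ₐ[F] MvPolynomial (Fin N) F :=
  aeval fun k => if k = i then X j else X k

theorem X_sub_X_dvd_sub_identify (i j : Fin N) (f : MvPolynomial (Fin N) F) :
    X i - X j ∣ f - identify F i j f := by
  induction f using MvPolynomial.induction_on with
  | C a => simp [identify, algHom_C]
  | add f g hf hg =>
    rw [map_add, add_sub_add_comm]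
    exact dvd_add hf hg
  | mul_X f k hf =>
    have h : f * X k - identify F i j (f * X k) =
        (f - identify F i j f) * X k + identify F i j f * (X k - identify F i j (X k)) := by
      rw [map_mul]; ring
    rw [h]
    refine dvd_add (hf.mul_right _) (Dvd.dvd.mul_left ?_ _)
    simp only [identify, aeval_X]
    split_ifs with hk
    · rw [hk]
    · simp

theorem X_sub_X_dvd_iff {i j : Fin N} {f : MvPolynomial (Fin N) F} :
    X i - X j ∣ f ↔ identify F i j f = 0 := by
  constructor
  · rintro ⟨g, rfl⟩
    rw [map_mul]
    have : identify F i j (X i - X j) = 0 := by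
      simp only [identify, map_sub, aeval_X]
      split_ifs <;> simp
    rw [this, zero_mul]
  · intro h
    have h1 := X_sub_X_dvd_sub_identify i j f
    rwa [h, sub_zero] at h1

/-- Divisibility by `X i - X j` means lying in the kernel of a substitution with values in a domain.
-/
theorem prime_X_sub_X {i j : Fin N} (hij : i ≠ j) :
    Prime (X i - X j : MvPolynomial (Fin N) F) := by
  refine ⟨sub_ne_zero.mpr (X_injective.ne hij), fun h => ?_, fun f g h => ?_⟩
  · have h1 : (X i - X j : MvPolynomial (Fin N) F) ∣ 1 := h.dvd
    rw [X_sub_X_dvd_iff, map_one] at h1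
    exact one_ne_zero h1
  · rw [X_sub_X_dvd_iff, map_mul, mul_eq_zero] at h
    rwa [X_sub_X_dvd_iff, X_sub_X_dvd_iff]

/-- Identifying two variables makes an alternating polynomial equal to its own negative, hence `0`
in characteristic zero. So it is divisible by every difference of variables, and these are pairwise
relatively prime. -/
theorem vdm_dvd [CharZero F] {g : MvPolynomial (Fin N) F}
    (hg : ∀ σ : Equiv.Perm (Fin N), rename σ g = Equiv.Perm.sign σ • g) : vdm N F ∣ g := by
  have hdvd : ∀ i j : Fin N, i ≠ j → X i - X j ∣ g := by
    intro i j hij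
    have h1 : identify F i j g = 0 := by
      have h2 : (identify F i j).comp (rename (Equiv.swap i j)) = identify F i j := by
        ext1 k
        simp only [AlgHom.comp_apply, rename_X, identify, aeval_X]
        by_cases hk : k = i
        · subst hk; simp [Ne.symm hij]
        · by_cases hk' : k = j
          · subst hk'; simp [hk]
          · rw [Equiv.swap_apply_of_ne_of_ne hk hk']
      have h3 := DFunLike.congr_fun h2 g
      rw [AlgHom.comp_apply, hg, Equiv.Perm.sign_swap hij, Units.neg_smul, one_smul, map_neg]
        at h3
      exact self_eq_neg.mp h3.symm
    exact X_sub_X_dvd_iff.mpr h1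
  rw [vdm, Matrix.det_vandermonde, Finset.prod_sigma']
  refine Finset.prod_dvd_of_isRelPrime ?_ ?_
  · rintro ⟨i, j⟩ hij ⟨i', j'⟩ hij' hne
    have h1 : i < j := by simpa using hij
    have h2 : i' < j' := by simpa using hij'
    change IsRelPrime (X j - X i) (X j' - X i')
    rw [(prime_X_sub_X h1.ne').irreducible.isRelPrime_iff_not_dvd, X_sub_X_dvd_iff]
    simp only [identify, map_sub, aeval_X]
    intro h0
    split_ifs at h0 with h3 h4 h4
    · exact h2.ne (h4.trans h3.symm)
    · rw [sub_eq_zero] at h0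
      have h5 := X_injective h0
      subst h3 h5
      exact hne rfl
    · rw [sub_eq_zero] at h0
      have h5 := X_injective h0
      omega
    · rw [sub_eq_zero] at h0
      exact h2.ne' (X_injective h0)
  · rintro ⟨i, j⟩ hij
    have h1 : i < j := by simpa using hij
    exact hdvd j i h1.ne'

theorem weight_one_eq (α : Fin N →₀ ℕ) : Finsupp.weight 1 α = ∑ i, α i := by
  rw [Finsupp.weight_apply, Finsupp.sum_fintype _ _ (by simp)]
  simp

theorem isHomogeneous_polyOp (q τ Y : F) {f : MvPolynomial (Fin N) F} {n : ℕ}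
    (hf : f.IsHomogeneous n) : (polyOp q τ Y f).IsHomogeneous (n + ∑ i : Fin N, (i : ℕ)) := by
  intro β hβ
  rw [coeff_polyOp] at hβ
  obtain ⟨w, -, hw⟩ := Finset.exists_ne_zero_of_sum_ne_zero hβ
  split_ifs at hw with hle
  · have h1 : coeff (β - permExpo w) f ≠ 0 := fun h => by simp [h] at hw
    have h2 := hf h1
    rw [weight_one_eq] at h2 ⊢
    rw [← h2, ← Equiv.sum_comp w fun i : Fin N => (i : ℕ), ← Finset.sum_add_distrib]
    refine Finset.sum_congr rfl fun i _ => ?_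
    have := hle i
    simp only [permExpo_apply] at this
    simp only [Finsupp.tsub_apply, permExpo_apply]
    omega
  · simp at hw

/-- Scaling all variables by `2` detects the degree, since the powers of `2` are distinct in
characteristic zero. As an identity of ring homomorphisms it passes to quotients, such as that by
`vdm`. -/
theorem isHomogeneous_iff_shift [CharZero F] {f : MvPolynomial (Fin N) F} {n : ℕ} :
    f.IsHomogeneous n ↔ shift 2 Finset.univ f = C (2 ^ n) * f := by
  constructor
  · intro h
    ext α
    rw [coeff_shift, coeff_C_mul]
    by_cases h0 : coeff α f = 0
    · simp [h0]
    · have := h h0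
      rw [weight_one_eq] at this
      rw [this]
  · intro h α hα
    have h1 := congrArg (coeff α) h
    rw [coeff_shift, coeff_C_mul] at h1
    have h2 := mul_right_cancel₀ hα h1
    rw [weight_one_eq]
    exact_mod_cast Nat.pow_right_injective le_rfl (by exact_mod_cast h2)

theorem exists_symmetric_quotient [CharZero F] (q τ Y : F) {f : MvPolynomial (Fin N) F}
    (hf : f.IsSymmetric) {n : ℕ} (hh : f.IsHomogeneous n) :
    ∃ g : MvPolynomial (Fin N) F, g.IsSymmetric ∧ g.IsHomogeneous n ∧
      polyOp q τ Y f = vdm N F * g := by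
  obtain ⟨g, hg⟩ := vdm_dvd (rename_polyOp q τ Y hf)
  have hv : ∀ σ : Equiv.Perm (Fin N), rename σ (vdm N F) = Equiv.Perm.sign σ • vdm N F := by
    intro σ
    have := rename_polyOp q τ 0 (IsSymmetric.one (σ := Fin N) (R := F)) σ
    rwa [polyOp_zero, mul_one] at this
  refine ⟨g, fun σ => ?_, ?_, hg⟩
  · have h1 := rename_polyOp q τ Y hf σ
    rw [hg, map_mul, hv, smul_mul_assoc] at h1
    exact mul_left_cancel₀ vdm_ne_zero (sign_smul_inj _ h1)
  · have h1 := isHomogeneous_polyOp q τ 0 (isHomogeneous_one (Fin N) F)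
    rw [polyOp_zero, mul_one, isHomogeneous_iff_shift] at h1
    have h2 := isHomogeneous_polyOp q τ Y hh
    rw [hg, isHomogeneous_iff_shift, map_mul, h1] at h2
    rw [isHomogeneous_iff_shift]
    refine mul_left_cancel₀ (mul_ne_zero (C_ne_zero.mpr (pow_ne_zero _ two_ne_zero)) vdm_ne_zero)
      (h2.trans ?_)
    rw [pow_add, C_mul, zero_add]
    ring

/-! ### Setting a variable to zero -/

/-- `x_0 ↦ 0`, `x_{i + 1} ↦ x_i`. -/
def dropVar (F : Type*) [Field F] (N : ℕ) :
    MvPolynomial (Fin (N + 1)) F →ₐ[F] MvPolynomial (Fin N) F :=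
  aeval (Fin.cons 0 X : Fin (N + 1) → MvPolynomial (Fin N) F)

theorem dropVar_toPoly (f : Sym F) : dropVar F N (toPoly F (N + 1) f) = toPoly F N f := by
  have h : (dropVar F N).comp (toPoly F (N + 1)) = toPoly F N := by
    ext1 r
    simp [dropVar, psum, Fin.sum_univ_succ]
  exact DFunLike.congr_fun h f

theorem dropVar_shift (q : F) (J : Finset (Fin N)) (f : MvPolynomial (Fin (N + 1)) F) :
    dropVar F N (shift q (J.map (Fin.succEmb N)) f) = shift q J (dropVar F N f) := by
  have h : (dropVar F N).comp (shift q (J.map (Fin.succEmb N))) =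
      (shift q J).comp (dropVar F N) := by
    ext1 i
    refine Fin.cases ?_ (fun i => ?_) i
    · simp [dropVar, shift_X]
    · simp only [AlgHom.comp_apply, shift_X, dropVar, aeval_X, Fin.cons_succ, Finset.mem_map,
        Fin.coe_succEmb, Fin.succ_inj, exists_eq_right]
      split_ifs <;> simp [algHom_C]
  exact DFunLike.congr_fun h f

theorem dropVar_shift_insert (q : F) (J : Finset (Fin N)) (f : MvPolynomial (Fin (N + 1)) F) :
    dropVar F N (shift q (insert 0 (J.map (Fin.succEmb N))) f) = shift q J (dropVar F N f) := by
  have h : (dropVar F N).comp (shift q (insert 0 (J.map (Fin.succEmb N)))) =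
      (shift q J).comp (dropVar F N) := by
    ext1 i
    refine Fin.cases ?_ (fun i => ?_) i
    · simp [dropVar, shift_X]
    · simp only [AlgHom.comp_apply, shift_X, dropVar, aeval_X, Fin.cons_succ, Finset.mem_map,
        Finset.mem_insert, Fin.succ_ne_zero, false_or,
        Fin.coe_succEmb, Fin.succ_inj, exists_eq_right]
      split_ifs <;> simp [algHom_C]
  exact DFunLike.congr_fun h f

theorem sum_finset_fin_succ {M : Type*} [AddCommMonoid M] (g : Finset (Fin (N + 1)) → M) :
    ∑ I, g I = ∑ J : Finset (Fin N),
      (g (J.map (Fin.succEmb N)) + g (insert 0 (J.map (Fin.succEmb N)))) := by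
  have hu : (Finset.univ : Finset (Fin (N + 1))) =
      insert 0 (Finset.univ.map (Fin.succEmb N)) := by
    rw [Fin.univ_succ, Finset.cons_eq_insert]; rfl
  have hp : (Finset.univ.map (Fin.succEmb N)).powerset =
      (Finset.univ : Finset (Finset (Fin N))).map (Finset.mapEmbedding (Fin.succEmb N)).toEmbedding := by
    ext t
    simp only [Finset.mem_powerset, Finset.subset_map_iff, Finset.subset_univ, true_and,
      Finset.mem_map, Finset.mem_univ, RelEmbedding.coe_toEmbedding, Finset.mapEmbedding_apply]
    exact exists_congr fun u => eq_comm
  rw [← Finset.powerset_univ, hu, Finset.sum_powerset_insert (by simp), hp, Finset.sum_map,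
    Finset.sum_map, ← Finset.sum_add_distrib]
  rfl

/-- Only permutations with `w 0 = 0` survive `x_0 = 0`. The shift of the lost variable contributes
`1 + Y`; the other exponents `w_i` are at least `1`, and lowering them by `1` produces `∏ x_i` and
replaces `Y` by `τ Y`. -/
theorem dropVar_polyOp (q τ Y : F) (f : MvPolynomial (Fin (N + 1)) F) :
    dropVar F N (polyOp q τ Y f) =
      C (1 + Y) * (∏ i, X i) * polyOp q τ (τ * Y) (dropVar F N f) := by
  -- A permutation of `N + 1` letters is split into the image of `0` and a permutation of the
  -- remaining `N` letters.
  rw [polyOp, altOp, map_sum, Finset.univ_perm_fin_succ, Finset.sum_map,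
    Fintype.sum_prod_type, Finset.sum_eq_single 0]
  · rw [polyOp, altOp, Finset.mul_sum]
    refine Finset.sum_congr rfl fun e _ => ?_
    simp only [Equiv.toEmbedding_apply, Units.smul_def, map_zsmul]
    rw [Equiv.Perm.decomposeFin.symm_sign, if_pos rfl, one_mul, mul_smul_comm]
    congr 1
    rw [map_mul, map_prod, Fin.prod_univ_succ, map_sum]
    simp only [Equiv.Perm.decomposeFin_symm_apply_zero, Equiv.Perm.decomposeFin_symm_apply_succ,
      Equiv.swap_self, Equiv.refl_apply, Fin.val_zero, pow_zero, map_one, one_mul, map_pow]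
    have hX : ∀ i : Fin N, dropVar F N (X i.succ) = X i := fun i => by simp [dropVar]
    simp only [hX, Fin.val_succ, pow_succ, Finset.prod_mul_distrib]
    rw [sum_finset_fin_succ, mul_comm (C (1 + Y)), mul_comm (∏ x, X x ^ _), mul_assoc, mul_assoc,
      mul_left_comm (C (1 + Y))]
    congr 2
    rw [Finset.mul_sum]
    refine Finset.sum_congr rfl fun J _ => ?_
    have h0 : (0 : Fin (N + 1)) ∉ J.map (Fin.succEmb N) := by simp
    rw [Finset.card_insert_of_notMem h0, Finset.sum_insert h0]
    simp only [Finset.card_map, Finset.sum_map, Fin.coe_succEmb, map_mul, map_pow, algHom_C,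
      algebraMap_eq, RingHom.coe_coe, dropVar_shift, dropVar_shift_insert,
      Equiv.Perm.decomposeFin_symm_apply_zero, Equiv.Perm.decomposeFin_symm_apply_succ,
      Equiv.swap_self, Equiv.refl_apply, Fin.val_zero, Fin.val_succ, Finset.sum_add_distrib,
      Finset.sum_const, smul_eq_mul, mul_one, C_add, C_1, pow_add, mul_pow, pow_succ]
    ring
  · intro p _ hp
    refine Finset.sum_eq_zero fun e _ => ?_
    simp only [Equiv.toEmbedding_apply, Units.smul_def, map_zsmul]
    rw [map_mul, map_prod, Fin.prod_univ_succ]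
    have : dropVar F N (X 0 ^ ((Equiv.Perm.decomposeFin.symm (p, e) 0 : Fin (N + 1)) : ℕ)) = 0 := by
      rw [Equiv.Perm.decomposeFin_symm_apply_zero, map_pow]
      simp only [dropVar, aeval_X, Fin.cons_zero]
      exact zero_pow fun h => hp (Fin.ext h)
    rw [this]
    simp
  · simp

theorem dropVar_vdm : dropVar F N (vdm (N + 1) F) = (∏ i, X i) * vdm N F := by
  have h := dropVar_polyOp (N := N) (1 : F) 1 0 1
  simpa [polyOp_zero] using h

end

/-! ### Exponentials of power series -/

section

variable {R R' : Type*} [CommRing R] [CommRing R']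
variable (F : Type*) [Field F] [Algebra F R] [Algebra F R']

/-- The coefficients of `exp (∑_r a_r u ^ r / r)`. -/
def expCoeff (a : ℕ → R) : ℕ → R
  | 0 => 1
  | n + 1 => ((n + 1 : F)⁻¹) • ∑ i : Fin (n + 1), a (i + 1) * expCoeff a (n - i)

/-- `exp (∑_r a_r u ^ r / r)`. -/
def expSeries (a : ℕ → R) : PowerSeries R := PowerSeries.mk (expCoeff F a)

theorem smul_expCoeff_succ [CharZero F] (a : ℕ → R) (n : ℕ) :
    expCoeff F a (n + 1) * (n + 1) =
      ∑ i ∈ Finset.range (n + 1), a (i + 1) * expCoeff F a (n - i) := by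
  rw [expCoeff, Fin.sum_univ_eq_sum_range (fun i => a (i + 1) * expCoeff F a (n - i))]
  have h : (n + 1 : R) = algebraMap F R (n + 1) := by simp
  rw [h, mul_comm, ← Algebra.smul_def, smul_smul, mul_inv_cancel₀ (Nat.cast_add_one_ne_zero n), one_smul]

theorem derivative_expSeries [CharZero F] (a : ℕ → R) :
    PowerSeries.derivative R (expSeries F a) =
      (PowerSeries.mk fun r => a (r + 1)) * expSeries F a := by
  ext n
  rw [PowerSeries.coeff_derivative, PowerSeries.coeff_mul, expSeries, PowerSeries.coeff_mk,
    smul_expCoeff_succ, Finset.Nat.sum_antidiagonal_eq_sum_range_succ_mk]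
  simp

/-- A linear differential equation determines its solution from the constant term. Exponential
identities are proved below in this way. -/
theorem eq_of_derivative_eq (F : Type*) [Field F] [CharZero F] [Algebra F R]
    {A f g : PowerSeries R} (h0 : PowerSeries.coeff 0 f = PowerSeries.coeff 0 g)
    (hf : PowerSeries.derivative R f = A * f) (hg : PowerSeries.derivative R g = A * g) :
    f = g := by
  ext n
  induction n using Nat.strong_induction_on with
  | _ n ih =>
    rcases n with _ | n
    · exact h0
    · have h1 := congrArg (PowerSeries.coeff n) hf
      have h2 := congrArg (PowerSeries.coeff n) hg
      rw [PowerSeries.coeff_derivative, PowerSeries.coeff_mul] at h1 h2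
      have h3 : PowerSeries.coeff (n + 1) f * (n + 1 : R) =
          PowerSeries.coeff (n + 1) g * (n + 1) := by
        rw [h1, h2]
        refine Finset.sum_congr rfl fun p hp => ?_
        rw [ih p.2 (by have := Finset.HasAntidiagonal.mem_antidiagonal.mp hp; omega)]
      have h : (n + 1 : R) = algebraMap F R (n + 1) := by simp
      rw [h, mul_comm, mul_comm _ (algebraMap F R _), ← Algebra.smul_def, ← Algebra.smul_def] at h3
      have h4 := congrArg (fun c => (n + 1 : F)⁻¹ • c) h3
      simpa only [inv_smul_smul₀ (Nat.cast_add_one_ne_zero (R := F) n)] using h4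

theorem map_expCoeff (h : R →ₐ[F] R') (a : ℕ → R) (n : ℕ) :
    h (expCoeff F a n) = expCoeff F (fun r => h (a r)) n := by
  induction n using Nat.strong_induction_on with
  | _ n ih =>
    rcases n with _ | n
    · simp [expCoeff]
    · simp only [expCoeff, map_smul, map_sum, map_mul]
      congr 1
      refine Finset.sum_congr rfl fun i _ => ?_
      rw [ih _ (by omega)]

theorem map_expSeries (h : R →ₐ[F] R') (a : ℕ → R) :
    PowerSeries.map (h : R →+* R') (expSeries F a) = expSeries F fun r => h (a r) := by
  ext n
  rw [PowerSeries.coeff_map, expSeries, expSeries, PowerSeries.coeff_mk, PowerSeries.coeff_mk]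
  exact map_expCoeff F h a n

/-- This is `exp (∑ cʳ uʳ / r) = 1 / (1 - c u)`: adding `cʳ` to the logarithm divides the series by
`1 - c u`. -/
theorem one_sub_mul_expSeries [CharZero F] (a : ℕ → R) (c : R) :
    (1 - PowerSeries.C c * PowerSeries.X) * expSeries F (fun r => a r + c ^ r) =
      expSeries F a := by
  refine eq_of_derivative_eq F (A := PowerSeries.mk fun r => a (r + 1)) ?_ ?_
    (derivative_expSeries F a)
  · simp [expSeries, expCoeff, PowerSeries.coeff_zero_eq_constantCoeff_apply]
  · have h1 : (PowerSeries.mk fun r => a (r + 1) + c ^ (r + 1)) =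
        (PowerSeries.mk fun r => a (r + 1)) +
          PowerSeries.C c * PowerSeries.mk fun r => c ^ r := by
      ext n; simp [pow_succ']
    have h2 : (1 - PowerSeries.C c * PowerSeries.X) * (PowerSeries.mk fun r => c ^ r) = 1 := by
      ext n
      rw [sub_mul, one_mul, mul_assoc, map_sub, PowerSeries.coeff_C_mul]
      rcases n with _ | n
      · simp
      · simp [PowerSeries.coeff_succ_X_mul, pow_succ', PowerSeries.coeff_one]
    rw [Derivation.leibniz, derivative_expSeries, h1]
    simp only [smul_eq_mul, map_sub, Derivation.leibniz, PowerSeries.derivative_X,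
      PowerSeries.derivative_C, Derivation.map_one_eq_zero]
    linear_combination (PowerSeries.C c * expSeries F fun r => a r + c ^ r) * h2

theorem prod_one_sub_mul_expSeries {ι : Type*} [CharZero F] (s : Finset ι) (c : ι → R) (a : ℕ → R) :
    (∏ i ∈ s, (1 - PowerSeries.C (c i) * PowerSeries.X)) *
      expSeries F (fun r => a r + ∑ i ∈ s, c i ^ r) = expSeries F a := by
  classical
  induction s using Finset.induction_on generalizing a with
  | empty => simp
  | insert i s hi ih =>
    rw [Finset.prod_insert hi, mul_assoc]
    have h : (fun r => a r + ∑ j ∈ insert i s, c j ^ r) =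
        fun r => (a r + c i ^ r) + ∑ j ∈ s, c j ^ r := by
      funext r; rw [Finset.sum_insert hi, add_assoc]
    rw [h, ih, one_sub_mul_expSeries]

end

section

variable {F : Type*} [Field F] [CharZero F]

/-- The coefficients of `exp (∑_r X_r u ^ r)`. -/
theorem coeff_expCoeff_X (n : ℕ) (d : ℕ+ →₀ ℕ) :
    coeff d (expCoeff F (fun r => C (r : F) * (X r.toPNat' : Sym F)) n) =
      if Finsupp.weight (fun r : ℕ+ => (r : ℕ)) d = n then
        (d.prod fun _ e => (e.factorial : F))⁻¹ else 0 := by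
  classical
  induction n using Nat.strong_induction_on generalizing d with
  | _ n ih =>
    rcases n with _ | n
    · rw [expCoeff, coeff_one]
      by_cases hd : d = 0
      · subst hd; simp
      · rw [if_neg (Ne.symm hd), if_neg]
        intro h
        apply hd
        rw [Finsupp.weight_apply, Finsupp.sum, Finset.sum_eq_zero_iff] at h
        ext s
        by_contra hs
        have := h s (Finsupp.mem_support_iff.mpr hs)
        simp at this
        exact hs (by simpa using this)
    · rw [expCoeff, coeff_smul, coeff_sum]
      -- In Newton's recursion, multiplication by `(i + 1) X_{i+1}` accounts for `(i + 1) d_{i+1}`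
      -- times the expected coefficient; these multiplicities add up to the weight of `d`, which is
      -- `n + 1`.
      have hterm : ∀ i : Fin (n + 1),
          coeff d (C (((i : ℕ) + 1 : ℕ) : F) * (X ((i : ℕ) + 1).toPNat' : Sym F) *
            expCoeff F (fun r => C (r : F) * (X r.toPNat' : Sym F)) (n - i)) =
          if Finsupp.weight (fun r : ℕ+ => (r : ℕ)) d = n + 1 then
            ((((i : ℕ) + 1) * d ((i : ℕ) + 1).toPNat' : ℕ) : F) *
              (d.prod fun _ e => (e.factorial : F))⁻¹ else 0 := by
        intro i
        set s : ℕ+ := ((i : ℕ) + 1).toPNat' with hs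
        have hsv : (s : ℕ) = i + 1 := by rw [hs, PNat.toPNat'_coe (Nat.succ_pos _)]
        rw [mul_assoc, coeff_C_mul, coeff_X_mul', ih _ (by omega)]
        by_cases hmem : s ∈ d.support
        · rw [if_pos hmem]
          have hpos : 1 ≤ d s := Nat.one_le_iff_ne_zero.mpr (Finsupp.mem_support_iff.mp hmem)
          have hd : d - Finsupp.single s 1 + Finsupp.single s 1 = d :=
            tsub_add_cancel_of_le (Finsupp.single_le_iff.mpr hpos)
          have hw : Finsupp.weight (fun r : ℕ+ => (r : ℕ)) d =
              Finsupp.weight (fun r : ℕ+ => (r : ℕ)) (d - Finsupp.single s 1) + (i + 1) := by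
            conv_lhs => rw [← hd, map_add]
            simp [Finsupp.weight_apply, hsv]
          have hfac : (d.prod fun _ e => (e.factorial : F)) =
              d s * ((d - Finsupp.single s 1).prod fun _ e => (e.factorial : F)) := by
            have h1 := Finsupp.mul_prod_erase d s (fun _ e => (e.factorial : F)) hmem
            have h2 : ((d - Finsupp.single s 1).prod fun _ e => (e.factorial : F)) =
                ((d s - 1).factorial : F) * ((d.erase s).prod fun _ e => (e.factorial : F)) := by
              have h3 : (d - Finsupp.single s 1).erase s = d.erase s := by
                ext t
                by_cases ht : t = s
                · simp [ht]
                · simp [Finsupp.erase_ne ht, ht]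
              have h4 := Finsupp.mul_prod_erase' (d - Finsupp.single s 1) s
                (fun _ e => (e.factorial : F)) (by simp)
              rw [h3] at h4
              rw [← h4]
              simp
            rw [← h1, h2, ← mul_assoc]
            congr 1
            rw [← Nat.cast_mul, Nat.mul_factorial_pred (by omega)]
          have hds : (d s : F) ≠ 0 := by exact_mod_cast (by omega : d s ≠ 0)
          by_cases hwt : Finsupp.weight (fun r : ℕ+ => (r : ℕ)) d = n + 1
          · rw [if_pos hwt, if_pos (by omega), hfac]
            push_cast
            field_simp
          · rw [if_neg hwt, if_neg (by omega), mul_zero]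
        · rw [if_neg hmem]
          have h0 : d s = 0 := by simpa using hmem
          rw [h0]
          simp
      rw [Finset.sum_congr rfl fun i _ => hterm i]
      split_ifs with hwt
      · rw [← Finset.sum_mul, ← Nat.cast_sum]
        have hsum : ∑ i : Fin (n + 1), ((i : ℕ) + 1) * d ((i : ℕ) + 1).toPNat' = n + 1 := by
          rw [Fin.sum_univ_eq_sum_range (fun i => (i + 1) * d (i + 1).toPNat')]
          have hwt' := hwt
          rw [Finsupp.weight_apply, Finsupp.sum] at hwt'
          refine Eq.trans ?_ hwt'
          rw [Finset.sum_subset (s₁ := d.support)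
            (s₂ := (Finset.range (n + 1)).map ⟨Nat.succPNat, Nat.succPNat_injective⟩),
            Finset.sum_map]
          · refine Finset.sum_congr rfl fun i _ => ?_
            simp [mul_comm]
            rfl
          · intro s hs
            rw [Finset.mem_map]
            refine ⟨s.natPred, ?_, by simp⟩
            have h1 : d s • (s : ℕ) ≤ n + 1 := by
              rw [← hwt, Finsupp.weight_apply, Finsupp.sum]
              exact Finset.single_le_sum (f := fun s => d s • (s : ℕ)) (fun _ _ => Nat.zero_le _) hs
            have h2 : 1 ≤ d s := Nat.one_le_iff_ne_zero.mpr (Finsupp.mem_support_iff.mp hs)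
            have h3 : (s : ℕ) ≤ n + 1 := le_trans (Nat.le_mul_of_pos_left _ h2) h1
            have h4 := s.natPred_add_one
            simp only [Finset.mem_range]
            omega
          · intro s _ hs
            simp [Finsupp.notMem_support_iff.mp hs]
        rw [hsum, smul_eq_mul]
        push_cast
        rw [← mul_assoc, inv_mul_cancel₀ (Nat.cast_add_one_ne_zero n), one_mul]
      · simp

end

/-! ### Symmetry of the Macdonald operator on the Cauchy kernel -/

section

variable {S : Type*} [CommRing S] {N : ℕ}

/-- The coefficients of the polynomials `∏_{j' ≠ j} (1 - u y_{j'} x)` in `x`. -/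
def cauchyCoeff (u : S) (y : Fin N → S) : Matrix (Fin N) (Fin N) S :=
  Matrix.of fun j k => (∏ j' ∈ Finset.univ.erase j,
    (1 - Polynomial.C (u * y j') * Polynomial.X : Polynomial S)).coeff k

theorem sum_cauchyCoeff (u : S) (y : Fin N → S) (j : Fin N) (x : S) :
    ∑ k, cauchyCoeff u y j k * x ^ (k : ℕ) = ∏ j' ∈ Finset.univ.erase j, (1 - u * x * y j') := by
  have hdeg : (∏ j' ∈ Finset.univ.erase j,
      (1 - Polynomial.C (u * y j') * Polynomial.X : Polynomial S)).natDegree < N := by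
    refine (Polynomial.natDegree_prod_le _ _).trans_lt ?_
    calc _ ≤ ∑ _j' ∈ Finset.univ.erase j, 1 := Finset.sum_le_sum fun i _ => by
            refine (Polynomial.natDegree_sub_le _ _).trans ?_
            simp only [Polynomial.natDegree_one, zero_le, sup_of_le_right]
            exact (Polynomial.natDegree_C_mul_le _ _).trans Polynomial.natDegree_X_le
      _ < N := by
            have := j.pos
            simp [Finset.card_erase_of_mem]
            omega
  have h := Polynomial.eval_eq_sum_range' hdeg x
  rw [← Fin.sum_univ_eq_sum_range (fun k => (∏ j' ∈ Finset.univ.erase j,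
    (1 - Polynomial.C (u * y j') * Polynomial.X : Polynomial S)).coeff k * x ^ k)] at h
  refine h.symm.trans ?_
  rw [Polynomial.eval_prod]
  refine Finset.prod_congr rfl fun j' _ => ?_
  simp
  ring

/-- Over the fraction field, evaluating the polynomials `∏_{j' ≠ j} (1 - u y_{j'} x)` at the points
`1 / (u y_i)` gives a diagonal matrix with nonzero entries. -/
theorem det_cauchyCoeff_ne_zero [IsDomain S] {u : S} {y : Fin N → S} (hu : u ≠ 0)
    (hy : ∀ i, y i ≠ 0) (hinj : Function.Injective y) : (cauchyCoeff u y).det ≠ 0 := by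
  let L := FractionRing S
  let ι : S →+* L := algebraMap S L
  have hι : Function.Injective ι := IsFractionRing.injective S L
  have hι0 : ∀ {a}, a ≠ 0 → ι a ≠ 0 := fun {a} ha h => ha (hι (by rw [h, map_zero]))
  intro h
  have h1 : (cauchyCoeff (ι u) fun i => ι (y i)).det = 0 := by
    have h2 : (cauchyCoeff (ι u) fun i => ι (y i)) = (cauchyCoeff u y).map ι := by
      ext j k
      simp only [cauchyCoeff, Matrix.of_apply, Matrix.map_apply]
      rw [← Polynomial.coeff_map, Polynomial.map_prod]
      simp
    rw [h2, ← RingHom.mapMatrix_apply, ← RingHom.map_det, h, map_zero]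
  have h3 : ((cauchyCoeff (ι u) fun i => ι (y i)) *
      Matrix.of fun k i : Fin N => ((ι u * ι (y i))⁻¹) ^ (k : ℕ)).det ≠ 0 := by
    have h4 : (cauchyCoeff (ι u) fun i => ι (y i)) *
        (Matrix.of fun k i : Fin N => ((ι u * ι (y i))⁻¹) ^ (k : ℕ)) =
        Matrix.diagonal fun i => ∏ j' ∈ Finset.univ.erase i, (1 - (ι (y i))⁻¹ * ι (y j')) := by
      have hc : ∀ i j', ι u * (ι u * ι (y i))⁻¹ * ι (y j') = (ι (y i))⁻¹ * ι (y j') := by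
        intro i j'
        rw [mul_inv, mul_inv_cancel_left₀ (hι0 hu)]
      ext j i
      rw [Matrix.mul_apply]
      simp only [Matrix.of_apply]
      rw [sum_cauchyCoeff]
      simp only [hc]
      by_cases hij : j = i
      · subst hij; rw [Matrix.diagonal_apply_eq]
      · rw [Matrix.diagonal_apply_ne _ hij]
        refine Finset.prod_eq_zero (i := i) (Finset.mem_erase.mpr ⟨Ne.symm hij, Finset.mem_univ _⟩) ?_
        rw [inv_mul_cancel₀ (hι0 (hy i)), sub_self]
    rw [h4, Matrix.det_diagonal, Finset.prod_ne_zero_iff]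
    intro i _
    rw [Finset.prod_ne_zero_iff]
    intro j hj h5
    rw [sub_eq_zero, eq_comm, inv_mul_eq_one₀ (hι0 (hy i))] at h5
    exact (Finset.mem_erase.mp hj).1 (hinj (hι h5)).symm
  rw [Matrix.det_mul, h1, zero_mul] at h3
  exact h3 rfl

/-- The determinant by which the operator acts on the Cauchy kernel, cleared of denominators. -/
def kernelDet (u τ Y : S) (x y : Fin N → S) : S :=
  Matrix.det (Matrix.of fun k i : Fin N => x i ^ (k : ℕ) *
    ((∏ j, (1 - τ * (u * x i * y j))) + Y * τ ^ (k : ℕ) * ∏ j, (1 - u * x i * y j)))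

/-- Multiplying by `cauchyCoeff` evaluates its polynomials at `x_i` and `τ x_i`. Up to a factor
symmetric in the two alphabets, the result is the Cauchy-type matrix with entries `1 / (1 - u x_i
y_j) + Y / (1 - τ u x_i y_j)`; exchanging `x` and `y` transposes it. The units in the hypotheses
provide these inverses. -/
theorem det_cauchyCoeff_mul_kernelDet (u τ Y : S) (x y : Fin N → S)
    (hr : ∀ i j, IsUnit (1 - u * x i * y j)) (hs : ∀ i j, IsUnit (1 - τ * (u * x i * y j))) :
    (cauchyCoeff u y).det * kernelDet u τ Y x y =
      (cauchyCoeff u x).det * kernelDet u τ Y y x := by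
  have key : ∀ (x y : Fin N → S) (v : Fin N → Fin N → S),
      (∀ i j, (1 - u * x i * y j) * (1 - τ * (u * x i * y j)) * v i j = 1) →
      (cauchyCoeff u y).det * kernelDet u τ Y x y =
        (∏ i, ∏ j, ((1 - u * x i * y j) * (1 - τ * (u * x i * y j)))) *
          Matrix.det (Matrix.of fun j i : Fin N =>
            ((1 - τ * (u * x i * y j)) + Y * (1 - u * x i * y j)) * v i j) := by
    intro x y v hv
    rw [kernelDet, ← Matrix.det_mul, ← Matrix.det_mul_row]
    congr 1
    ext j i
    rw [Matrix.mul_apply]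
    simp only [Matrix.of_apply]
    have h1 : ∀ k : Fin N, cauchyCoeff u y j k * (x i ^ (k : ℕ) *
        ((∏ j, (1 - τ * (u * x i * y j))) + Y * τ ^ (k : ℕ) * ∏ j, (1 - u * x i * y j))) =
        (cauchyCoeff u y j k * x i ^ (k : ℕ)) * (∏ j, (1 - τ * (u * x i * y j))) +
        (cauchyCoeff u y j k * (τ * x i) ^ (k : ℕ)) * (Y * ∏ j, (1 - u * x i * y j)) := by
      intro k; rw [mul_pow]; ring
    rw [Finset.sum_congr rfl fun k _ => h1 k, Finset.sum_add_distrib, ← Finset.sum_mul,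
      ← Finset.sum_mul, sum_cauchyCoeff, sum_cauchyCoeff]
    have h2 : ∀ j', 1 - u * (τ * x i) * y j' = 1 - τ * (u * x i * y j') := fun j' => by ring
    simp only [h2]
    rw [Finset.prod_mul_distrib, ← Finset.mul_prod_erase Finset.univ _ (Finset.mem_univ j),
      ← Finset.mul_prod_erase Finset.univ (fun j' => 1 - u * x i * y j') (Finset.mem_univ j)]
    linear_combination (-(((1 - τ * (u * x i * y j)) + Y * (1 - u * x i * y j)) *
      (∏ x_1 ∈ Finset.univ.erase j, (1 - τ * (u * x i * y x_1))) *
      ∏ x_1 ∈ Finset.univ.erase j, (1 - u * x i * y x_1))) * hv i j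
  choose v hv using fun i j => ((hr i j).mul (hs i j)).exists_right_inv
  rw [key x y v hv, key y x (fun i j => v j i) fun i j => by
    rw [mul_right_comm u (y i) (x j)]; exact hv j i]
  rw [Finset.prod_comm]
  congr 1
  · refine Finset.prod_congr rfl fun j _ => Finset.prod_congr rfl fun i _ => ?_
    rw [mul_right_comm u (y j) (x i)]
  · rw [← Matrix.det_transpose]
    congr 1
    ext i j
    simp only [Matrix.transpose_apply, Matrix.of_apply]
    rw [mul_right_comm u (x i) (y j)]

theorem kernelDet_zero (u τ : S) (x y : Fin N → S) :
    kernelDet u τ 0 x y = (∏ i, ∏ j, (1 - τ * (u * x i * y j))) *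
      Matrix.det (Matrix.of fun k i : Fin N => x i ^ (k : ℕ)) := by
  rw [kernelDet, ← Matrix.det_mul_row]
  congr 1
  ext k i
  simp only [Matrix.of_apply]
  ring

/-- The case `Y = 0` of the previous identity relates the two Cauchy determinants to the two
Vandermonde determinants. Combining it with the case of general `Y` eliminates the Cauchy
determinants. -/
theorem kernelDet_symm [IsDomain S] (u τ Y : S) (x y : Fin N → S)
    (hr : ∀ i j, IsUnit (1 - u * x i * y j)) (hs : ∀ i j, IsUnit (1 - τ * (u * x i * y j)))
    (hu : u ≠ 0) (hx : ∀ i, x i ≠ 0) (hinj : Function.Injective x) :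
    kernelDet u τ Y x y * Matrix.det (Matrix.of fun k i : Fin N => y i ^ (k : ℕ)) =
      kernelDet u τ Y y x * Matrix.det (Matrix.of fun k i : Fin N => x i ^ (k : ℕ)) := by
  have h1 := det_cauchyCoeff_mul_kernelDet u τ Y x y hr hs
  have h2 := det_cauchyCoeff_mul_kernelDet u τ 0 x y hr hs
  rw [kernelDet_zero, kernelDet_zero] at h2
  have h3 : (∏ i, ∏ j, (1 - τ * (u * y i * x j))) = ∏ i, ∏ j, (1 - τ * (u * x i * y j)) := by
    rw [Finset.prod_comm]
    refine Finset.prod_congr rfl fun j _ => Finset.prod_congr rfl fun i _ => ?_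
    rw [mul_right_comm u (y i) (x j)]
  have h4 : (∏ i, ∏ j, (1 - τ * (u * x i * y j))) ≠ 0 := by
    rw [Finset.prod_ne_zero_iff]
    intro i _
    rw [Finset.prod_ne_zero_iff]
    exact fun j _ => (hs i j).ne_zero
  rw [h3, mul_left_comm, mul_left_comm (cauchyCoeff u x).det] at h2
  have h5 := mul_left_cancel₀ h4 h2
  refine mul_left_cancel₀ (det_cauchyCoeff_ne_zero hu hx hinj) ?_
  linear_combination (Matrix.det (Matrix.of fun k i : Fin N => x i ^ (k : ℕ))) * h1 -
    kernelDet u τ Y x y * h5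

end

/-! ### The Cauchy kernel -/

/-- `q` and `τ` are nonzero and multiplicatively independent. -/
structure IsGenericPair {F : Type*} [Field F] (q τ : F) : Prop where
  left_ne_zero : q ≠ 0
  right_ne_zero : τ ≠ 0
  eq_zero_of_zpow : ∀ a b : ℤ, q ^ a * τ ^ b = 1 → a = 0 ∧ b = 0

namespace IsGenericPair

variable {F : Type*} [Field F] {q τ : F}

theorem one_sub_left_ne_zero (h : IsGenericPair q τ) {r : ℕ} (hr : 0 < r) : 1 - q ^ r ≠ 0 := by
  intro h0
  have := (h.eq_zero_of_zpow r 0 (by rw [zpow_natCast, zpow_zero, mul_one]; exact (sub_eq_zero.mp h0).symm)).1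
  omega

theorem one_sub_right_ne_zero (h : IsGenericPair q τ) {r : ℕ} (hr : 0 < r) : 1 - τ ^ r ≠ 0 := by
  intro h0
  have := (h.eq_zero_of_zpow 0 r (by rw [zpow_natCast, zpow_zero, one_mul]; exact (sub_eq_zero.mp h0).symm)).2
  omega

end IsGenericPair

section

variable {F : Type*} [Field F] {q τ : F} {N : ℕ} {σ : Type*}

/-- The logarithm of the Cauchy kernel in two alphabets among the variables. -/
def kernelSeq (q τ : F) (ex ey : Fin N → σ) (r : ℕ) : MvPolynomial σ F :=
  C ((1 - τ ^ r) / (1 - q ^ r)) * ((∑ i, X (ex i) ^ r) * ∑ j, X (ey j) ^ r)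

theorem kernelSeq_comm (ex ey : Fin N → σ) : kernelSeq q τ ex ey = kernelSeq q τ ey ex := by
  funext r
  rw [kernelSeq, kernelSeq, mul_comm (∑ i, _)]

/-- Because `(qʳ - 1)(1 - τʳ)/(1 - qʳ) = τʳ - 1`, the shift multiplies the kernel by `∏ (1 - u x_i
y_j) / (1 - τ u x_i y_j)` over `i ∈ I`. The identity is its logarithm, arranged without subtraction.
-/
theorem shift_kernelSeq [DecidableEq σ] (h : IsGenericPair q τ) (ex : Fin N ↪ σ) (ey : Fin N → σ)
    (hxy : ∀ i j, ex i ≠ ey j) (I : Finset (Fin N)) (r : ℕ) :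
    shift q (I.map ex) (kernelSeq q τ ex ey r) +
        ∑ p ∈ I ×ˢ Finset.univ, (X (ex p.1) * X (ey p.2)) ^ r =
      kernelSeq q τ ex ey r + ∑ p ∈ I ×ˢ Finset.univ, (C τ * (X (ex p.1) * X (ey p.2))) ^ r := by
  have h1 : shift q (I.map ex) (∑ i, X (ex i) ^ r) =
      (∑ i, X (ex i) ^ r) + (C (q ^ r) - 1) * ∑ i ∈ I, X (ex i) ^ r := by
    rw [map_sum, Finset.mul_sum, ← Fintype.sum_ite_mem I, ← Finset.sum_add_distrib]
    refine Finset.sum_congr rfl fun i _ => ?_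
    rw [map_pow, shift_X]
    simp only [Finset.mem_map']
    split_ifs
    · rw [mul_pow, C_pow]; ring
    · simp
  have h2 : shift q (I.map ex) (∑ j, (X (ey j) : MvPolynomial σ F) ^ r) = ∑ j, X (ey j) ^ r := by
    rw [map_sum]
    refine Finset.sum_congr rfl fun j _ => ?_
    rw [map_pow, shift_X, if_neg]
    rw [Finset.mem_map]
    rintro ⟨i, -, hi⟩
    exact hxy i j hi
  have h3 : ∀ c : MvPolynomial σ F, ∑ p ∈ I ×ˢ Finset.univ, (c * (X (ex p.1) * X (ey p.2))) ^ r =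
      c ^ r * ((∑ i ∈ I, X (ex i) ^ r) * ∑ j, X (ey j) ^ r) := by
    intro c
    rw [Finset.sum_product, Finset.sum_mul_sum, Finset.mul_sum]
    refine Finset.sum_congr rfl fun i _ => ?_
    rw [Finset.mul_sum]
    exact Finset.sum_congr rfl fun j _ => by rw [mul_pow, mul_pow]
  have h4 := h3 1
  simp only [one_mul, one_pow] at h4
  rw [h3, h4, kernelSeq, map_mul, map_mul, h1, h2, algHom_C, algebraMap_eq]
  rcases r.eq_zero_or_pos with rfl | hr
  · simp
  · have h5 : (C ((1 - τ ^ r) / (1 - q ^ r)) : MvPolynomial σ F) * (C (q ^ r) - 1) =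
        C τ ^ r - 1 := by
      rw [← C_1, ← C_sub, ← C_mul, ← C_pow, ← C_sub]
      congr 1
      have := h.one_sub_left_ne_zero hr
      field_simp
      ring
    linear_combination ((∑ i ∈ I, X (ex i) ^ r) * ∑ j, X (ey j) ^ r) * h5

theorem map_shift_kernel [CharZero F] [DecidableEq σ] (h : IsGenericPair q τ) (ex : Fin N ↪ σ) (ey : Fin N → σ)
    (hxy : ∀ i j, ex i ≠ ey j) (I : Finset (Fin N)) :
    (∏ i ∈ I, ∏ j, (1 - PowerSeries.C (C τ) * (PowerSeries.X * PowerSeries.C (X (ex i)) *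
        PowerSeries.C (X (ey j))))) *
      PowerSeries.map (shift q (I.map ex) : MvPolynomial σ F →+* MvPolynomial σ F)
        (expSeries F (kernelSeq q τ ex ey)) =
    expSeries F (kernelSeq q τ ex ey) * ∏ i ∈ I, ∏ j, (1 - PowerSeries.X *
      PowerSeries.C (X (ex i)) * PowerSeries.C (X (ey j))) := by
  rw [map_expSeries]
  have h1 := prod_one_sub_mul_expSeries F (I ×ˢ (Finset.univ : Finset (Fin N)))
    (fun p => (X (ex p.1) * X (ey p.2) : MvPolynomial σ F))
    (fun r => shift q (I.map ex) (kernelSeq q τ ex ey r))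
  have h2 := prod_one_sub_mul_expSeries F (I ×ˢ (Finset.univ : Finset (Fin N)))
    (fun p => (C τ * (X (ex p.1) * X (ey p.2)) : MvPolynomial σ F)) (kernelSeq q τ ex ey)
  rw [funext (shift_kernelSeq h ex ey hxy I)] at h1
  rw [← h1, ← h2, Finset.prod_product, Finset.prod_product]
  have h3 : ∀ i j, (1 - PowerSeries.C (C τ * (X (ex i) * X (ey j)) : MvPolynomial σ F) *
      PowerSeries.X) = 1 - PowerSeries.C (C τ) * (PowerSeries.X * PowerSeries.C (X (ex i)) *
        PowerSeries.C (X (ey j))) := fun i j => by simp only [map_mul]; ring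
  have h4 : ∀ i j, (1 - PowerSeries.C (X (ex i) * X (ey j) : MvPolynomial σ F) *
      PowerSeries.X) = 1 - PowerSeries.X * PowerSeries.C (X (ex i)) *
        PowerSeries.C (X (ey j)) := fun i j => by simp only [map_mul]; ring
  simp only [h3, h4]
  ring

theorem altOp_kernel [CharZero F] [DecidableEq σ] (h : IsGenericPair q τ) (Y : F) (ex : Fin N ↪ σ) (ey : Fin N → σ)
    (hxy : ∀ i j, ex i ≠ ey j) :
    (∏ i, ∏ j, (1 - PowerSeries.C (C τ) * (PowerSeries.X * PowerSeries.C (X (ex i)) *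
        PowerSeries.C (X (ey j))))) *
      altOp (fun i => PowerSeries.C (X (ex i) : MvPolynomial σ F))
        (fun I => PowerSeries.map (shift q (I.map ex) : MvPolynomial σ F →+* MvPolynomial σ F))
        (PowerSeries.C (C τ)) (PowerSeries.C (C Y)) (expSeries F (kernelSeq q τ ex ey)) =
    expSeries F (kernelSeq q τ ex ey) * kernelDet PowerSeries.X (PowerSeries.C (C τ))
      (PowerSeries.C (C Y)) (fun i => PowerSeries.C (X (ex i))) fun j => PowerSeries.C (X (ey j)) :=
  altOp_eq_det _ _ _ _ _ (fun i => ∏ j, (1 - PowerSeries.X * PowerSeries.C (X (ex i)) *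
    PowerSeries.C (X (ey j)))) _ (map_shift_kernel h ex ey hxy)

theorem coeff_altOp {R : Type*} [CommRing R] (x : Fin N → R) (T : Finset (Fin N) → R →+* R)
    (t Y : R) (f : PowerSeries R) (n : ℕ) :
    PowerSeries.coeff n (altOp (fun i => PowerSeries.C (x i)) (fun I => PowerSeries.map (T I))
      (PowerSeries.C t) (PowerSeries.C Y) f) = altOp x T t Y (PowerSeries.coeff n f) := by
  simp only [altOp, map_sum, Units.smul_def, map_zsmul, ← map_pow, ← map_prod, ← map_mul,
    PowerSeries.coeff_C_mul, PowerSeries.coeff_map]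

/-- The operator has the same effect on the Cauchy kernel in both alphabets. -/
theorem altOp_kernel_symm [CharZero F] [DecidableEq σ] (h : IsGenericPair q τ) (Y : F) (ex ey : Fin N ↪ σ)
    (hxy : ∀ i j, ex i ≠ ey j) (n : ℕ) :
    altOp (fun i => (X (ex i) : MvPolynomial σ F))
        (fun I => (shift q (I.map ex) : MvPolynomial σ F →+* MvPolynomial σ F)) (C τ) (C Y)
        (expCoeff F (kernelSeq q τ ex ey) n) *
      Matrix.det (Matrix.of fun k i : Fin N => (X (ey i) : MvPolynomial σ F) ^ (k : ℕ)) =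
    altOp (fun i => (X (ey i) : MvPolynomial σ F))
        (fun I => (shift q (I.map ey) : MvPolynomial σ F →+* MvPolynomial σ F)) (C τ) (C Y)
        (expCoeff F (kernelSeq q τ ex ey) n) *
      Matrix.det (Matrix.of fun k i : Fin N => (X (ex i) : MvPolynomial σ F) ^ (k : ℕ)) := by
  have h1 := altOp_kernel h Y ex ey hxy
  have h2 := altOp_kernel h Y ey ex fun i j => (hxy j i).symm
  have hu : ∀ i j, IsUnit (1 - PowerSeries.X * PowerSeries.C (X (ex i) : MvPolynomial σ F) *
      PowerSeries.C (X (ey j))) := by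
    intro i j
    rw [PowerSeries.isUnit_iff_constantCoeff]
    simp
  have hu' : ∀ i j, IsUnit (1 - PowerSeries.C (C τ) * (PowerSeries.X *
      PowerSeries.C (X (ex i) : MvPolynomial σ F) * PowerSeries.C (X (ey j)))) := by
    intro i j
    rw [PowerSeries.isUnit_iff_constantCoeff]
    simp
  have h3 := kernelDet_symm PowerSeries.X (PowerSeries.C (C τ)) (PowerSeries.C (C Y))
    (fun i => PowerSeries.C (X (ex i) : MvPolynomial σ F)) (fun j => PowerSeries.C (X (ey j)))
    hu hu' PowerSeries.X_ne_zero
    (fun i h => X_ne_zero (R := F) (ex i) (PowerSeries.C_injective (by rw [h, map_zero])))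
    (PowerSeries.C_injective.comp (X_injective.comp ex.injective))
  have h4 : (∏ i, ∏ j, (1 - PowerSeries.C (C τ : MvPolynomial σ F) * (PowerSeries.X *
      PowerSeries.C (X (ey i)) * PowerSeries.C (X (ex j))))) =
      ∏ i, ∏ j, (1 - PowerSeries.C (C τ) * (PowerSeries.X * PowerSeries.C (X (ex i)) *
        PowerSeries.C (X (ey j)))) := by
    rw [Finset.prod_comm]
    refine Finset.prod_congr rfl fun j _ => Finset.prod_congr rfl fun i _ => ?_
    ring
  have h5 : (∏ i, ∏ j, (1 - PowerSeries.C (C τ : MvPolynomial σ F) * (PowerSeries.X *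
      PowerSeries.C (X (ex i)) * PowerSeries.C (X (ey j))))) ≠ 0 := by
    rw [Finset.prod_ne_zero_iff]
    intro i _
    rw [Finset.prod_ne_zero_iff]
    exact fun j _ => (hu' i j).ne_zero
  rw [h4, kernelSeq_comm ey ex] at h2
  have hdet : ∀ e : Fin N ↪ σ, Matrix.det (Matrix.of fun k i : Fin N =>
      PowerSeries.C (X (e i) : MvPolynomial σ F) ^ (k : ℕ)) =
      PowerSeries.C (Matrix.det (Matrix.of fun k i : Fin N =>
        (X (e i) : MvPolynomial σ F) ^ (k : ℕ))) := by
    intro e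
    rw [RingHom.map_det]
    congr 1
    ext k i : 2
    simp
  have h6 := mul_left_cancel₀ h5 (b := altOp (fun i => PowerSeries.C (X (ex i) : MvPolynomial σ F))
        (fun I => PowerSeries.map (shift q (I.map ex) : MvPolynomial σ F →+* MvPolynomial σ F))
        (PowerSeries.C (C τ)) (PowerSeries.C (C Y)) (expSeries F (kernelSeq q τ ex ey)) *
        PowerSeries.C (Matrix.det (Matrix.of fun k i : Fin N =>
        (X (ey i) : MvPolynomial σ F) ^ (k : ℕ))))
      (c := altOp (fun i => PowerSeries.C (X (ey i) : MvPolynomial σ F))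
        (fun I => PowerSeries.map (shift q (I.map ey) : MvPolynomial σ F →+* MvPolynomial σ F))
        (PowerSeries.C (C τ)) (PowerSeries.C (C Y)) (expSeries F (kernelSeq q τ ex ey)) *
        PowerSeries.C (Matrix.det (Matrix.of fun k i : Fin N =>
        (X (ex i) : MvPolynomial σ F) ^ (k : ℕ)))) (by
      rw [← mul_assoc, ← mul_assoc, h1, h2, ← hdet, ← hdet]
      linear_combination expSeries F (kernelSeq q τ ex ey) * h3)
  have h7 := congrArg (PowerSeries.coeff n) h6
  rw [PowerSeries.coeff_mul_C, PowerSeries.coeff_mul_C, coeff_altOp, coeff_altOp, expSeries,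
    PowerSeries.coeff_mk] at h7
  exact h7

end

/-! ### The Macdonald pairing -/

section

variable {σ F : Type*} [Field F]

/-- The square length of the monomial with exponent `d`. -/
def sqLength (ω : σ → F) (d : σ →₀ ℕ) : F := d.prod fun s e => ω s ^ e * (e.factorial : F)

theorem sqLength_ne_zero [CharZero F] {ω : σ → F} (hω : ∀ s, ω s ≠ 0) (d : σ →₀ ℕ) :
    sqLength ω d ≠ 0 :=
  Finset.prod_ne_zero_iff.mpr fun s _ =>
    mul_ne_zero (pow_ne_zero _ (hω s)) (Nat.cast_ne_zero.mpr (Nat.factorial_ne_zero _))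

theorem pairing_eq_sum (ω : σ → F) {f : MvPolynomial σ F} (g : MvPolynomial σ F)
    {s : Finset (σ →₀ ℕ)} (hs : f.support ⊆ s) :
    pairing ω f g = ∑ d ∈ s, coeff d f * coeff d g * sqLength ω d := by
  rw [pairing]
  refine Finset.sum_subset hs fun d _ hd => ?_
  rw [notMem_support_iff.mp hd]
  simp

theorem pairing_comm (ω : σ → F) (f g : MvPolynomial σ F) : pairing ω f g = pairing ω g f := by
  classical
  rw [pairing_eq_sum ω g (Finset.subset_union_left (s₂ := g.support)),
    pairing_eq_sum ω f (Finset.subset_union_right (s₁ := f.support))]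
  exact Finset.sum_congr rfl fun d _ => by rw [mul_comm (coeff d f)]

/-- The pairing as a bilinear map. -/
def pairingLin (ω : σ → F) : MvPolynomial σ F →ₗ[F] MvPolynomial σ F →ₗ[F] F :=
  LinearMap.mk₂ F (pairing ω)
    (fun f f' g => by
      classical
      have hs : (f + f').support ⊆ f.support ∪ f'.support := support_add
      rw [pairing_eq_sum ω g hs,
        pairing_eq_sum ω g (Finset.subset_union_left (s₂ := f'.support)),
        pairing_eq_sum ω g (Finset.subset_union_right (s₁ := f.support)),
        ← Finset.sum_add_distrib]
      exact Finset.sum_congr rfl fun d _ => by rw [coeff_add]; ring)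
    (fun c f g => by
      have hs : (c • f).support ⊆ f.support := support_smul
      rw [pairing_eq_sum ω g hs, pairing_eq_sum ω g subset_rfl, smul_eq_mul, Finset.mul_sum]
      exact Finset.sum_congr rfl fun d _ => by rw [coeff_smul, smul_eq_mul]; ring)
    (fun f g g' => by
      rw [pairing, pairing, pairing, ← Finset.sum_add_distrib]
      exact Finset.sum_congr rfl fun d _ => by rw [coeff_add]; ring)
    (fun c f g => by
      rw [pairing, pairing, smul_eq_mul, Finset.mul_sum]
      exact Finset.sum_congr rfl fun d _ => by rw [coeff_smul, smul_eq_mul]; ring)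

theorem pairingLin_apply (ω : σ → F) (f g : MvPolynomial σ F) :
    pairingLin ω f g = pairing ω f g := rfl

theorem pairingLin_comm (ω : σ → F) (f g : MvPolynomial σ F) :
    pairingLin ω f g = pairingLin ω g f := pairing_comm ω f g

theorem pairingLin_monomial (ω : σ → F) (f : MvPolynomial σ F) (d : σ →₀ ℕ) :
    pairingLin ω f (monomial d 1) = coeff d f * sqLength ω d := by
  classical
  rw [pairingLin_comm, pairingLin_apply, pairing_eq_sum ω f support_monomial_subset]
  simp

end

/-! ### The Cauchy kernel in power sums and self-adjointness -/

section

variable {F : Type*} [Field F] {q τ : F} {N : ℕ}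

/-- The square lengths of the power sums for the Macdonald pairing. -/
def qtWeight (q τ : F) (r : ℕ+) : F := ((r : ℕ) : F) * ((1 - q ^ (r : ℕ)) / (1 - τ ^ (r : ℕ)))

/-- The Macdonald pairing as a bilinear map. -/
def qtForm (q τ : F) : Sym F →ₗ[F] Sym F →ₗ[F] F := pairingLin (qtWeight q τ)

theorem qtForm_comm (f g : Sym F) : qtForm q τ f g = qtForm q τ g f := pairingLin_comm _ f g

theorem polyOp_smul (Y c : F) (f : MvPolynomial (Fin N) F) :
    polyOp q τ Y (c • f) = c • polyOp q τ Y f := by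
  rw [smul_eq_C_mul, polyOp_C_mul, smul_eq_C_mul]

theorem rename_polyOp_embedding (Y : F) (f : MvPolynomial (Fin N) F) (e : Fin N ↪ Fin N ⊕ Fin N) :
    rename e (polyOp q τ Y f) = altOp (fun i => (X (e i) : MvPolynomial (Fin N ⊕ Fin N) F))
        (fun I => (shift q (I.map e) :
          MvPolynomial (Fin N ⊕ Fin N) F →+* MvPolynomial (Fin N ⊕ Fin N) F))
        (C τ) (C Y) (rename e f) := by
  have h := map_altOp (rename e : MvPolynomial (Fin N) F →ₐ[F] _).toRingHom X
    (fun I => (shift q I : MvPolynomial (Fin N) F →+* MvPolynomial (Fin N) F))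
    (fun I => (shift q (I.map e) :
          MvPolynomial (Fin N ⊕ Fin N) F →+* MvPolynomial (Fin N ⊕ Fin N) F)) (C τ) (C Y) f ?_
  · simpa [polyOp] using h
  · intro I
    have h : (rename e).comp (shift q I) = (shift q (I.map e)).comp (rename (R := F) e) := by
      ext1 i
      simp only [AlgHom.comp_apply, shift_X, rename_X, Finset.mem_map']
      split_ifs <;> simp
    exact DFunLike.congr_fun h f

theorem shift_map_rename (e e' : Fin N ↪ Fin N ⊕ Fin N) (hne : ∀ i j, e i ≠ e' j)
    (I : Finset (Fin N)) (g : MvPolynomial (Fin N) F) :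
    shift q (I.map e) (rename e' g) = rename e' g := by
  have h3 : (shift q (I.map e)).comp (rename (R := F) e') = rename e' := by
    ext1 j
    rw [AlgHom.comp_apply, rename_X, shift_X, if_neg]
    rw [Finset.mem_map]
    rintro ⟨i, -, hi⟩
    exact hne i j hi
  exact DFunLike.congr_fun h3 g

theorem altOp_C_mul_rename (e e' : Fin N ↪ Fin N ⊕ Fin N) (hne : ∀ i j, e i ≠ e' j) (Y c : F)
    (f g : MvPolynomial (Fin N) F) :
    altOp (fun i => (X (e i) : MvPolynomial (Fin N ⊕ Fin N) F))
        (fun I => (shift q (I.map e) :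
          MvPolynomial (Fin N ⊕ Fin N) F →+* MvPolynomial (Fin N ⊕ Fin N) F))
        (C τ) (C Y) (C c * (rename e f * rename e' g)) =
      C c * (rename e (polyOp q τ Y f) * rename e' g) := by
  have h5 := altOp_mul_of_invariant
      (fun i => (X (e i) : MvPolynomial (Fin N ⊕ Fin N) F))
      (fun I => (shift q (I.map e) :
          MvPolynomial (Fin N ⊕ Fin N) F →+* MvPolynomial (Fin N ⊕ Fin N) F))
      (C τ) (C Y) (rename e f) (C c * rename e' g) (by
        intro I
        rw [map_mul]
        congr 1
        · exact algHom_C (shift q (I.map e)) c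
        · exact shift_map_rename e e' hne I g)
  rw [← rename_polyOp_embedding] at h5
  rw [show C c * (rename e f * rename e' g) = rename e f * (C c * rename e' g) by ring, h5]
  ring

variable [CharZero F]

theorem qtWeight_ne_zero (h : IsGenericPair q τ) (r : ℕ+) : qtWeight q τ r ≠ 0 :=
  mul_ne_zero (Nat.cast_ne_zero.mpr r.ne_zero)
    (div_ne_zero (h.one_sub_left_ne_zero r.pos) (h.one_sub_right_ne_zero r.pos))

/-- The exponents of weight `n`. -/
def weightExps (F : Type*) [Field F] (n : ℕ) : Finset (ℕ+ →₀ ℕ) :=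
  (expCoeff F (fun r => C (r : F) * (X r.toPNat' : Sym F)) n).support

theorem mem_weightExps {n : ℕ} {d : ℕ+ →₀ ℕ} :
    d ∈ weightExps F n ↔ Finsupp.weight (fun r : ℕ+ => (r : ℕ)) d = n := by
  rw [weightExps, mem_support_iff, coeff_expCoeff_X]
  have : (d.prod fun _ e => (e.factorial : F))⁻¹ ≠ 0 :=
    inv_ne_zero (Finset.prod_ne_zero_iff.mpr fun s _ =>
      Nat.cast_ne_zero.mpr (Nat.factorial_ne_zero _))
  simp [this]

theorem support_subset_weightExps {n : ℕ} {f : Sym F} (hf : f ∈ homSym F n) :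
    f.support ⊆ weightExps F n := fun _ hd => mem_weightExps.mpr (hf (mem_support_iff.mp hd))

theorem monomial_mem_homSym {n : ℕ} {d : ℕ+ →₀ ℕ} (hd : d ∈ weightExps F n) :
    (monomial d 1 : Sym F) ∈ homSym F n :=
  isWeightedHomogeneous_monomial _ _ _ (mem_weightExps.mp hd)

theorem eq_sum_weightExps {n : ℕ} {f : Sym F} (hf : f ∈ homSym F n) :
    f = ∑ d ∈ weightExps F n, coeff d f • (monomial d 1 : Sym F) := by
  conv_lhs => rw [f.as_sum]
  rw [← Finset.sum_subset (support_subset_weightExps hf)]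
  · exact Finset.sum_congr rfl fun d _ => by rw [smul_monomial, smul_eq_mul, mul_one]
  · intro d _ hd
    rw [notMem_support_iff.mp hd, zero_smul]

/-- The Cauchy kernel in terms of power sums. -/
theorem expCoeff_kernelSeq (h : IsGenericPair q τ) (n : ℕ) :
    expCoeff F (kernelSeq q τ (Sum.inl : Fin N → Fin N ⊕ Fin N) Sum.inr) n =
      ∑ d ∈ weightExps F n, C (sqLength (qtWeight q τ) d)⁻¹ *
        (rename Sum.inl (toPoly F N (monomial d 1)) *
          rename Sum.inr (toPoly F N (monomial d 1))) := by
  -- The kernel is the generic exponential `exp (∑ X_r uʳ)` at `X_r = p_r(x) p_r(y) / ⟨p_r, p_r⟩`;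
  -- the factorials in its coefficients complete the square lengths.
  let v : ℕ+ → MvPolynomial (Fin N ⊕ Fin N) F := fun r =>
    C (qtWeight q τ r)⁻¹ * (rename Sum.inl (psum (Fin N) F r) * rename Sum.inr (psum (Fin N) F r))
  have h1 := map_expCoeff F (aeval v) (fun r => C (r : F) * (X r.toPNat' : Sym F)) n
  have h2 : (fun r : ℕ => aeval v (C (r : F) * (X r.toPNat' : Sym F))) =
      kernelSeq q τ (Sum.inl : Fin N → Fin N ⊕ Fin N) Sum.inr := by
    funext r
    rw [map_mul, algHom_C, aeval_X, kernelSeq, algebraMap_eq]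
    rcases r.eq_zero_or_pos with rfl | hr
    · simp
    · simp only [v, psum, map_sum, map_pow, rename_X, PNat.toPNat'_coe hr]
      rw [← mul_assoc, ← C_mul]
      congr 2
      have hr' : (r : F) ≠ 0 := Nat.cast_ne_zero.mpr hr.ne'
      have h3 := h.one_sub_left_ne_zero hr
      have h4 := h.one_sub_right_ne_zero hr
      rw [qtWeight, PNat.toPNat'_coe hr]
      field_simp
  rw [h2] at h1
  rw [← h1, aeval_def, eval₂_eq]
  refine Finset.sum_congr rfl fun d hd => ?_
  rw [coeff_expCoeff_X, if_pos (mem_weightExps.mp hd)]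
  have h5 : ∀ g : Sym F →ₐ[F] MvPolynomial (Fin N ⊕ Fin N) F,
      g (monomial d 1) = d.prod fun s e => g (X s) ^ e := by
    intro g
    rw [monomial_eq, C_1, one_mul, Finsupp.prod, map_prod, Finsupp.prod]
    simp
  have h6 := h5 ((rename Sum.inl).comp (toPoly F N))
  have h7 := h5 ((rename Sum.inr).comp (toPoly F N))
  rw [AlgHom.comp_apply] at h6 h7
  rw [h6, h7, sqLength]
  simp only [AlgHom.comp_apply, toPoly_X, v, Finsupp.prod, mul_pow, Finset.prod_mul_distrib,
    mul_inv, C_mul, ← C_pow, algebraMap_eq, ← map_prod C, inv_pow, Finset.prod_inv_distrib]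
  ring

theorem exists_toPoly_quotient (n : ℕ) (Y : F) {f : Sym F} (hf : f ∈ homSym F n) :
    ∃ g ∈ homSym F n, polyOp q τ Y (toPoly F N f) = vdm N F * toPoly F N g := by
  obtain ⟨g, hs, hh, hg⟩ := exists_symmetric_quotient q τ Y (isSymmetric_toPoly N f)
    (isHomogeneous_toPoly hf)
  refine ⟨_, ?_, hg.trans (congrArg _ (eq_toPoly_sum_monomialSym hs hh))⟩
  exact Submodule.sum_mem _ fun nu _ => Submodule.smul_mem _ _ (monomialSym_mem_homSym nu)

/-- The kernel identity in terms of power sums, with values in polynomials in two alphabets. -/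
theorem sum_kernel_symm (h : IsGenericPair q τ) (n : ℕ) (Y : F) :
    ∑ d ∈ weightExps F n, C (sqLength (qtWeight q τ) d)⁻¹ *
        (rename Sum.inl (polyOp q τ Y (toPoly F N (monomial d 1))) *
          rename (Sum.inr : Fin N → Fin N ⊕ Fin N) (vdm N F * toPoly F N (monomial d 1))) =
      ∑ d ∈ weightExps F n, C (sqLength (qtWeight q τ) d)⁻¹ *
        (rename Sum.inl (vdm N F * toPoly F N (monomial d 1)) *
          rename Sum.inr (polyOp q τ Y (toPoly F N (monomial d 1)))) := by
  have h1 := altOp_kernel_symm h Y (Function.Embedding.inl : Fin N ↪ Fin N ⊕ Fin N)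
    Function.Embedding.inr (fun i j => Sum.inl_ne_inr) n
  have h2 : expCoeff F (kernelSeq q τ (Function.Embedding.inl : Fin N ↪ Fin N ⊕ Fin N)
    Function.Embedding.inr) n = _ := expCoeff_kernelSeq h n
  rw [h2, altOp_sum, altOp_sum, Finset.sum_mul, Finset.sum_mul] at h1
  have hv : ∀ e : Fin N ↪ Fin N ⊕ Fin N, rename e (vdm N F) =
      Matrix.det (Matrix.of fun k i : Fin N =>
        (X (e i) : MvPolynomial (Fin N ⊕ Fin N) F) ^ (k : ℕ)) := by
    intro e
    rw [vdm_eq, AlgHom.map_det]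
    congr 1
    ext k i : 2
    simp
  have e1 : ⇑(Function.Embedding.inl : Fin N ↪ Fin N ⊕ Fin N) = Sum.inl := rfl
  have e2 : ⇑(Function.Embedding.inr : Fin N ↪ Fin N ⊕ Fin N) = Sum.inr := rfl
  refine Eq.trans (Finset.sum_congr rfl fun d _ => ?_)
    (h1.trans (Finset.sum_congr rfl fun d _ => ?_))
  · rw [← hv, ← e1, ← e2, altOp_C_mul_rename _ _ (fun i j => Sum.inl_ne_inr), map_mul]
    ring
  · rw [← hv, ← e1, ← e2, mul_comm (rename _ _) (rename _ _),
      altOp_C_mul_rename _ _ (fun i j => Sum.inr_ne_inl), map_mul]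
    ring

end

section

variable {F : Type*} [Field F] {q τ : F} {N : ℕ}

variable [CharZero F]

theorem toPoly_injOn' {n : ℕ} (hN : n ≤ N) {f g : Sym F} (hf : f ∈ homSym F n)
    (hg : g ∈ homSym F n) (h : toPoly F N f = toPoly F N g) : f = g :=
  sub_eq_zero.mp (toPoly_injOn hN (Submodule.sub_mem _ hf hg) (by rw [map_sub, h, sub_self]))

/-- The matrix of the operator in the basis of power sums is symmetric up to square lengths. -/
theorem polyOp_adjoint_monomial (h : IsGenericPair q τ) {n : ℕ} (hN : n ≤ N) (Y : F)
    {p : (ℕ+ →₀ ℕ) → Sym F} (hp : ∀ d ∈ weightExps F n, p d ∈ homSym F n)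
    (hD : ∀ d ∈ weightExps F n,
      polyOp q τ Y (toPoly F N (monomial d 1)) = vdm N F * toPoly F N (p d))
    {d e : ℕ+ →₀ ℕ} (hd : d ∈ weightExps F n) (he : e ∈ weightExps F n) :
    qtForm q τ (p d) (monomial e 1) = qtForm q τ (monomial d 1) (p e) := by
  classical
  set w := sqLength (qtWeight q τ) with hw
  have hw0 : ∀ d, w d ≠ 0 := fun d => sqLength_ne_zero (qtWeight_ne_zero h) d
  have h1 := sum_kernel_symm (N := N) h n Y
  have h2 : ∑ d ∈ weightExps F n, C (w d)⁻¹ *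
        (rename Sum.inl (toPoly F N (p d)) *
          rename (Sum.inr : Fin N → Fin N ⊕ Fin N) (toPoly F N (monomial d 1))) =
      ∑ d ∈ weightExps F n, C (w d)⁻¹ *
        (rename Sum.inl (toPoly F N (monomial d 1)) * rename Sum.inr (toPoly F N (p d))) := by
    have hv : rename (Sum.inl : Fin N → Fin N ⊕ Fin N) (vdm N F) *
        rename (Sum.inr : Fin N → Fin N ⊕ Fin N) (vdm N F) ≠ 0 := by
      refine mul_ne_zero ?_ ?_
      · exact (map_ne_zero_iff _ (rename_injective _ Sum.inl_injective)).mpr vdm_ne_zero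
      · exact (map_ne_zero_iff _ (rename_injective _ Sum.inr_injective)).mpr vdm_ne_zero
    apply mul_left_cancel₀ hv
    rw [Finset.mul_sum, Finset.mul_sum]
    refine Eq.trans (Finset.sum_congr rfl fun d hd => ?_)
      (h1.trans (Finset.sum_congr rfl fun d hd => ?_))
    · rw [hD d hd, map_mul, map_mul]; ring
    · rw [hD d hd, map_mul, map_mul]; ring
  -- Specializing the second alphabet to a point `b` gives an identity in one alphabet. It lifts to
  -- `Sym F` because `n ≤ N`, so coefficients of power-sum monomials can be compared there.
  have h3 : ∀ b : Fin N → F, ∀ e, ∑ d ∈ weightExps F n,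
      (w d)⁻¹ * eval b (toPoly F N (monomial d 1)) * coeff e (p d) =
      ∑ d ∈ weightExps F n, (w d)⁻¹ * eval b (toPoly F N (p d)) *
        coeff e (monomial d (1 : F)) := by
    intro b e
    let ψ : MvPolynomial (Fin N ⊕ Fin N) F →ₐ[F] MvPolynomial (Fin N) F :=
      aeval (Sum.elim X fun i => C (b i))
    have hl : ∀ f : MvPolynomial (Fin N) F, ψ (rename Sum.inl f) = f := by
      intro f
      simp only [ψ, aeval_rename, Sum.elim_comp_inl]
      exact aeval_X_left_apply f
    have hr : ∀ f : MvPolynomial (Fin N) F, ψ (rename Sum.inr f) = C (eval b f) := by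
      intro f
      simp only [ψ, aeval_rename, Sum.elim_comp_inr]
      have : aeval (fun i => (C (b i) : MvPolynomial (Fin N) F)) =
          (Algebra.ofId F (MvPolynomial (Fin N) F)).comp (aeval b) := by
        ext1 i
        simp [Algebra.ofId_apply]
      rw [this]
      simp [Algebra.ofId_apply]
    have h4 := congrArg ψ h2
    simp only [map_sum, map_mul, hl, hr] at h4
    have hC : ∀ c, ψ (C c) = C c := fun c => algHom_C ψ c
    simp only [hC] at h4
    have h5 : ∑ d ∈ weightExps F n, ((w d)⁻¹ * eval b (toPoly F N (monomial d 1))) • p d =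
        ∑ d ∈ weightExps F n, ((w d)⁻¹ * eval b (toPoly F N (p d))) •
          (monomial d 1 : Sym F) := by
      refine toPoly_injOn' hN (Submodule.sum_mem _ fun d hd => Submodule.smul_mem _ _ (hp d hd))
        (Submodule.sum_mem _ fun d hd => Submodule.smul_mem _ _ (monomial_mem_homSym hd)) ?_
      rw [map_sum, map_sum]
      refine Eq.trans (Finset.sum_congr rfl fun d hd => ?_)
        (h4.trans (Finset.sum_congr rfl fun d hd => ?_))
      · rw [map_smul, smul_eq_C_mul, C_mul]; ring
      · rw [map_smul, smul_eq_C_mul, C_mul]; ring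
    have h6 := congrArg (coeff e) h5
    simpa only [coeff_sum, coeff_smul, smul_eq_mul] using h6
  -- Letting `b` vary recovers the identity in the second alphabet, since a polynomial over the
  -- infinite field `F` is determined by its values.
  have h7 : ∑ d ∈ weightExps F n, ((w d)⁻¹ * coeff e (p d)) • (monomial d 1 : Sym F) =
      (w e)⁻¹ • p e := by
    refine toPoly_injOn' hN
      (Submodule.sum_mem _ fun d hd => Submodule.smul_mem _ _ (monomial_mem_homSym hd))
      (Submodule.smul_mem _ _ (hp e he)) (MvPolynomial.funext fun b => ?_)
    have h8 := h3 b e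
    simp only [coeff_monomial, mul_ite, mul_one, mul_zero, Finset.sum_ite_eq', he, if_true] at h8
    rw [map_sum, map_sum, map_smul, smul_eval, ← h8]
    refine Finset.sum_congr rfl fun d _ => ?_
    rw [map_smul, smul_eval]
    ring
  have h9 := congrArg (coeff d) h7
  simp only [coeff_sum, coeff_smul, smul_eq_mul, coeff_monomial, mul_ite, mul_one, mul_zero,
    Finset.sum_ite_eq', hd, if_true] at h9
  rw [qtForm_comm (monomial d 1), qtForm, pairingLin_monomial, pairingLin_monomial, ← hw]
  have hdw := hw0 d
  have hew := hw0 e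
  field_simp at h9
  linear_combination h9

/-- The operators are self-adjoint for the Macdonald pairing. -/
theorem polyOp_adjoint (h : IsGenericPair q τ) {n : ℕ} (hN : n ≤ N) (Y : F) {f f' g g' : Sym F}
    (hf : f ∈ homSym F n) (hf' : f' ∈ homSym F n) (hg : g ∈ homSym F n) (hg' : g' ∈ homSym F n)
    (hDf : polyOp q τ Y (toPoly F N f) = vdm N F * toPoly F N f')
    (hDg : polyOp q τ Y (toPoly F N g) = vdm N F * toPoly F N g') :
    qtForm q τ f' g = qtForm q τ f g' := by
  have hex : ∀ d : ℕ+ →₀ ℕ, ∃ p : Sym F, d ∈ weightExps F n → p ∈ homSym F n ∧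
      polyOp q τ Y (toPoly F N (monomial d 1)) = vdm N F * toPoly F N p := by
    intro d
    by_cases hd : d ∈ weightExps F n
    · obtain ⟨p, hp⟩ := exists_toPoly_quotient (q := q) (τ := τ) (N := N) n Y
        (monomial_mem_homSym hd)
      exact ⟨p, fun _ => hp⟩
    · exact ⟨0, fun h => absurd h hd⟩
  choose p hp using hex
  -- The quotient by `vdm` is unique and depends linearly on the function, so the claim reduces to
  -- power-sum monomials.
  have key : ∀ {k k' : Sym F}, k ∈ homSym F n → k' ∈ homSym F n →
      polyOp q τ Y (toPoly F N k) = vdm N F * toPoly F N k' →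
      k' = ∑ d ∈ weightExps F n, coeff d k • p d := by
    intro k k' hk hk' hD
    refine toPoly_injOn' hN hk'
      (Submodule.sum_mem _ fun d hd => Submodule.smul_mem _ _ (hp d hd).1) ?_
    apply mul_left_cancel₀ (vdm_ne_zero (N := N) (F := F))
    rw [← hD]
    conv_lhs => rw [eq_sum_weightExps hk]
    rw [map_sum, map_sum, polyOp_sum, Finset.mul_sum]
    refine Finset.sum_congr rfl fun d hd => ?_
    rw [map_smul, polyOp_smul, (hp d hd).2, map_smul, mul_smul_comm]
  rw [key hf hf' hDf, key hg hg' hDg]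
  conv_lhs => rw [eq_sum_weightExps hg]
  conv_rhs => rw [eq_sum_weightExps hf]
  simp only [map_sum, map_smul, LinearMap.sum_apply, LinearMap.smul_apply, smul_eq_mul,
    Finset.mul_sum]
  refine Finset.sum_congr rfl fun d hd => Finset.sum_congr rfl fun e he => ?_
  rw [polyOp_adjoint_monomial h hN Y (fun d hd => (hp d hd).1) (fun d hd => (hp d hd).2) he hd]
  

end

/-! ### Triangularity -/

section

variable {F : Type*} [Field F] {q τ : F} {N : ℕ}

/-- If an entry were smaller than a later one, swapping them would give a larger exponent with the
same nonzero coefficient. -/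
theorem antitone_of_leading {f : MvPolynomial (Fin N) F} (hf : f.IsSymmetric) {ν : Fin N →₀ ℕ}
    (hν : coeff ν f ≠ 0) (hmax : ∀ α, toLex ν < toLex α → coeff α f = 0) : Antitone ν := by
  intro i j hij
  by_contra! hlt
  refine hν ?_
  rw [← coeff_mapDomain_of_isSymmetric hf (Equiv.swap i j)]
  refine hmax _ ?_
  have hne : i ≠ j := by rintro rfl; exact lt_irrefl _ hlt
  have hsw : ∀ k, (ν.mapDomain (Equiv.swap i j)) k = ν (Equiv.swap i j k) := by
    intro k
    rw [← Finsupp.equivMapDomain_eq_mapDomain, Finsupp.equivMapDomain_apply, Equiv.symm_swap]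
  rw [Finsupp.Lex.lt_iff]
  refine ⟨i, fun k hk => ?_, ?_⟩
  · change ν k = (ν.mapDomain (Equiv.swap i j)) k
    rw [hsw, Equiv.swap_apply_of_ne_of_ne hk.ne (hk.trans_le hij).ne]
  · change ν i < (ν.mapDomain (Equiv.swap i j)) i
    rw [hsw, Equiv.swap_apply_left]
    exact hlt

variable [CharZero F] {n : ℕ}

theorem exists_leading_partition {f : Sym F} (hf : f ∈ homSym F n) (h0 : toPoly F N f ≠ 0) :
    ∃ nu : n.Partition, (rows nu).length ≤ N ∧ coeff (expo N nu) (toPoly F N f) ≠ 0 ∧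
      ∀ α, toLex (expo N nu) < toLex α → coeff α (toPoly F N f) = 0 := by
  obtain ⟨ν, hν, hmax⟩ := exists_leading h0
  have h1 : ∑ i, ν i = n := by
    have := isHomogeneous_toPoly hf hν
    rw [← this, weight_one_eq]
  obtain ⟨nu, hl, rfl⟩ := exists_expo_eq (antitone_of_leading (isSymmetric_toPoly N f) hν hmax) h1
  exact ⟨nu, hl, hν, hmax⟩

theorem lexLT_of_toLex_expo_lt {mu lam : n.Partition} (hN : (rows mu).length ≤ N)
    (h : toLex (expo N mu) < toLex (expo N lam)) : lexLT n mu lam := by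
  rcases lexLT_trichotomous mu lam with h' | rfl | h'
  · exact h'
  · exact absurd h (lt_irrefl _)
  · exact absurd h (toLex_expo_lt hN h').asymm

/-- If no `m_ν` with `ν` above `λ` occurs, no exponent above `λ` occurs. -/
theorem coeff_eq_zero_of_lexLT {f : Sym F} (hf : f ∈ homSym F n) {lam : n.Partition}
    (hlam : (rows lam).length ≤ N)
    (h : ∀ nu, (rows nu).length ≤ N → lexLT n lam nu → coeff (expo N nu) (toPoly F N f) = 0)
    {α : Fin N →₀ ℕ} (hα : toLex (expo N lam) < toLex α) : coeff α (toPoly F N f) = 0 := by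
  by_cases h0 : toPoly F N f = 0
  · rw [h0, coeff_zero]
  obtain ⟨ka, hl, hka, hmax⟩ := exists_leading_partition hf h0
  refine hmax α (lt_of_le_of_lt ?_ hα)
  by_contra! hlt
  exact hka (h ka hl (lexLT_of_toLex_expo_lt hlam hlt))

/-- The eigenvalues. -/
def eigenvalue (q τ : F) (N : ℕ) (lam : n.Partition) (Y : F) : F :=
  ∏ i : Fin N, (1 + Y * τ ^ (Fin.rev i : ℕ) * q ^ (rows lam).getD i 0)

/-- The operators are triangular. -/
theorem polyOp_triangular {Y : F} {f g : Sym F} (hf : f ∈ homSym F n) (hg : g ∈ homSym F n)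
    (hD : polyOp q τ Y (toPoly F N f) = vdm N F * toPoly F N g) {lam : n.Partition}
    (hlam : (rows lam).length ≤ N)
    (h : ∀ nu, (rows nu).length ≤ N → lexLT n lam nu → coeff (expo N nu) (toPoly F N f) = 0) :
    (∀ nu, (rows nu).length ≤ N → lexLT n lam nu → coeff (expo N nu) (toPoly F N g) = 0) ∧
      coeff (expo N lam) (toPoly F N g) =
        eigenvalue q τ N lam Y * coeff (expo N lam) (toPoly F N f) := by
  -- Compare leading coefficients of the two sides of `hD`. A leading partition of `g` above `λ`
  -- would have coefficient a multiple of that of `f`, namely `0`; so there is none.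
  have key : ∀ nu : n.Partition, (rows nu).length ≤ N → (nu = lam ∨ lexLT n lam nu) →
      (∀ α, toLex (expo N nu) < toLex α → coeff α (toPoly F N g) = 0) →
      coeff (expo N nu) (toPoly F N g) =
        eigenvalue q τ N nu Y * coeff (expo N nu) (toPoly F N f) := by
    intro nu hnu hle hmax
    have h1 := congrArg (coeff (expo N nu + permExpo Fin.revPerm)) hD
    rw [← polyOp_zero q τ, coeff_polyOp_add _ _ _ hmax, coeff_polyOp_add] at h1
    · have h2 := sign_smul_inj _ h1
      simp only [zero_mul, add_zero, Finset.prod_const_one, one_mul] at h2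
      exact h2.symm
    · intro α hα
      refine coeff_eq_zero_of_lexLT hf hlam h ?_
      rcases hle with rfl | hle
      · exact hα
      · exact (toLex_expo_lt hnu hle).trans hα
  have h1 : ∀ nu, (rows nu).length ≤ N → lexLT n lam nu →
      coeff (expo N nu) (toPoly F N g) = 0 := by
    intro nu hnu hlt
    by_contra hne
    have h0 : toPoly F N g ≠ 0 := by
      intro h0
      rw [h0, coeff_zero] at hne
      exact hne rfl
    obtain ⟨ka, hl, hka, hmax⟩ := exists_leading_partition hg h0
    have hle : toLex (expo N nu) ≤ toLex (expo N ka) := by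
      by_contra! h3
      exact hne (hmax _ h3)
    have h4 : lexLT n lam ka :=
      lexLT_of_toLex_expo_lt hlam ((toLex_expo_lt hnu hlt).trans_le hle)
    refine hka ?_
    rw [key ka hl (Or.inr h4) hmax, h ka hl h4, mul_zero]
  exact ⟨h1, key lam hlam (Or.inl rfl) fun α hα => coeff_eq_zero_of_lexLT hg hlam h1 hα⟩

theorem eq_sum_monomialSym (hN : n ≤ N) {f : Sym F} (hf : f ∈ homSym F n) :
    f = ∑ nu : n.Partition, coeff (expo N nu) (toPoly F N f) • monomialSym nu := by
  obtain ⟨c, rfl⟩ := exists_eq_sum_monomialSym hf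
  refine Finset.sum_congr rfl fun nu _ => ?_
  rw [coeff_expo_toPoly_sum ((length_rows_le nu).trans hN)]

/-- The span of the `m_ν` with `ν` below `λ`. -/
def lowerSpan (F : Type*) [Field F] (lam : n.Partition) : Submodule F (Sym F) :=
  Submodule.span F (monomialSym '' {nu | lexLT n nu lam})

theorem lowerSpan_le_homSym (lam : n.Partition) : lowerSpan F lam ≤ homSym F n := by
  refine Submodule.span_le.mpr ?_
  rintro _ ⟨nu, -, rfl⟩
  exact monomialSym_mem_homSym nu

theorem lowerSpan_mono {mu lam : n.Partition} (h : lexLT n mu lam) :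
    lowerSpan F mu ≤ lowerSpan F lam :=
  Submodule.span_mono (Set.image_mono fun _ hnu => lt_trans hnu h)

theorem monomialSym_mem_lowerSpan {mu lam : n.Partition} (h : lexLT n mu lam) :
    (monomialSym mu : Sym F) ∈ lowerSpan F lam :=
  Submodule.subset_span ⟨mu, h, rfl⟩

theorem coeff_eq_zero_of_mem_lowerSpan {lam nu : n.Partition} {f : Sym F}
    (hf : f ∈ lowerSpan F lam) (hnu : (rows nu).length ≤ N) (h : ¬ lexLT n nu lam) :
    coeff (expo N nu) (toPoly F N f) = 0 := by
  induction hf using Submodule.span_induction with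
  | mem x hx =>
    obtain ⟨ka, hka, rfl⟩ := hx
    rw [coeff_expo_toPoly_monomialSym hnu, if_neg]
    rintro rfl
    exact h hka
  | zero => simp
  | add x y _ _ hx hy => rw [map_add, coeff_add, hx, hy, add_zero]
  | smul a x _ hx => rw [map_smul, coeff_smul, hx, smul_zero]

theorem mem_lowerSpan (hN : n ≤ N) {lam : n.Partition} {f : Sym F} (hf : f ∈ homSym F n)
    (h : ∀ nu, ¬ lexLT n nu lam → coeff (expo N nu) (toPoly F N f) = 0) :
    f ∈ lowerSpan F lam := by
  rw [eq_sum_monomialSym hN hf]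
  refine Submodule.sum_mem _ fun nu _ => ?_
  by_cases hnu : lexLT n nu lam
  · exact Submodule.smul_mem _ _ (monomialSym_mem_lowerSpan hnu)
  · rw [h nu hnu, zero_smul]
    exact Submodule.zero_mem _

/-- `f = m_λ + lower terms`. -/
def IsMonicAt (lam : n.Partition) (f : Sym F) : Prop := f - monomialSym lam ∈ lowerSpan F lam

theorem IsMonicAt.mem_homSym {lam : n.Partition} {f : Sym F} (h : IsMonicAt lam f) :
    f ∈ homSym F n := by
  have := Submodule.add_mem _ (lowerSpan_le_homSym lam h) (monomialSym_mem_homSym lam)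
  rwa [sub_add_cancel] at this

theorem IsMonicAt.coeff {lam nu : n.Partition} {f : Sym F} (h : IsMonicAt lam f)
    (hnu : (rows nu).length ≤ N) (h' : ¬ lexLT n nu lam) :
    MvPolynomial.coeff (expo N nu) (toPoly F N f) = if lam = nu then 1 else 0 := by
  have h1 := coeff_eq_zero_of_mem_lowerSpan h hnu h'
  rw [map_sub, coeff_sub, sub_eq_zero] at h1
  rw [h1, coeff_expo_toPoly_monomialSym hnu]

theorem IsMonicAt.mem_lowerSpan {lam mu : n.Partition} {f : Sym F} (h : IsMonicAt lam f)
    (hlt : lexLT n lam mu) : f ∈ lowerSpan F mu := by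
  have := Submodule.add_mem _ (lowerSpan_mono hlt h) (monomialSym_mem_lowerSpan hlt)
  rwa [sub_add_cancel] at this

/-- The quotient of the operator applied to a function with leading term `m_λ`. -/
theorem exists_quotient_of_isMonicAt (hN : n ≤ N) (Y : F) {lam : n.Partition} {f : Sym F}
    (h : IsMonicAt lam f) : ∃ g ∈ lowerSpan F lam, polyOp q τ Y (toPoly F N f) =
      vdm N F * toPoly F N (eigenvalue q τ N lam Y • f + g) := by
  obtain ⟨g, hg, hD⟩ := exists_toPoly_quotient (q := q) (τ := τ) (N := N) n Y h.mem_homSym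
  have hlam := (length_rows_le lam).trans hN
  obtain ⟨h1, h2⟩ := polyOp_triangular h.mem_homSym hg hD hlam fun nu hnu hlt => by
    rw [h.coeff hnu (lt_asymm hlt), if_neg]
    rintro rfl
    exact lt_irrefl _ hlt
  refine ⟨g - eigenvalue q τ N lam Y • f, mem_lowerSpan hN
    (Submodule.sub_mem _ hg (Submodule.smul_mem _ _ h.mem_homSym)) fun nu hnu => ?_,
    by rw [add_sub_cancel, hD]⟩
  have hl := (length_rows_le nu).trans hN
  rw [map_sub, map_smul, coeff_sub, coeff_smul, smul_eq_mul]
  rcases lexLT_trichotomous nu lam with h' | rfl | h'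
  · exact absurd h' hnu
  · rw [h2, sub_self]
  · rw [h1 nu hl h', h.coeff hl hnu, if_neg, mul_zero, sub_self]
    rintro rfl
    exact lt_irrefl _ h'

theorem pow_mul_pow_eq (h : IsGenericPair q τ) {a b c d : ℕ} (he : τ ^ a * q ^ b = τ ^ c * q ^ d) :
    a = c ∧ b = d := by
  have h1 := h.eq_zero_of_zpow ((b : ℤ) - d) ((a : ℤ) - c) (by
    rw [zpow_sub₀ h.left_ne_zero, zpow_sub₀ h.right_ne_zero, zpow_natCast, zpow_natCast,
      zpow_natCast, zpow_natCast]
    have := pow_ne_zero d h.left_ne_zero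
    have := pow_ne_zero c h.right_ne_zero
    field_simp
    linear_combination he)
  omega

theorem exists_eigenvalue_ne (h : IsGenericPair q τ) (hN : n ≤ N) {nu lam : n.Partition}
    (hne : nu ≠ lam) : ∃ Y, eigenvalue q τ N nu Y ≠ eigenvalue q τ N lam Y := by
  have h1 : expo N nu ≠ expo N lam := fun he => hne
    (expo_injective ((length_rows_le nu).trans hN) ((length_rows_le lam).trans hN) he)
  obtain ⟨i, hi⟩ := DFunLike.ne_iff.mp h1
  have hc : τ ^ (Fin.rev i : ℕ) * q ^ (rows nu).getD i 0 ≠ 0 :=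
    mul_ne_zero (pow_ne_zero _ h.right_ne_zero) (pow_ne_zero _ h.left_ne_zero)
  -- This `Y` kills the `i`-th factor for `ν`. A vanishing factor for `λ` would, by multiplicative
  -- independence, have the same index `i` and give `λ_i = ν_i`.
  refine ⟨-(τ ^ (Fin.rev i : ℕ) * q ^ (rows nu).getD i 0)⁻¹, ?_⟩
  have h2 : eigenvalue q τ N nu (-(τ ^ (Fin.rev i : ℕ) * q ^ (rows nu).getD i 0)⁻¹) = 0 := by
    refine Finset.prod_eq_zero (Finset.mem_univ i) ?_
    rw [mul_assoc, neg_mul, inv_mul_cancel₀ hc, add_neg_cancel]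
  rw [h2]
  refine (Finset.prod_ne_zero_iff.mpr fun k _ hk => ?_).symm
  have h3 : τ ^ (Fin.rev k : ℕ) * q ^ (rows lam).getD k 0 =
      τ ^ (Fin.rev i : ℕ) * q ^ (rows nu).getD i 0 := by
    rw [mul_assoc, neg_mul, add_neg_eq_zero] at hk
    rw [eq_comm, inv_mul_eq_one₀ hc] at hk
    exact hk.symm
  obtain ⟨h4, h5⟩ := pow_mul_pow_eq h h3
  have h6 : k = i := Fin.rev_injective (Fin.ext h4)
  subst h6
  exact hi h5.symm

end

/-! ### Macdonald symmetric functions -/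

section

variable {F : Type*} [Field F] {q τ : F} {N n : ℕ}

open Classical in
theorem macdonaldP_eq (q τ : F) (lam : n.Partition) :
    macdonaldP q τ lam = monomialSym lam - ∑ mu : {mu : n.Partition // lexLT n mu lam},
      (qtForm q τ (monomialSym lam) (macdonaldP q τ mu.1) /
        qtForm q τ (macdonaldP q τ mu.1) (macdonaldP q τ mu.1)) • macdonaldP q τ mu.1 := by
  rw [macdonaldP, WellFounded.fix_eq]
  congr 1
  exact Finset.sum_congr rfl fun mu _ => by rw [smul_eq_C_mul]; rfl

variable [CharZero F]

theorem isMonicAt_macdonaldP (q τ : F) (lam : n.Partition) :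
    IsMonicAt lam (macdonaldP q τ lam) := by
  classical
  induction lam using (lexLT_wf n).induction with
  | h lam ih =>
  rw [IsMonicAt, macdonaldP_eq, sub_sub_cancel_left]
  exact Submodule.neg_mem _ (Submodule.sum_mem _ fun mu _ =>
    Submodule.smul_mem _ _ ((ih mu.1 mu.2).mem_lowerSpan mu.2))

theorem macdonaldP_mem_homSym (q τ : F) (lam : n.Partition) :
    macdonaldP q τ lam ∈ homSym F n :=
  (isMonicAt_macdonaldP q τ lam).mem_homSym

theorem lowerSpan_eq (q τ : F) (lam : n.Partition) :
    lowerSpan F lam = Submodule.span F (macdonaldP q τ '' {nu | lexLT n nu lam}) := by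
  set P : n.Partition → Sym F := macdonaldP q τ with hP
  have hmon : ∀ nu, IsMonicAt nu (P nu) := isMonicAt_macdonaldP q τ
  clear_value P
  apply le_antisymm
  · induction lam using (lexLT_wf n).induction with
    | h lam ih =>
    refine Submodule.span_le.mpr ?_
    rintro _ ⟨nu, hnu, rfl⟩
    have h2 := ih nu hnu (hmon nu)
    have h3 : P nu ∈ Submodule.span F (P '' {nu | lexLT n nu lam}) :=
      Submodule.subset_span (Set.mem_image_of_mem _ hnu)
    have hsub : {ka | lexLT n ka nu} ⊆ {ka | lexLT n ka lam} := fun _ hka =>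
      _root_.trans (r := lexLT n) hka hnu
    have h4 := Submodule.sub_mem _ h3 (Submodule.span_mono (Set.image_mono hsub) h2)
    rwa [sub_sub_cancel] at h4
  · refine Submodule.span_le.mpr ?_
    rintro _ ⟨nu, hnu, rfl⟩
    exact (hmon nu).mem_lowerSpan hnu

/-- The power-sum monomials are orthogonal with nonzero square lengths, so the form is nondegenerate
in each degree. -/
theorem eq_zero_of_qtForm_eq_zero (h : IsGenericPair q τ) {f : Sym F} (hf : f ∈ homSym F n)
    (h0 : ∀ nu : n.Partition, qtForm q τ f (monomialSym nu) = 0) : f = 0 := by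
  have h1 : ∀ g ∈ homSym F n, qtForm q τ f g = 0 := by
    intro g hg
    obtain ⟨c, rfl⟩ := exists_eq_sum_monomialSym hg
    simp [h0]
  rw [eq_sum_weightExps hf]
  refine Finset.sum_eq_zero fun d hd => ?_
  have h2 := h1 _ (monomial_mem_homSym hd)
  rw [qtForm, pairingLin_monomial, mul_eq_zero,
    or_iff_left (sqLength_ne_zero (qtWeight_ne_zero h) d)] at h2
  rw [h2, zero_smul]

/-- Orthogonality, the eigenvector property and nondegeneracy. -/
structure IsEigen (q τ : F) (N : ℕ) (lam : n.Partition) : Prop where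
  orthogonal : ∀ f ∈ lowerSpan F lam, qtForm q τ (macdonaldP q τ lam) f = 0
  eigen : ∀ Y, polyOp q τ Y (toPoly F N (macdonaldP q τ lam)) =
    vdm N F * toPoly F N (eigenvalue q τ N lam Y • macdonaldP q τ lam)
  norm_ne_zero : qtForm q τ (macdonaldP q τ lam) (macdonaldP q τ lam) ≠ 0

/-- All three properties go together in one induction along the lexicographic order: Gram–Schmidt
gives orthogonality only if the earlier norms are nonzero, the eigenvector property needs
orthogonality, and the norm is handled by means of the eigenvalues. -/
theorem isEigen (h : IsGenericPair q τ) (hN : n ≤ N) (lam : n.Partition) : IsEigen q τ N lam := by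
  classical
  induction lam using (lexLT_wf n).induction with
  | h lam ih =>
  have hmon := isMonicAt_macdonaldP q τ lam
  have hhom := macdonaldP_mem_homSym q τ lam
  have horth : ∀ mu ka, lexLT n mu lam → lexLT n ka lam → mu ≠ ka →
      qtForm q τ (macdonaldP q τ mu) (macdonaldP q τ ka) = 0 := by
    intro mu ka hmu hka hne
    rcases lexLT_trichotomous mu ka with hlt | rfl | hlt
    · rw [qtForm_comm]
      exact (ih ka hka).orthogonal _ ((isMonicAt_macdonaldP q τ mu).mem_lowerSpan hlt)
    · exact absurd rfl hne
    · exact (ih mu hmu).orthogonal _ ((isMonicAt_macdonaldP q τ ka).mem_lowerSpan hlt)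
  have h1 : ∀ mu, lexLT n mu lam → qtForm q τ (macdonaldP q τ lam) (macdonaldP q τ mu) = 0 := by
    intro mu hmu
    rw [macdonaldP_eq q τ lam, map_sub, map_sum, LinearMap.sub_apply, LinearMap.sum_apply,
      Finset.sum_eq_single ⟨mu, hmu⟩]
    · rw [map_smul, LinearMap.smul_apply, smul_eq_mul,
        div_mul_cancel₀ _ (ih mu hmu).norm_ne_zero, sub_self]
    · intro ka _ hka
      rw [map_smul, LinearMap.smul_apply, horth _ _ ka.2 hmu fun he => hka (Subtype.ext he),
        smul_zero]
    · intro hh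
      exact absurd (Finset.mem_univ _) hh
  have h2 : ∀ f ∈ lowerSpan F lam, qtForm q τ (macdonaldP q τ lam) f = 0 := by
    intro f hf
    rw [lowerSpan_eq q τ] at hf
    induction hf using Submodule.span_induction with
    | mem x hx =>
      obtain ⟨ka, hka, rfl⟩ := hx
      exact h1 ka hka
    | zero => exact map_zero _
    | add x y _ _ hx hy => rw [map_add, hx, hy, add_zero]
    | smul a x _ hx => rw [map_smul, hx, smul_zero]
  have h3 : ∀ Y, polyOp q τ Y (toPoly F N (macdonaldP q τ lam)) =
      vdm N F * toPoly F N (eigenvalue q τ N lam Y • macdonaldP q τ lam) := by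
    intro Y
    obtain ⟨g, hg, hD⟩ := exists_quotient_of_isMonicAt (q := q) (τ := τ) hN Y hmon
    -- Self-adjointness moves the operator to the eigenvector `P_μ`, so the error term `g` is
    -- orthogonal to all lower `P_μ`. It lies in their span, on which the form is nondegenerate.
    have h4 : ∀ mu, lexLT n mu lam → qtForm q τ g (macdonaldP q τ mu) = 0 := by
      intro mu hmu
      have h5 := polyOp_adjoint h hN Y hhom (Submodule.add_mem _ (Submodule.smul_mem _ _ hhom)
        (lowerSpan_le_homSym lam hg)) (macdonaldP_mem_homSym q τ mu)
        (Submodule.smul_mem _ _ (macdonaldP_mem_homSym q τ mu)) hD ((ih mu hmu).eigen Y)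
      rw [map_add, map_smul, map_smul, LinearMap.add_apply, LinearMap.smul_apply, h1 mu hmu,
        smul_zero, smul_zero, zero_add] at h5
      exact h5
    have h6 : g = 0 := by
      have hg' := hg
      rw [lowerSpan_eq q τ, Set.image_eq_range,
        Submodule.mem_span_range_iff_exists_fun] at hg'
      obtain ⟨c, rfl⟩ := hg'
      refine Finset.sum_eq_zero fun mu _ => ?_
      have h7 := h4 mu.1 mu.2
      rw [map_sum, LinearMap.sum_apply, Finset.sum_eq_single mu] at h7
      · rw [map_smul, LinearMap.smul_apply, smul_eq_mul, mul_eq_zero,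
          or_iff_left (ih mu.1 mu.2).norm_ne_zero] at h7
        rw [h7, zero_smul]
      · intro ka _ hka
        rw [map_smul, LinearMap.smul_apply, horth _ _ ka.2 mu.2 fun he => hka (Subtype.ext he),
          smul_zero]
      · intro hh
        exact absurd (Finset.mem_univ _) hh
    rw [hD, h6, add_zero]
  refine ⟨h2, h3, fun h0 => ?_⟩
  -- Were the norm zero, `P_λ` would be orthogonal to every `m_ν`, against nondegeneracy. For `ν =
  -- λ` this is immediate; for `ν ≠ λ`, triangularity and self-adjointness give `(e_λ - e_ν) ⟨P_λ,
  -- m_ν⟩ = 0`, and some `Y` separates the eigenvalues.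
  have h4 : ∀ nu : n.Partition, qtForm q τ (macdonaldP q τ lam) (monomialSym nu) = 0 := by
    intro nu
    induction nu using (lexLT_wf n).induction with
    | h nu ihn =>
    by_cases hne : nu = lam
    · subst hne
      have h5 := h2 _ hmon
      rw [map_sub, h0, zero_sub, neg_eq_zero] at h5
      exact h5
    · obtain ⟨Y, hY⟩ := exists_eigenvalue_ne h hN hne
      have hself : IsMonicAt nu (monomialSym nu : Sym F) := by
        rw [IsMonicAt, sub_self]; exact Submodule.zero_mem _
      obtain ⟨g, hg, hD⟩ := exists_quotient_of_isMonicAt (q := q) (τ := τ) hN Y hself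
      have h5 := polyOp_adjoint h hN Y hhom (Submodule.smul_mem _ _ hhom)
        (monomialSym_mem_homSym nu) (Submodule.add_mem _
          (Submodule.smul_mem _ _ (monomialSym_mem_homSym nu)) (lowerSpan_le_homSym nu hg))
        (h3 Y) hD
      have h6 : qtForm q τ (macdonaldP q τ lam) g = 0 := by
        clear hD h5
        induction hg using Submodule.span_induction with
        | mem x hx =>
          obtain ⟨ka, hka, rfl⟩ := hx
          exact ihn ka hka
        | zero => exact map_zero _
        | add x y _ _ hx hy => rw [map_add, hx, hy, add_zero]
        | smul a x _ hx => rw [map_smul, hx, smul_zero]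
      rw [map_add, map_smul, map_smul, h6, add_zero, LinearMap.smul_apply, smul_eq_mul,
        smul_eq_mul, ← sub_eq_zero, ← sub_mul, mul_eq_zero, sub_eq_zero] at h5
      exact h5.resolve_left hY.symm
  have h5 := eq_zero_of_qtForm_eq_zero h hhom h4
  have h6 := hmon.coeff (length_rows_le lam) (lt_irrefl (rows lam))
  rw [h5, map_zero, coeff_zero, if_pos rfl] at h6
  exact zero_ne_one h6

/-- The functions `P_λ` are eigenvectors. -/
theorem polyOp_macdonaldP (h : IsGenericPair q τ) (hN : n ≤ N) (lam : n.Partition) (Y : F) :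
    polyOp q τ Y (toPoly F N (macdonaldP q τ lam)) =
      C (eigenvalue q τ N lam Y) * (vdm N F * toPoly F N (macdonaldP q τ lam)) := by
  rw [(isEigen h hN lam).eigen Y, map_smul, smul_eq_C_mul]
  ring

theorem exists_eq_sum_macdonaldP (q τ : F) {f : Sym F} (hf : f ∈ homSym F n) :
    ∃ c : n.Partition → F, f = ∑ lam, c lam • macdonaldP q τ lam := by
  have h1 : homSym F n ≤ Submodule.span F (Set.range (macdonaldP q τ : n.Partition → Sym F)) := by
    rw [homSym_eq_span]
    refine Submodule.span_le.mpr ?_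
    rintro _ ⟨nu, rfl⟩
    have h2 := isMonicAt_macdonaldP q τ nu
    rw [IsMonicAt, lowerSpan_eq q τ] at h2
    have h3 := Submodule.span_mono (Set.image_subset_range _ _) h2
    have h4 := Submodule.sub_mem _ (Submodule.subset_span (Set.mem_range_self nu)) h3
    rwa [sub_sub_cancel] at h4
  obtain ⟨c, hc⟩ := Submodule.mem_span_range_iff_exists_fun F |>.mp (h1 hf)
  exact ⟨c, hc.symm⟩

/-- The images of the `P_λ` in `N` variables, with `λ` of length at most `N`, are independent. -/
theorem eq_zero_of_sum_toPoly_macdonaldP (q τ : F) {s : Finset n.Partition}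
    (hs : ∀ lam ∈ s, (rows lam).length ≤ N) {c : n.Partition → F}
    (h0 : ∑ lam ∈ s, c lam • toPoly F N (macdonaldP q τ lam) = 0) :
    ∀ lam ∈ s, c lam = 0 := by
  classical
  by_contra! hne
  obtain ⟨ka, hka, hmax⟩ := (s.filter fun lam => c lam ≠ 0).exists_max_image
    (fun lam => toLex (expo N lam)) (by
      obtain ⟨lam, h1, h2⟩ := hne
      exact ⟨lam, Finset.mem_filter.mpr ⟨h1, h2⟩⟩)
  obtain ⟨hks, hkc⟩ := Finset.mem_filter.mp hka
  refine hkc ?_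
  have h1 := congrArg (coeff (expo N ka)) h0
  rw [coeff_sum, coeff_zero, Finset.sum_eq_single ka] at h1
  · rwa [coeff_smul, (isMonicAt_macdonaldP q τ ka).coeff (hs ka hks) (lt_irrefl (rows ka)),
      if_pos rfl, smul_eq_mul, mul_one] at h1
  · intro lam hlam hl
    rw [coeff_smul]
    by_cases hc : c lam = 0
    · rw [hc, zero_smul]
    have h2 := hmax lam (Finset.mem_filter.mpr ⟨hlam, hc⟩)
    rw [(isMonicAt_macdonaldP q τ lam).coeff (hs ka hks) fun h3 =>
      absurd (toLex_expo_lt (hs lam hlam) h3) (not_lt.mpr h2), if_neg hl, smul_zero]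
  · intro hh
    exact absurd hks hh

end

/-! ### The series of `e_n[X / (1 - q)]` -/

section

variable {F : Type*} [Field F] {q τ : F} {M : ℕ}

/-- The recursion never reads the term at `0`, so degenerate values there, such as `(1 - q ^ 0)⁻¹ =
0`, are harmless. -/
theorem expCoeff_congr {R : Type*} [CommRing R] [Algebra F R] {a b : ℕ → R}
    (h : ∀ r, 0 < r → a r = b r) (n : ℕ) : expCoeff F a n = expCoeff F b n := by
  induction n using Nat.strong_induction_on with
  | _ n ih =>
    rcases n with _ | n
    · rw [expCoeff, expCoeff]
    · rw [expCoeff, expCoeff]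
      congr 1
      refine Finset.sum_congr rfl fun i _ => ?_
      rw [h _ (Nat.succ_pos _), ih _ (by omega)]

theorem expSeries_congr {R : Type*} [CommRing R] [Algebra F R] {a b : ℕ → R}
    (h : ∀ r, 0 < r → a r = b r) : expSeries F a = expSeries F b :=
  PowerSeries.ext fun n => by
    rw [expSeries, expSeries, PowerSeries.coeff_mk, PowerSeries.coeff_mk, expCoeff_congr h]

/-- `(-1) ^ n e_n[X / (1 - q)]`. -/
def elemCoeff (q : F) (n : ℕ) : Sym F :=
  expCoeff F (fun r => C (-(1 - q ^ r)⁻¹) * (X r.toPNat' : Sym F)) n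

theorem elemCoeff_mem_homSym (q : F) (n : ℕ) : elemCoeff q n ∈ homSym F n := by
  rw [elemCoeff]
  induction n using Nat.strong_induction_on with
  | _ n ih =>
    rcases n with _ | n
    · rw [expCoeff]; exact one_mem_homSym
    · rw [expCoeff]
      refine Submodule.smul_mem _ _ (Submodule.sum_mem _ fun i _ => ?_)
      rw [mul_assoc, ← smul_eq_C_mul]
      refine Submodule.smul_mem _ _ ?_
      have h1 := mul_mem_homSym (X_mem_homSym (F := F) ((i : ℕ) + 1).toPNat') (ih (n - i) (by omega))
      rwa [PNat.toPNat'_coe (Nat.succ_pos _),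
        show (i : ℕ) + 1 + (n - i) = n + 1 by omega] at h1

/-- The logarithm of the series in finitely many variables. -/
def elemSeq (q : F) (M r : ℕ) : MvPolynomial (Fin M) F := C (-(1 - q ^ r)⁻¹) * ∑ i, X i ^ r

theorem toPoly_elemCoeff (n : ℕ) : toPoly F M (elemCoeff q n) = expCoeff F (elemSeq q M) n := by
  rw [elemCoeff, map_expCoeff]
  refine expCoeff_congr (fun r hr => ?_) n
  rw [map_mul, algHom_C, toPoly_X, PNat.toPNat'_coe hr, elemSeq, psum, algebraMap_eq]

/-- Since `-(qʳ - 1)/(1 - qʳ) = 1`, shifting the variables in `I` divides the series by `∏_{i ∈ I}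
(1 - x_i u)`. -/
theorem shift_elemSeq (h : IsGenericPair q τ) (I : Finset (Fin M)) {r : ℕ} (hr : 0 < r) :
    shift q I (elemSeq q M r) = elemSeq q M r + ∑ i ∈ I, X i ^ r := by
  have h1 : shift q I (∑ i, X i ^ r) =
      (∑ i, X i ^ r) + (C (q ^ r) - 1) * ∑ i ∈ I, (X i : MvPolynomial (Fin M) F) ^ r := by
    rw [map_sum, Finset.mul_sum, ← Fintype.sum_ite_mem I, ← Finset.sum_add_distrib]
    refine Finset.sum_congr rfl fun i _ => ?_
    rw [map_pow, shift_X]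
    split_ifs
    · rw [mul_pow, C_pow]; ring
    · simp
  have h2 : (C (-(1 - q ^ r)⁻¹) * (C (q ^ r) - 1) : MvPolynomial (Fin M) F) = 1 := by
    rw [← C_1, ← C_sub, ← C_mul]
    congr 1
    have := h.one_sub_left_ne_zero hr
    field_simp
    ring
  rw [elemSeq, map_mul, algHom_C, algebraMap_eq, h1, mul_add, ← mul_assoc, h2, one_mul]

variable [CharZero F]

theorem prod_mul_map_shift_elemSeries (h : IsGenericPair q τ) (I : Finset (Fin M)) :
    (∏ i ∈ I, (1 - PowerSeries.C (X i) * PowerSeries.X)) *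
      PowerSeries.map (shift q I : MvPolynomial (Fin M) F →+* MvPolynomial (Fin M) F)
        (expSeries F (elemSeq q M)) = expSeries F (elemSeq q M) := by
  rw [map_expSeries, expSeries_congr fun r hr => shift_elemSeq h I hr,
    prod_one_sub_mul_expSeries]

/-- At `Y = -1` row `k` is `(1 - tᵏ) xᵏ - u xᵏ⁺¹`, without the first term for `k = 0`. So `x_i`
comes out of each column, and what remains is the Vandermonde matrix multiplied by a lower
triangular matrix with diagonal `-u`. -/
theorem det_elem {S : Type*} [CommRing S] (u t : S) (x : Fin M → S) :
    Matrix.det (Matrix.of fun k i : Fin M => x i ^ (k : ℕ) * ((1 - x i * u) + (-1) * t ^ (k : ℕ) * 1)) =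
      (-u) ^ M * ((∏ i, x i) * Matrix.det (Matrix.of fun k i : Fin M => x i ^ (k : ℕ))) := by
  let U : Matrix (Fin M) (Fin M) S := Matrix.of fun k l =>
    if l = k then -u else if (l : ℕ) + 1 = k then 1 - t ^ (k : ℕ) else 0
  have hU : U.det = (-u) ^ M := by
    rw [Matrix.det_of_isLowerTriangular U]
    · simp [U]
    · intro k l hkl
      have hkl' : k < l := hkl
      simp only [U, Matrix.of_apply]
      rw [if_neg hkl'.ne', if_neg]
      have : (k : ℕ) < l := hkl'
      omega
  have hm : Matrix.of (fun k i : Fin M => x i ^ (k : ℕ) * ((1 - x i * u) + (-1) * t ^ (k : ℕ) * 1)) =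
      U * Matrix.of (fun k i : Fin M => x i ^ (k : ℕ)) * Matrix.diagonal x := by
    ext k i
    rw [Matrix.mul_diagonal, Matrix.mul_apply]
    simp only [U, Matrix.of_apply]
    by_cases hk : (k : ℕ) = 0
    · rw [Finset.sum_eq_single k]
      · rw [if_pos rfl, hk]; ring
      · intro l _ hl
        rw [if_neg hl, if_neg (by omega), zero_mul]
      · intro hh; exact absurd (Finset.mem_univ _) hh
    · obtain ⟨m, hm⟩ := Nat.exists_eq_succ_of_ne_zero hk
      have hmM : m < M := by omega
      rw [← Finset.add_sum_erase _ _ (Finset.mem_univ k), if_pos rfl,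
        Finset.sum_eq_single ⟨m, hmM⟩]
      · rw [if_neg (by intro hh; have := congrArg Fin.val hh; simp at this; omega),
          if_pos (by simp [hm]), hm, Nat.succ_eq_add_one]
        ring
      · intro l hl hl'
        rw [if_neg (Finset.ne_of_mem_erase hl), if_neg, zero_mul]
        intro hh
        exact hl' (Fin.ext (by simp; omega))
      · intro hh
        refine absurd (Finset.mem_erase.mpr ⟨?_, Finset.mem_univ _⟩) hh
        intro hh
        have := congrArg Fin.val hh
        simp at this
        omega
  rw [hm, Matrix.det_mul, Matrix.det_mul, hU, Matrix.det_diagonal]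
  ring

/-- The operator at `Y = -1` lowers the degree by `M`. -/
theorem polyOp_elemCoeff (h : IsGenericPair q τ) (m : ℕ) :
    polyOp q τ (-1) (toPoly F M (elemCoeff q (m + M))) =
      C ((-1) ^ M * q ^ m) * (∏ i, X i) * (vdm M F * toPoly F M (elemCoeff q m)) := by
  have h1 := altOp_eq_det (fun i => PowerSeries.C (X i : MvPolynomial (Fin M) F))
    (fun I => PowerSeries.map (shift q I : MvPolynomial (Fin M) F →+* MvPolynomial (Fin M) F))
    (PowerSeries.C (C τ)) (-1) (expSeries F (elemSeq q M)) (fun _ => 1)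
    (fun i => 1 - PowerSeries.C (X i) * PowerSeries.X) (fun I => by
      rw [Finset.prod_const_one, mul_one]; exact prod_mul_map_shift_elemSeries h I)
  -- For the series `G`, writing `G` as `∏ (1 - x_i u)` times its full shift cancels the
  -- denominators: `D(-1) G` is `(-u)^M x_1 ⋯ x_M` times the full shift of `G`. That shift
  -- contributes `q ^ m` in degree `m`.
  rw [det_elem, ← prod_mul_map_shift_elemSeries h Finset.univ, mul_assoc] at h1
  have h2 : (∏ i : Fin M, (1 - PowerSeries.C (X i : MvPolynomial (Fin M) F) * PowerSeries.X)) ≠ 0 := by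
    refine Finset.prod_ne_zero_iff.mpr fun i _ h0 => ?_
    have := congrArg PowerSeries.constantCoeff h0
    simp at this
  have h3 := mul_left_cancel₀ h2 h1
  rw [prod_mul_map_shift_elemSeries h Finset.univ] at h3
  have hv : Matrix.det (Matrix.of fun k i : Fin M =>
      PowerSeries.C (X i : MvPolynomial (Fin M) F) ^ (k : ℕ)) = PowerSeries.C (vdm M F) := by
    rw [vdm_eq, RingHom.map_det]
    congr 1
    ext k i : 2
    simp
  have hY : (-1 : PowerSeries (MvPolynomial (Fin M) F)) = PowerSeries.C (C (-1)) := by simp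
  have h4 := congrArg (PowerSeries.coeff (m + M)) h3
  rw [hv, hY, coeff_altOp] at h4
  have h5 : PowerSeries.map (shift q (Finset.univ : Finset (Fin M)) : MvPolynomial (Fin M) F →+* MvPolynomial (Fin M) F)
        (expSeries F (elemSeq q M)) * ((-PowerSeries.X) ^ M *
          ((∏ i, PowerSeries.C (X i)) * PowerSeries.C (vdm M F))) =
      PowerSeries.C ((-1) ^ M * (∏ i, X i) * vdm M F) *
        (PowerSeries.map (shift q (Finset.univ : Finset (Fin M)) : MvPolynomial (Fin M) F →+* MvPolynomial (Fin M) F)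
        (expSeries F (elemSeq q M)) * PowerSeries.X ^ M) := by
    rw [neg_pow PowerSeries.X]
    simp only [map_mul, map_pow, map_neg, map_one, map_prod]
    ring
  rw [h5, PowerSeries.coeff_C_mul, PowerSeries.coeff_mul_X_pow, PowerSeries.coeff_map, expSeries,
    PowerSeries.coeff_mk, PowerSeries.coeff_mk, ← toPoly_elemCoeff, ← toPoly_elemCoeff] at h4
  have h6 : shift q Finset.univ (toPoly F M (elemCoeff q m)) =
      C (q ^ m) * toPoly F M (elemCoeff q m) := by
    ext α
    rw [coeff_shift, coeff_C_mul]
    by_cases h0 : coeff α (toPoly F M (elemCoeff q m)) = 0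
    · rw [h0, mul_zero, mul_zero]
    · have h7 := isHomogeneous_toPoly (elemCoeff_mem_homSym q m) h0
      rw [weight_one_eq] at h7
      rw [h7]
  rw [polyOp, h4]
  change _ * shift q Finset.univ _ = _
  rw [h6]
  simp only [C_mul, C_pow, C_neg, C_1]
  ring

end

/-! ### Restriction to fewer variables -/

section

variable {F : Type*} [Field F] {q τ : F} {M n : ℕ}

/-- The `j` extra rows are empty and give the factors `1 + τˢ Z`; in the others `τ ^ j` is absorbed
into `Z`. -/
theorem eigenvalue_add {lam : n.Partition} (hlam : (rows lam).length ≤ M) (j : ℕ) (Z : F) :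
    eigenvalue q τ (M + j) lam Z =
      (∏ s ∈ Finset.range j, (1 + τ ^ s * Z)) * eigenvalue q τ M lam (τ ^ j * Z) := by
  rw [eigenvalue, Fin.prod_univ_add, mul_comm, eigenvalue]
  congr 1
  · rw [← Finset.prod_range_reflect,
      ← Fin.prod_univ_eq_prod_range (fun s => 1 + τ ^ (j - 1 - s) * Z)]
    refine Finset.prod_congr rfl fun i _ => ?_
    have h1 : (rows lam).getD (Fin.natAdd M i : ℕ) 0 = 0 :=
      List.getD_eq_default _ _ (by rw [Fin.val_natAdd]; omega)
    rw [h1, Fin.val_rev, Fin.val_natAdd, pow_zero, mul_one,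
      show M + j - (M + (i : ℕ) + 1) = j - 1 - i by omega]
    ring
  · refine Finset.prod_congr rfl fun i _ => ?_
    rw [Fin.val_castAdd, Fin.val_rev, Fin.val_rev, Fin.val_castAdd,
      show M + j - ((i : ℕ) + 1) = j + (M - ((i : ℕ) + 1)) by omega, pow_add]
    ring

theorem prod_X_ne_zero : (∏ i : Fin M, X i : MvPolynomial (Fin M) F) ≠ 0 :=
  Finset.prod_ne_zero_iff.mpr fun i _ => X_ne_zero i

variable [CharZero F]

/-- The eigenvalue equation in fewer variables. -/
theorem polyOp_toPoly_macdonaldP (h : IsGenericPair q τ) (lam : n.Partition) (j : ℕ) :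
    ∀ {M : ℕ}, n ≤ M + j → ∀ Z : F,
      C (∏ s ∈ Finset.range j, (1 + τ ^ s * Z)) *
          polyOp q τ (τ ^ j * Z) (toPoly F M (macdonaldP q τ lam)) =
        C (eigenvalue q τ (M + j) lam Z) * (vdm M F * toPoly F M (macdonaldP q τ lam)) := by
  induction j with
  | zero =>
    intro M hM Z
    simpa using polyOp_macdonaldP h hM lam Z
  | succ j ih =>
    intro M hM Z
    -- Each variable set to zero yields one more factor `1 + τ ^ j Z` on the left. The factors stay
    -- there because they may vanish for special `Z`.
    have h1 := congrArg (dropVar F M) (ih (M := M + 1) (by omega) Z)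
    rw [map_mul, map_mul, map_mul, dropVar_polyOp, dropVar_vdm, dropVar_toPoly, algHom_C,
      algHom_C, algebraMap_eq, show M + 1 + j = M + (j + 1) by omega] at h1
    apply mul_left_cancel₀ (prod_X_ne_zero (M := M) (F := F))
    rw [Finset.prod_range_succ, C_mul, pow_succ', mul_assoc τ]
    linear_combination h1

/-- The leading partition of a nonzero image has at most `M` rows, and the eigenvalue equation in
`M` variables gives it the same eigenvalue as `λ` for all `Y`. Eigenvalues separate partitions, so
it is `λ`. -/
theorem length_le_of_toPoly_ne_zero (h : IsGenericPair q τ) {lam : n.Partition}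
    (h0 : toPoly F M (macdonaldP q τ lam) ≠ 0) : (rows lam).length ≤ M := by
  obtain ⟨ka, hl, hka, hmax⟩ := exists_leading_partition (macdonaldP_mem_homSym q τ lam) h0
  have h1 : ka = lam := by
    by_contra hne
    obtain ⟨Y, hY⟩ := exists_eigenvalue_ne h (Nat.le_add_left n M) hne
    apply hY
    have h2 := polyOp_toPoly_macdonaldP h lam n (Nat.le_add_left n M) Y
    have h3 := congrArg (coeff (expo M ka + permExpo Fin.revPerm)) h2
    rw [← polyOp_zero q τ, coeff_C_mul, coeff_C_mul, coeff_polyOp_add _ _ _ hmax,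
      coeff_polyOp_add _ _ _ hmax, mul_smul_comm, mul_smul_comm] at h3
    have h4 := sign_smul_inj _ h3
    simp only [zero_mul, add_zero, Finset.prod_const_one, one_mul] at h4
    rw [← mul_assoc] at h4
    rw [eigenvalue_add hl]
    exact mul_right_cancel₀ hka h4
  rwa [h1] at hl

theorem prod_X_eq : (∏ i : Fin M, X i : MvPolynomial (Fin M) F) =
    monomial (Finsupp.equivFunOnFinite.symm fun _ => 1) 1 := by
  rw [monomial_eq, C_1, one_mul, Finsupp.prod_fintype]
  · simp
  · simp

/-- `λ` arises from `μ` by adding a column of length `M`. -/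
structure IsAddColumn (M : ℕ) {m : ℕ} (mu : m.Partition) (lam : (m + M).Partition) : Prop where
  length_le : (rows mu).length ≤ M
  length_le' : (rows lam).length ≤ M
  getD_eq : ∀ i < M, (rows lam).getD i 0 = (rows mu).getD i 0 + 1

theorem one_add_ne_zero (h : IsGenericPair q τ) {a b c d : ℕ} (hne : a ≠ c ∨ b ≠ d) :
    1 + τ ^ a * q ^ b * (-(τ ^ c * q ^ d)⁻¹) ≠ 0 := by
  intro h0
  have hc : τ ^ c * q ^ d ≠ 0 :=
    mul_ne_zero (pow_ne_zero _ h.right_ne_zero) (pow_ne_zero _ h.left_ne_zero)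
  have h1 : τ ^ a * q ^ b = τ ^ c * q ^ d := by
    rw [mul_neg, add_neg_eq_zero, eq_comm, mul_inv_eq_one₀ hc] at h0
    exact h0
  have := pow_mul_pow_eq h h1
  omega

/-- Adding a column of full length is multiplication by the product of the variables. -/
theorem toPoly_macdonaldP_of_isAddColumn (h : IsGenericPair q τ) {m : ℕ} {mu : m.Partition}
    {lam : (m + M).Partition} (hs : IsAddColumn M mu lam) :
    toPoly F M (macdonaldP q τ lam) = (∏ i, X i) * toPoly F M (macdonaldP q τ mu) := by
  by_contra hne
  -- Both sides have the same eigenvalue, so a nonzero difference would be an eigenvector whose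
  -- leading exponent is forced to be that of `λ`. But both sides have coefficient `1` there.
  obtain ⟨ν, hν, hY⟩ := exists_eigenvalue_eq q τ (sub_ne_zero.mpr hne)
  have heig : ∀ Z, eigenvalue q τ M mu (τ ^ m * (Z * q)) = eigenvalue q τ M lam (τ ^ m * Z) := by
    intro Z
    refine Finset.prod_congr rfl fun i _ => ?_
    rw [hs.getD_eq i i.2]
    ring
  have h1 : ∀ i, ν i = (rows lam).getD i 0 := by
    intro i
    -- Chosen so that the `i`-th factor at `τ ^ m * Z` vanishes for `λ`, while the auxiliary
    -- products over `s < m` do not. The vanishing factor for `ν` must then have index `i`, whence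
    -- `ν_i = λ_i`.
    set Z : F := -(τ ^ (m + (Fin.rev i : ℕ)) * q ^ (rows lam).getD i 0)⁻¹ with hZ
    have hA : ∏ s ∈ Finset.range m, (1 + τ ^ s * Z) ≠ 0 := by
      refine Finset.prod_ne_zero_iff.mpr fun s hs => ?_
      have := one_add_ne_zero h (a := s) (b := 0) (c := m + (Fin.rev i : ℕ))
        (d := (rows lam).getD i 0) (Or.inl (by have := Finset.mem_range.mp hs; omega))
      rwa [pow_zero, mul_one] at this
    have hB : ∏ s ∈ Finset.range m, (1 + τ ^ s * (Z * q)) ≠ 0 := by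
      refine Finset.prod_ne_zero_iff.mpr fun s hs => ?_
      have := one_add_ne_zero h (a := s) (b := 1) (c := m + (Fin.rev i : ℕ))
        (d := (rows lam).getD i 0) (Or.inl (by have := Finset.mem_range.mp hs; omega))
      rw [pow_one] at this
      convert this using 2
      ring
    have h2 := polyOp_toPoly_macdonaldP h lam m (M := M) (by omega) Z
    have h3 := polyOp_toPoly_macdonaldP h mu m (M := M) (by omega) (Z * q)
    rw [eigenvalue_add hs.length_le', C_mul, mul_assoc] at h2
    rw [eigenvalue_add hs.length_le, C_mul, mul_assoc, heig] at h3
    have h2' := mul_left_cancel₀ (C_ne_zero.mpr hA) h2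
    have h3' := mul_left_cancel₀ (C_ne_zero.mpr hB) h3
    have h4 := hY (τ ^ m * Z) 1 (eigenvalue q τ M lam (τ ^ m * Z)) (by
      rw [C_1, one_mul, polyOp_sub, polyOp_prod_X_mul, mul_assoc, h2', h3']
      ring)
    have h5 : eigenvalue q τ M lam (τ ^ m * Z) = 0 := by
      refine Finset.prod_eq_zero (Finset.mem_univ i) ?_
      have hc : τ ^ (m + (Fin.rev i : ℕ)) * q ^ (rows lam).getD i 0 ≠ 0 :=
        mul_ne_zero (pow_ne_zero _ h.right_ne_zero) (pow_ne_zero _ h.left_ne_zero)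
      have h6 := inv_mul_cancel₀ hc
      rw [pow_add] at h6 hZ
      rw [hZ]
      linear_combination -h6
    rw [h5, one_mul, Finset.prod_eq_zero_iff] at h4
    obtain ⟨k, -, hk⟩ := h4
    by_contra hik
    refine one_add_ne_zero h (a := m + (Fin.rev k : ℕ)) (b := ν k) (c := m + (Fin.rev i : ℕ))
      (d := (rows lam).getD i 0) ?_ ?_
    · by_cases hki : k = i
      · subst hki; exact Or.inr hik
      · left
        intro hh
        exact hki (Fin.rev_injective (Fin.ext (by omega)))
    · rw [← hZ, ← hk, pow_add]
      ring
  have hν' : ν = expo M lam := Finsupp.ext h1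
  apply hν
  rw [coeff_sub, hν', (isMonicAt_macdonaldP q τ lam).coeff hs.length_le' (lt_irrefl (rows lam)),
    if_pos rfl]
  have h2 : expo M lam = Finsupp.equivFunOnFinite.symm (fun _ => 1) + expo M mu := by
    ext i
    rw [Finsupp.add_apply, expo_apply, expo_apply, hs.getD_eq i i.2]
    simp [add_comm]
  rw [h2, prod_X_eq, coeff_monomial_mul, one_mul,
    (isMonicAt_macdonaldP q τ mu).coeff hs.length_le (lt_irrefl (rows mu)), if_pos rfl, sub_self]

end

/-! ### The coefficients of `e_n[X / (1 - q)]` -/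

section

variable {F : Type*} [Field F] {q τ : F} {M : ℕ}

theorem exists_isAddColumn {m : ℕ} {mu : m.Partition} (hmu : (rows mu).length ≤ M) :
    ∃ lam : (m + M).Partition, IsAddColumn M mu lam := by
  obtain ⟨lam, hl, he⟩ := exists_expo_eq (N := M) (n := m + M)
    (α := expo M mu + Finsupp.equivFunOnFinite.symm fun _ => 1)
    (by
      intro i j hij
      rw [Finsupp.add_apply, Finsupp.add_apply]
      exact Nat.add_le_add (expo_antitone M mu hij) le_rfl)
    (by simp [Finset.sum_add_distrib, ← degree_expo mu hmu])
  refine ⟨lam, hmu, hl, fun i hi => ?_⟩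
  have := DFunLike.congr_fun he ⟨i, hi⟩
  simpa using this

theorem exists_isAddColumn_left {m : ℕ} (lam : (m + M).Partition) (hM : (rows lam).length = M) :
    ∃ mu : m.Partition, IsAddColumn M mu lam := by
  have hpos : ∀ i : Fin M, 1 ≤ expo M lam i := by
    intro i
    have hi : (i : ℕ) < (rows lam).length := by rw [hM]; exact i.2
    rw [expo_apply, List.getD_eq_getElem _ _ hi]
    exact rows_get_pos lam ⟨i, hi⟩
  have hsum := degree_expo lam hM.le
  have h1 : ∑ i : Fin M, (expo M lam i - 1) + M = m + M := by
    conv_rhs => rw [← hsum]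
    have : ∀ i ∈ (Finset.univ : Finset (Fin M)), expo M lam i = (expo M lam i - 1) + 1 :=
      fun i _ => (Nat.sub_add_cancel (hpos i)).symm
    rw [Finset.sum_congr rfl this, Finset.sum_add_distrib]
    simp
  obtain ⟨mu, hl, he⟩ := exists_expo_eq (N := M) (n := m)
    (α := Finsupp.equivFunOnFinite.symm fun i => expo M lam i - 1)
    (fun i j hij => Nat.sub_le_sub_right (expo_antitone M lam hij) 1)
    (Nat.add_right_cancel h1)
  refine ⟨mu, hl, hM.le, fun i hi => ?_⟩
  have h3 := DFunLike.congr_fun he ⟨i, hi⟩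
  have h4 := hpos ⟨i, hi⟩
  simp only [expo_apply, Finsupp.equivFunOnFinite_symm_apply_apply] at h3 h4
  omega

theorem IsAddColumn.injective {m : ℕ} {mu mu' : m.Partition} {lam : (m + M).Partition}
    (h : IsAddColumn M mu lam) (h' : IsAddColumn M mu' lam) : mu = mu' := by
  refine expo_injective h.length_le h'.length_le (Finsupp.ext fun i => ?_)
  have h1 := h.getD_eq i i.2
  have h2 := h'.getD_eq i i.2
  simp only [expo_apply]
  omega

variable [CharZero F]

theorem polyOp_neg_one_macdonaldP (h : IsGenericPair q τ) {n : ℕ} {lam : n.Partition}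
    (hl : (rows lam).length ≤ M) :
    polyOp q τ (-1) (toPoly F M (macdonaldP q τ lam)) =
      C (eigenvalue q τ M lam (-1)) * (vdm M F * toPoly F M (macdonaldP q τ lam)) := by
  -- With `Z = -τ^{-n}` one gets `τ ^ n * Z = -1`, and the extra factors `1 - τ^{s-n}`, `s < n`, are
  -- nonzero and cancel.
  have h1 := polyOp_toPoly_macdonaldP h lam n (Nat.le_add_left n M) (-(τ ^ n * q ^ 0)⁻¹)
  have hA : ∏ s ∈ Finset.range n, (1 + τ ^ s * (-(τ ^ n * q ^ 0)⁻¹)) ≠ 0 := by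
    refine Finset.prod_ne_zero_iff.mpr fun s hs => ?_
    have := one_add_ne_zero h (a := s) (b := 0) (c := n) (d := 0)
      (Or.inl (Finset.mem_range.mp hs).ne)
    simpa only [pow_zero, mul_one] using this
  rw [eigenvalue_add hl, C_mul, mul_assoc] at h1
  have h2 := mul_left_cancel₀ (C_ne_zero.mpr hA) h1
  have h3 : τ ^ n * (-(τ ^ n * q ^ 0)⁻¹) = -1 := by
    have := pow_ne_zero n h.right_ne_zero
    rw [pow_zero, mul_one, mul_neg, mul_inv_cancel₀ this]
  rwa [h3] at h2

/-- The recursion for the coefficients. -/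
theorem coeff_recursion (h : IsGenericPair q τ) {m : ℕ} {c : m.Partition → F}
    {c' : (m + M).Partition → F}
    (hc : elemCoeff q m = ∑ mu, c mu • macdonaldP q τ mu)
    (hc' : elemCoeff q (m + M) = ∑ lam, c' lam • macdonaldP q τ lam)
    {mu : m.Partition} {lam : (m + M).Partition} (hs : IsAddColumn M mu lam) :
    c' lam * eigenvalue q τ M lam (-1) = (-1) ^ M * q ^ m * c mu := by
  classical
  let s : Finset (m + M).Partition := Finset.univ.filter fun lam => (rows lam).length ≤ M
  let s' : Finset m.Partition := Finset.univ.filter fun mu => (rows mu).length ≤ M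
  have hex : ∀ mu : m.Partition, ∃ lam : (m + M).Partition, mu ∈ s' → IsAddColumn M mu lam := by
    intro mu
    by_cases hmu : (rows mu).length ≤ M
    · obtain ⟨lam, hl⟩ := exists_isAddColumn hmu
      exact ⟨lam, fun _ => hl⟩
    · exact ⟨lam, fun hm => absurd (Finset.mem_filter.mp hm).2 hmu⟩
  choose add hadd using hex
  have h1 := polyOp_elemCoeff (M := M) h m
  -- In `M` variables only partitions with at most `M` rows survive. The right side is rewritten
  -- below in the same `P_λ` by adding a column of length `M`, which is injective on partitions.
  have hL : polyOp q τ (-1) (toPoly F M (elemCoeff q (m + M))) =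
      vdm M F * ∑ lam ∈ s, (c' lam * eigenvalue q τ M lam (-1)) •
        toPoly F M (macdonaldP q τ lam) := by
    rw [hc', map_sum, polyOp_sum, Finset.mul_sum, Finset.sum_filter]
    refine Finset.sum_congr rfl fun lam _ => ?_
    rw [map_smul, polyOp_smul]
    split_ifs with hl
    · rw [polyOp_neg_one_macdonaldP h hl, mul_smul_comm, smul_eq_C_mul, smul_eq_C_mul, C_mul]
      ring
    · have h0 : toPoly F M (macdonaldP q τ lam) = 0 := by
        by_contra h0
        exact hl (length_le_of_toPoly_ne_zero h h0)
      rw [h0]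
      have := polyOp_smul (q := q) (τ := τ) (-1) 0 (0 : MvPolynomial (Fin M) F)
      rw [zero_smul, zero_smul] at this
      rw [this, smul_zero]
  have hR : C ((-1) ^ M * q ^ m) * (∏ i, X i) * (vdm M F * toPoly F M (elemCoeff q m)) =
      vdm M F * ∑ lam ∈ s, (∑ mu ∈ s' with add mu = lam, (-1) ^ M * q ^ m * c mu) •
        toPoly F M (macdonaldP q τ lam) := by
    have h2 : ∑ lam ∈ s, (∑ mu ∈ s' with add mu = lam, (-1) ^ M * q ^ m * c mu) •
        toPoly F M (macdonaldP q τ lam) =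
        ∑ mu ∈ s', ((-1) ^ M * q ^ m * c mu) • toPoly F M (macdonaldP q τ (add mu)) := by
      rw [← Finset.sum_fiberwise_of_maps_to (s := s') (t := s) (g := add)
        (fun mu hmu => Finset.mem_filter.mpr ⟨Finset.mem_univ _, (hadd mu hmu).length_le'⟩)]
      refine Finset.sum_congr rfl fun lam _ => ?_
      rw [Finset.sum_smul]
      refine Finset.sum_congr rfl fun mu hmu => ?_
      rw [(Finset.mem_filter.mp hmu).2]
    have h3 : toPoly F M (elemCoeff q m) = ∑ mu ∈ s', c mu • toPoly F M (macdonaldP q τ mu) := by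
      rw [hc, map_sum, Finset.sum_filter]
      refine Finset.sum_congr rfl fun mu _ => ?_
      rw [map_smul]
      split_ifs with hl
      · rfl
      · have h0 : toPoly F M (macdonaldP q τ mu) = 0 := by
          by_contra h0
          exact hl (length_le_of_toPoly_ne_zero h h0)
        rw [h0, smul_zero]
    rw [h2, h3, Finset.mul_sum, Finset.mul_sum, Finset.mul_sum]
    refine Finset.sum_congr rfl fun mu hmu => ?_
    rw [toPoly_macdonaldP_of_isAddColumn h (hadd mu hmu), smul_eq_C_mul, smul_eq_C_mul,
      C_mul (a := (-1) ^ M * q ^ m)]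
    ring
  rw [hL, hR] at h1
  have h2 := mul_left_cancel₀ vdm_ne_zero h1
  rw [← sub_eq_zero, ← Finset.sum_sub_distrib] at h2
  simp only [← sub_smul] at h2
  have h3 := eq_zero_of_sum_toPoly_macdonaldP q τ (fun lam hlam => (Finset.mem_filter.mp hlam).2)
    h2 lam (Finset.mem_filter.mpr ⟨Finset.mem_univ _, hs.length_le'⟩)
  rw [sub_eq_zero] at h3
  have hmu : mu ∈ s' := Finset.mem_filter.mpr ⟨Finset.mem_univ _, hs.length_le⟩
  have hadd' : add mu = lam := expo_injective (hadd mu hmu).length_le' hs.length_le'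
    (Finsupp.ext fun i => by
      rw [expo_apply, expo_apply, (hadd mu hmu).getD_eq i i.2, hs.getD_eq i i.2])
  have h4 : s'.filter (fun mu => add mu = lam) = {mu} := by
    ext ka
    rw [Finset.mem_filter, Finset.mem_singleton]
    constructor
    · rintro ⟨hk, rfl⟩
      exact (hadd ka hk).injective hs
    · rintro rfl
      exact ⟨hmu, hadd'⟩
  rw [h3, h4, Finset.sum_singleton]

end

/-! ### Boxes -/

section

variable {M n : ℕ}

theorem getD_rows_pos {lam : n.Partition} {i : ℕ} : 0 < (rows lam).getD i 0 ↔
    i < (rows lam).length := by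
  constructor
  · intro h
    by_contra! hi
    rw [List.getD_eq_default _ _ hi] at h
    exact lt_irrefl _ h
  · intro hi
    rw [List.getD_eq_getElem _ _ hi]
    exact rows_get_pos lam ⟨i, hi⟩

theorem getD_rows_le (lam : n.Partition) (i : ℕ) : (rows lam).getD i 0 ≤ n := by
  by_cases hi : i < (rows lam).length
  · rw [List.getD_eq_getElem _ _ hi]
    conv_rhs => rw [← rows_sum lam]
    exact List.single_le_sum (by simp) _ (List.getElem_mem hi)
  · rw [List.getD_eq_default _ _ (not_lt.mp hi)]
    exact Nat.zero_le n

theorem mem_boxes {lam : n.Partition} {s : ℕ × ℕ} :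
    s ∈ boxes lam ↔ s.2 < (rows lam).getD s.1 0 := by
  rw [boxes, Finset.mem_filter, Finset.mem_product, Finset.mem_range, Finset.mem_range]
  refine ⟨fun h => h.2, fun h => ⟨⟨?_, h.trans_le (getD_rows_le lam _)⟩, h⟩⟩
  exact (getD_rows_pos.mp (Nat.zero_lt_of_lt h)).trans_le (length_rows_le lam)

theorem card_filter_parts {lam : n.Partition} (hM : (rows lam).length ≤ M) (k : ℕ) :
    (lam.parts.filter fun a => k < a).card =
      (Finset.univ.filter fun i : Fin M => k < (rows lam).getD i 0).card := by
  rw [← shape_expo lam hM, shape, Multiset.filter_filter, Multiset.filter_map, Multiset.card_map,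
    Finset.card_def, Finset.filter_val]
  congr 1
  refine Multiset.filter_congr fun i _ => ?_
  simp only [Function.comp_apply, expo_apply]
  omega

theorem IsAddColumn.length_eq {m : ℕ} {mu : m.Partition} {lam : (m + M).Partition}
    (h : IsAddColumn M mu lam) : (rows lam).length = M := by
  refine le_antisymm h.length_le' ?_
  by_contra! hlt
  have h1 := h.getD_eq _ hlt
  rw [List.getD_eq_default _ _ le_rfl] at h1
  omega

/-- A product over the boxes, column by column. -/
theorem IsAddColumn.prod_boxes {R : Type*} [CommMonoid R] {m : ℕ} {mu : m.Partition}
    {lam : (m + M).Partition} (h : IsAddColumn M mu lam) (f : ℕ → ℕ → R) :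
    ∏ s ∈ boxes lam, f (arm lam s) (leg lam s) =
      (∏ i : Fin M, f ((rows mu).getD i 0) (Fin.rev i : ℕ)) *
        ∏ s ∈ boxes mu, f (arm mu s) (leg mu s) := by
  classical
  have hget : ∀ i k, k + 1 < (rows lam).getD i 0 ↔ k < (rows mu).getD i 0 := by
    intro i k
    by_cases hi : i < M
    · rw [h.getD_eq i hi]; omega
    · rw [List.getD_eq_default _ _ (h.length_le'.trans (not_lt.mp hi)),
        List.getD_eq_default _ _ (h.length_le.trans (not_lt.mp hi))]
      omega
  -- The boxes of `λ` are a full first column, with arms `μ_i` and legs `M - 1 - i`, and the boxes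
  -- of `μ` moved one step right with unchanged arms and legs.
  have h1 : boxes lam = (Finset.univ.image fun i : Fin M => ((i : ℕ), 0)) ∪
      (boxes mu).image fun s => (s.1, s.2 + 1) := by
    ext ⟨i, j⟩
    rw [mem_boxes, Finset.mem_union, Finset.mem_image, Finset.mem_image]
    rcases j with _ | j
    · simp only [getD_rows_pos, h.length_eq]
      constructor
      · intro hi
        exact Or.inl ⟨⟨i, hi⟩, Finset.mem_univ _, rfl⟩
      · rintro (⟨k, -, hk⟩ | ⟨s, -, hs⟩)
        · obtain rfl : (k : ℕ) = i := (Prod.ext_iff.mp hk).1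
          exact k.2
        · exact absurd (Prod.ext_iff.mp hs).2 (Nat.succ_ne_zero _)
    · simp only [hget]
      constructor
      · intro hi
        exact Or.inr ⟨(i, j), mem_boxes.mpr hi, rfl⟩
      · rintro (⟨k, -, hk⟩ | ⟨s, hs, hs'⟩)
        · exact absurd (Prod.ext_iff.mp hk).2.symm (Nat.succ_ne_zero _)
        · have h2 := mem_boxes.mp hs
          have h3 := Prod.ext_iff.mp hs'
          simp only [Nat.add_right_cancel_iff] at h3
          rwa [h3.1, h3.2] at h2
  have hd : Disjoint (Finset.univ.image fun i : Fin M => ((i : ℕ), 0))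
      ((boxes mu).image fun s => (s.1, s.2 + 1)) := by
    rw [Finset.disjoint_left]
    intro s hs hs'
    obtain ⟨k, -, rfl⟩ := Finset.mem_image.mp hs
    obtain ⟨s, -, hs⟩ := Finset.mem_image.mp hs'
    exact absurd (Prod.ext_iff.mp hs).2 (Nat.succ_ne_zero _)
  rw [h1, Finset.prod_union hd, Finset.prod_image, Finset.prod_image]
  · congr 1
    · refine Finset.prod_congr rfl fun i _ => ?_
      congr 1
      · rw [arm, h.getD_eq i i.2]; omega
      · have h2 : Multiset.filter (fun a => 0 < a) lam.parts = lam.parts :=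
          Multiset.filter_eq_self.mpr fun a ha => lam.parts_pos ha
        have h3 : lam.parts.card = M := by rw [← coe_rows, Multiset.coe_card, h.length_eq]
        simp only [leg]
        rw [h2, h3, Fin.val_rev]
        omega
    · refine Finset.prod_congr rfl fun s hs => ?_
      have hs' := mem_boxes.mp hs
      have hs1 : s.1 < M :=
        (getD_rows_pos.mp (Nat.zero_lt_of_lt hs')).trans_le h.length_le
      congr 1
      · rw [arm, arm, h.getD_eq _ hs1]; omega
      · rw [leg, leg, card_filter_parts h.length_le', card_filter_parts h.length_le]
        simp only [hget]
  · intro s _ s' _ hss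
    have := Prod.ext_iff.mp hss
    exact Prod.ext this.1 (Nat.succ_injective this.2)
  · intro i _ i' _ hii
    exact Fin.ext (Prod.ext_iff.mp hii).1

/-- Induction on partitions by adding columns. -/
theorem column_induction {motive : ∀ {n : ℕ}, n.Partition → Prop}
    (zero : ∀ lam : (0 : ℕ).Partition, motive lam)
    (add : ∀ {m M : ℕ} {mu : m.Partition} {lam : (m + M).Partition}, IsAddColumn M mu lam →
      motive mu → motive lam) {n : ℕ} (lam : n.Partition) : motive lam := by
  induction n using Nat.strong_induction_on with
  | _ n ih =>
    rcases n.eq_zero_or_pos with rfl | hn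
    · exact zero lam
    · have hle := length_rows_le lam
      have hpos : 0 < (rows lam).length := by
        rw [List.length_pos_iff]
        intro h0
        have := rows_sum lam
        rw [h0, List.sum_nil] at this
        omega
      obtain ⟨M, hM⟩ : ∃ M, (rows lam).length = M := ⟨_, rfl⟩
      obtain ⟨m, rfl⟩ : ∃ m, n = m + M := ⟨n - M, by omega⟩
      obtain ⟨mu, hmu⟩ := exists_isAddColumn_left lam hM
      exact add hmu (ih m (by omega) mu)

theorem boxes_zero (lam : (0 : ℕ).Partition) : boxes lam = ∅ := by
  rw [boxes, Finset.range_zero, Finset.empty_product, Finset.filter_empty]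

theorem prod_boxes_const {R : Type*} [CommMonoid R] (a : R) (lam : n.Partition) :
    ∏ _s ∈ boxes lam, a = a ^ n := by
  induction lam using column_induction with
  | zero lam => rw [boxes_zero, Finset.prod_empty, pow_zero]
  | @add m M mu lam h ih =>
    rw [h.prod_boxes (fun _ _ => a), ih, Finset.prod_const, Finset.card_univ, Fintype.card_fin,
      pow_add, mul_comm]

theorem nStat_eq {lam : n.Partition} (hM : (rows lam).length ≤ M) :
    nStat lam = ∑ i ∈ Finset.range M, i * (rows lam).getD i 0 := by
  have h1 : ∀ K, (rows lam).length ≤ K → ∑ i ∈ Finset.range K, i * (rows lam).getD i 0 =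
      ∑ i ∈ Finset.range (rows lam).length, i * (rows lam).getD i 0 := by
    intro K hK
    symm
    refine Finset.sum_subset (Finset.range_subset_range.mpr hK) fun i _ hi => ?_
    rw [List.getD_eq_default _ _ (not_lt.mp fun hh => hi (Finset.mem_range.mpr hh)), mul_zero]
  rw [nStat, h1 n (length_rows_le lam), h1 M hM]

/-- `n(λ)` is the sum of all legs: a column of length `M` contributes `0 + 1 + ⋯ + (M - 1)`. This
distributes the factor `t ^ n(λ)` of `H̃_λ` over the boxes. -/
theorem prod_boxes_pow_leg {R : Type*} [CommMonoid R] (t : R) (lam : n.Partition) :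
    ∏ s ∈ boxes lam, t ^ leg lam s = t ^ nStat lam := by
  induction lam using column_induction with
  | zero lam => rw [boxes_zero, Finset.prod_empty, nStat, Finset.range_zero, Finset.sum_empty,
      pow_zero]
  | @add m M mu lam h ih =>
    rw [h.prod_boxes (fun _ l => t ^ l), ih, nStat_eq h.length_le, nStat_eq h.length_le',
      Finset.prod_pow_eq_pow_sum, ← pow_add]
    congr 1
    have h1 : ∑ i : Fin M, (Fin.rev i : ℕ) = ∑ i ∈ Finset.range M, i := by
      rw [← Fin.sum_univ_eq_sum_range (fun i => i)]
      exact Equiv.sum_comp Fin.revPerm fun i : Fin M => (i : ℕ)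
    rw [h1, ← Finset.sum_add_distrib]
    refine Finset.sum_congr rfl fun i hi => ?_
    rw [h.getD_eq i (Finset.mem_range.mp hi)]
    ring

end

section

variable {F : Type*} [Field F] [CharZero F] {q τ : F}

/-- The coefficients of `(-1) ^ n e_n[X / (1 - q)]` in the basis of the `P_λ`. -/
theorem elemCoeff_eq_sum (h : IsGenericPair q τ) (n : ℕ) :
    elemCoeff q n = ∑ lam : n.Partition,
      (∏ s ∈ boxes lam, (-(q ^ arm lam s / (1 - q ^ (arm lam s + 1) * τ ^ leg lam s)))) •
        macdonaldP q τ lam := by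
  choose c hc using fun n => exists_eq_sum_macdonaldP q τ (elemCoeff_mem_homSym q n)
  have key : ∀ {n : ℕ} (lam : n.Partition), c n lam =
      ∏ s ∈ boxes lam, (-(q ^ arm lam s / (1 - q ^ (arm lam s + 1) * τ ^ leg lam s))) := by
    intro n lam
    induction lam using column_induction with
    | zero lam =>
      rw [boxes_zero, Finset.prod_empty]
      have h1 := congrArg (coeff (expo 0 lam)) (congrArg (toPoly F 0) (hc 0))
      rw [Fintype.sum_unique, Subsingleton.elim default lam, map_smul, coeff_smul,
        (isMonicAt_macdonaldP q τ lam).coeff (length_rows_le lam) (lt_irrefl (rows lam)),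
        if_pos rfl, smul_eq_mul, mul_one, elemCoeff, expCoeff, map_one] at h1
      rw [← h1, Subsingleton.elim (expo 0 lam) 0, coeff_zero_one]
    | @add m M mu lam hs ih =>
      have h1 := coeff_recursion h (hc m) (hc (m + M)) hs
      rw [hs.prod_boxes fun a l => -(q ^ a / (1 - q ^ (a + 1) * τ ^ l)), ← ih]
      have hne : ∀ i : Fin M, 1 - q ^ ((rows mu).getD i 0 + 1) * τ ^ (Fin.rev i : ℕ) ≠ 0 := by
        intro i h0
        have := h.eq_zero_of_zpow ((rows mu).getD i 0 + 1 : ℕ) (Fin.rev i : ℕ) (by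
          rw [zpow_natCast, zpow_natCast]; exact (sub_eq_zero.mp h0).symm)
        omega
      -- Dividing the recursion by this product, with `q ^ m` spread over the rows of `μ`, gives
      -- exactly the factors of the first column of `λ`.
      have h2 : eigenvalue q τ M lam (-1) =
          ∏ i : Fin M, (1 - q ^ ((rows mu).getD i 0 + 1) * τ ^ (Fin.rev i : ℕ)) := by
        refine Finset.prod_congr rfl fun i _ => ?_
        rw [hs.getD_eq i i.2]
        ring
      have h3 : q ^ m = ∏ i : Fin M, q ^ (rows mu).getD i 0 := by
        rw [Finset.prod_pow_eq_pow_sum]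
        congr 1
        exact (degree_expo mu hs.length_le).symm
      have h4 : eigenvalue q τ M lam (-1) ≠ 0 := by
        rw [h2]; exact Finset.prod_ne_zero_iff.mpr fun i _ => hne i
      have h5 : (∏ i : Fin M, -(q ^ (rows mu).getD i 0 /
          (1 - q ^ ((rows mu).getD i 0 + 1) * τ ^ (Fin.rev i : ℕ)))) *
          eigenvalue q τ M lam (-1) = (-1) ^ M * q ^ m := by
        rw [h2, h3, ← Finset.prod_mul_distrib]
        have h6 : ((-1 : F)) ^ M = ∏ _i : Fin M, (-1 : F) := by simp
        rw [h6, ← Finset.prod_mul_distrib]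
        refine Finset.prod_congr rfl fun i _ => ?_
        rw [neg_mul, div_mul_cancel₀ _ (hne i)]
        ring
      apply mul_right_cancel₀ h4
      rw [h1, ← h5]
      ring
  rw [hc n]
  exact Finset.sum_congr rfl fun lam _ => by rw [key]

end

/-! ### The logarithm of an exponential -/

section

theorem coeff_pow_eq_zero {A : Type*} [CommRing A] {g : PowerSeries A}
    (hg : PowerSeries.constantCoeff g = 0) {n m : ℕ} (h : n < m) :
    PowerSeries.coeff n (g ^ m) = 0 :=
  PowerSeries.coeff_of_lt_order _ (lt_of_lt_of_le (by exact_mod_cast h)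
    (PowerSeries.le_order_pow_of_constantCoeff_eq_zero m hg))

/-- The logarithm of a solution of `df = a f` with `f(0) = 1` is linear. -/
theorem coeff_seriesLog_eq_zero {A : Type*} [CommRing A] [IsDomain A] [Algebra ℚ A]
    {f : PowerSeries A} {a : A} (h0 : PowerSeries.constantCoeff f = 1)
    (hf : PowerSeries.derivative A f = PowerSeries.C a * f) {n : ℕ} (hn : 1 < n) :
    PowerSeries.coeff n (seriesLog f) = 0 := by
  have hchar : CharZero A := algebraRat.charZero A
  obtain ⟨k, rfl⟩ : ∃ k, n = k + 1 := ⟨n - 1, by omega⟩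
  set g := f - 1 with hg
  have hg0 : PowerSeries.constantCoeff g = 0 := by rw [hg, map_sub, h0, map_one, sub_self]
  have hfg : f = 1 + g := by rw [hg]; ring
  have hdg : PowerSeries.derivative A g = PowerSeries.derivative A f := by
    rw [hg, map_sub, Derivation.map_one_eq_zero, sub_zero]
  -- The logarithm truncated at `j = k + 1` has the right coefficient in degree `k + 1`, and its
  -- derivative is a finite geometric sum.
  set S : PowerSeries A := ∑ j ∈ Finset.Icc 1 (k + 1),
    ((-1 : ℚ) ^ (j - 1) / (j : ℚ)) • g ^ j with hS
  have h1 : PowerSeries.coeff (k + 1) (seriesLog f) = PowerSeries.coeff (k + 1) S := by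
    rw [seriesLog, PowerSeries.coeff_mk, hS, map_sum]
    refine Finset.sum_congr rfl fun j _ => ?_
    rw [map_rat_smul]
  have h2 : PowerSeries.derivative A S =
      (∑ j ∈ Finset.range (k + 1), (-g) ^ j) * PowerSeries.derivative A g := by
    have hI : Finset.Icc 1 (k + 1) = Finset.Ico 1 (k + 2) := by
      ext x
      simp only [Finset.mem_Icc, Finset.mem_Ico]
      omega
    rw [hS, map_sum, Finset.sum_mul, hI, Finset.sum_Ico_eq_sum_range]
    refine Finset.sum_congr rfl fun i _ => ?_
    have hi : ((i + 1 : ℕ) : ℚ) ≠ 0 := Nat.cast_ne_zero.mpr (Nat.succ_ne_zero i)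
    rw [map_rat_smul, Derivation.leibniz_pow, add_comm 1 i, Nat.add_sub_cancel,
      ← Nat.cast_smul_eq_nsmul ℚ, smul_smul, div_mul_cancel₀ _ hi, smul_eq_mul]
    rcases Nat.even_or_odd i with he | ho
    · rw [he.neg_one_pow, he.neg_pow, one_smul]
    · rw [ho.neg_one_pow, ho.neg_pow, neg_one_smul, neg_mul]
  -- Cancelling `f` leaves `S' = a (1 - (-g)^{k+1})`. Its coefficient in degree `k ≥ 1` is zero
  -- because `g` has no constant term.
  have h3 : f * PowerSeries.derivative A S = (1 - (-g) ^ (k + 1)) * PowerSeries.derivative A g := by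
    rw [h2, ← mul_assoc, hfg, show (1 + g) = 1 - -g by ring, mul_comm (1 - -g), 
      geom_sum_mul_neg]
  have hf0 : f ≠ 0 := by
    rintro rfl
    simp at h0
  have h4 : PowerSeries.derivative A S = PowerSeries.C a * (1 - (-g) ^ (k + 1)) := by
    apply mul_left_cancel₀ hf0
    rw [h3, hdg, hf]
    ring
  have h5 := congrArg (PowerSeries.coeff k) h4
  rw [PowerSeries.coeff_derivative, PowerSeries.coeff_C_mul, map_sub, coeff_pow_eq_zero
    (by rw [map_neg, hg0, neg_zero]) (Nat.lt_succ_self k), PowerSeries.coeff_one,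
    if_neg (by omega), sub_zero, mul_zero] at h5
  rw [h1]
  exact (mul_eq_zero.mp h5).resolve_right (Nat.cast_add_one_ne_zero k)

theorem map_seriesLog {A B : Type*} [CommRing A] [Algebra ℚ A] [CommRing B] [Algebra ℚ B]
    (h : A →+* B) (f : PowerSeries A) (n : ℕ) :
    h (PowerSeries.coeff n (seriesLog f)) =
      PowerSeries.coeff n (seriesLog (PowerSeries.map h f)) := by
  rw [seriesLog, seriesLog, PowerSeries.coeff_mk, PowerSeries.coeff_mk, map_sum]
  refine Finset.sum_congr rfl fun j _ => ?_
  rw [map_rat_smul, ← PowerSeries.coeff_map, map_pow, map_sub, map_one]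

end

/-! ### The coefficient of `p_1 ^ n` -/

section

/-- `p_1 ↦ x` and `p_r ↦ 0` for `r > 1`. -/
def linPart (ι F : Type*) [Field F] : MultiSym ι F →ₐ[F] Polynomial F :=
  aeval fun s : ι × ℕ+ => if s.2 = 1 then Polynomial.X else 0

theorem coeff_linPart {F : Type*} [Field F] (f : MultiSym (Fin 1) F) (n : ℕ) :
    (linPart (Fin 1) F f).coeff n = coeff (Finsupp.single (0, 1) n) f := by
  classical
  induction f using MvPolynomial.induction_on' with
  | monomial e c =>
    rw [linPart, aeval_monomial, coeff_monomial]
    by_cases he : ∃ k, e = Finsupp.single (0, 1) k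
    · obtain ⟨k, rfl⟩ := he
      have hinj : (Finsupp.single ((0, 1) : Fin 1 × ℕ+) k = Finsupp.single (0, 1) n) ↔ n = k :=
        ⟨fun h => (Finsupp.single_injective _ h).symm, fun h => by rw [h]⟩
      rw [Finsupp.prod_single_index (by exact pow_zero _), if_pos rfl, Polynomial.algebraMap_eq,
        Polynomial.coeff_C_mul, Polynomial.coeff_X_pow]
      simp only [hinj, mul_ite, mul_one, mul_zero]
    · rw [if_neg fun h => he ⟨n, h⟩]
      have h1 : ∃ s ∈ e.support, s.2 ≠ 1 := by
        by_contra! h1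
        refine he ⟨e (0, 1), ?_⟩
        ext s
        by_cases hs : s = (0, 1)
        · rw [hs]; simp
        · rw [Finsupp.single_eq_of_ne hs]
          by_contra h2
          exact hs (Prod.ext (Subsingleton.elim _ _) (h1 s (Finsupp.mem_support_iff.mpr h2)))
      obtain ⟨s, hs, hs1⟩ := h1
      rw [Finsupp.prod, Finset.prod_eq_zero hs, mul_zero, Polynomial.coeff_zero]
      rw [if_neg hs1, zero_pow (Finsupp.mem_support_iff.mp hs)]
  | add p q hp hq => rw [map_add, Polynomial.coeff_add, hp, hq, coeff_add]

theorem completePart_ones {F : Type*} [Field F] {ι : Type*} (i : ι) (n : ℕ) :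
    (completePart i (ones n) : MultiSym ι F) = monomial (Finsupp.single (i, 1) n) 1 := by
  have h1 : (complete i 1 : MultiSym ι F) = X (i, 1) := by
    rw [complete, Fintype.sum_unique]
    have h2 : (default : (1 : ℕ).Partition).parts = {1} := by
      rw [Subsingleton.elim (default : (1 : ℕ).Partition) (ones 1)]; rfl
    rw [zee, h2]
    simp [powerSum]
    rfl
  rw [completePart, ones, Multiset.map_replicate, Multiset.prod_replicate, h1, X_pow_eq_monomial]

theorem linPart_adams_one (f : MultiSym (Fin 1) RatFun2) :
    linPart (Fin 1) RatFun2 (adams 1 f) =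
      Polynomial.map (adamsCoeff 1) (linPart (Fin 1) RatFun2 f) := by
  have h : (linPart (Fin 1) RatFun2).toRingHom.comp (adams 1) =
      (Polynomial.mapRingHom (adamsCoeff 1)).comp (linPart (Fin 1) RatFun2).toRingHom := by
    refine MvPolynomial.ringHom_ext (fun r => ?_) (fun s => ?_)
    · simp [adams, linPart]
    · simp [adams, linPart]
      split_ifs <;> simp
  exact DFunLike.congr_fun h f

/-- For `d ≠ 1` every `p_r` becomes `p_{dr}` with `dr > 1`, which is set to zero; only the constant
term remains. -/
theorem coeff_linPart_adams {d : ℕ+} (hd : d ≠ 1) (f : MultiSym (Fin 1) RatFun2) {n : ℕ}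
    (hn : n ≠ 0) : (linPart (Fin 1) RatFun2 (adams d f)).coeff n = 0 := by
  have hds : ∀ s : ℕ+, d * s ≠ 1 := by
    intro s h
    have h1 := congrArg PNat.val h
    rw [PNat.val_ofNat, PNat.mul_coe, mul_eq_one] at h1
    exact hd (PNat.eq h1.1)
  have h : (linPart (Fin 1) RatFun2).toRingHom.comp (adams d) =
      Polynomial.C.comp ((adamsCoeff d).comp constantCoeff) := by
    refine MvPolynomial.ringHom_ext (fun r => ?_) (fun s => ?_)
    · simp [adams, linPart]
    · simp [adams, linPart, hds]
  have h1 := DFunLike.congr_fun h f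
  simp only [RingHom.comp_apply] at h1
  change linPart (Fin 1) RatFun2 (adams d f) = _ at h1
  rw [h1, Polynomial.coeff_C, if_neg hn]

end

/-! ### The Cauchy kernel in genus `0` with one alphabet -/

section

theorem var_ne_zero (i : Fin 2) : var i ≠ 0 := by
  rw [var, map_ne_zero_iff _ (IsFractionRing.injective (MvPolynomial (Fin 2) ℚ) RatFun2)]
  exact X_ne_zero i

theorem var_pow_mul_pow_eq {a b c d : ℕ} (h : var 0 ^ a * var 1 ^ b = var 0 ^ c * var 1 ^ d) :
    a = c ∧ b = d := by
  simp only [var, ← map_pow, ← map_mul] at h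
  have h1 := IsFractionRing.injective (MvPolynomial (Fin 2) ℚ) RatFun2 h
  rw [X_pow_eq_monomial, X_pow_eq_monomial, X_pow_eq_monomial, X_pow_eq_monomial, monomial_mul,
    monomial_mul, one_mul] at h1
  have h2 := monomial_left_injective one_ne_zero h1
  have h3 := DFunLike.congr_fun h2 0
  have h4 := DFunLike.congr_fun h2 1
  simp at h3 h4
  exact ⟨h3, h4⟩

theorem isGenericPair_var : IsGenericPair (var 0 ^ 2) (var 1 ^ 2)⁻¹ where
  left_ne_zero := pow_ne_zero _ (var_ne_zero 0)
  right_ne_zero := inv_ne_zero (pow_ne_zero _ (var_ne_zero 1))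
  eq_zero_of_zpow a b h := by
    have h0 := var_ne_zero 0
    have h1 := var_ne_zero 1
    have ha : a = a.toNat - (-a).toNat := by omega
    have hb : -b = (-b).toNat - b.toNat := by omega
    rw [inv_zpow', ha, hb, zpow_sub₀ (pow_ne_zero 2 h0), zpow_sub₀ (pow_ne_zero 2 h1),
      zpow_natCast, zpow_natCast, zpow_natCast, zpow_natCast, ← pow_mul, ← pow_mul, ← pow_mul,
      ← pow_mul, div_mul_div_comm, div_eq_one_iff_eq (by positivity)] at h
    have := var_pow_mul_pow_eq h
    omega

/-- For one box: the normalization of `J_λ` cancels one denominator of the hook function, and with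
the share `w^{2l}` of `t ^ n(λ)` what is left is `w⁻²` times the factor in `elemCoeff_eq_sum`. -/
theorem hook_mul_eq (a l : ℕ) :
    -(var 0 ^ (2 * a) * var 1 ^ (2 * l)) /
        ((var 0 ^ (2 * a + 2) - var 1 ^ (2 * l)) * (var 0 ^ (2 * a) - var 1 ^ (2 * l + 2))) *
      ((var 1 ^ 2) ^ l * (1 - (var 0 ^ 2) ^ a * (var 1 ^ 2)⁻¹ ^ (l + 1))) =
    (var 1 ^ 2)⁻¹ *
      -((var 0 ^ 2) ^ a / (1 - (var 0 ^ 2) ^ (a + 1) * (var 1 ^ 2)⁻¹ ^ l)) := by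
  have h1 := var_ne_zero 1
  have h2 : var 0 ^ (2 * a + 2) - var 1 ^ (2 * l) ≠ 0 := by
    rw [sub_ne_zero]
    intro h
    have := var_pow_mul_pow_eq (a := 2 * a + 2) (b := 0) (c := 0) (d := 2 * l) (by simpa using h)
    omega
  have h3 : var 0 ^ (2 * a) - var 1 ^ (2 * l + 2) ≠ 0 := by
    rw [sub_ne_zero]
    intro h
    have := var_pow_mul_pow_eq (a := 2 * a) (b := 0) (c := 0) (d := 2 * l + 2) (by simpa using h)
    omega
  have h4 : 1 - (var 0 ^ 2) ^ a * (var 1 ^ 2)⁻¹ ^ (l + 1) =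
      -(var 0 ^ (2 * a) - var 1 ^ (2 * l + 2)) / var 1 ^ (2 * l + 2) := by
    rw [inv_pow, ← pow_mul, ← pow_mul, mul_add, mul_one]
    field_simp
    ring
  have h5 : 1 - (var 0 ^ 2) ^ (a + 1) * (var 1 ^ 2)⁻¹ ^ l =
      -(var 0 ^ (2 * a + 2) - var 1 ^ (2 * l)) / var 1 ^ (2 * l) := by
    rw [inv_pow, ← pow_mul, ← pow_mul, mul_add, mul_one]
    field_simp
    ring
  rw [h4, h5, ← pow_mul, ← pow_mul]
  field_simp
  ring

/-- The coefficients of the Cauchy kernel. -/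
theorem coeff_cauchyKernel (n : ℕ) :
    PowerSeries.coeff n (cauchyKernel 0 1 1) =
      rename (fun s => ((0 : Fin 1), s)) (C ((var 1 ^ 2)⁻¹ ^ n) *
        aeval (fun r : ℕ+ => C ((1 - (var 1 ^ 2)⁻¹ ^ (r : ℕ))⁻¹) * (X r : Sym RatFun2))
          (elemCoeff (var 0 ^ 2) n)) := by
  rw [cauchyKernel, PowerSeries.coeff_mk, elemCoeff_eq_sum isGenericPair_var n, map_sum,
    Finset.mul_sum, map_sum]
  refine Finset.sum_congr rfl fun lam _ => ?_
  rw [Fin.prod_univ_one, macdonaldH, macdonaldJ, map_mul, map_mul, map_mul, map_smul,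
    smul_eq_C_mul, map_mul, map_mul, rename_C, rename_C, algHom_C, algebraMap_eq, rename_C,
    rename_C, ← mul_assoc, ← mul_assoc, ← mul_assoc, ← C_mul, ← C_mul, ← C_mul]
  congr 2
  rw [hook, ← prod_boxes_pow_leg, ← prod_boxes_const (var 1 ^ 2)⁻¹ lam, mul_assoc, ← Finset.prod_mul_distrib,
    ← Finset.prod_mul_distrib, ← Finset.prod_mul_distrib]
  refine Finset.prod_congr rfl fun s _ => ?_
  rw [← hook_mul_eq, pow_one, mul_zero, pow_zero, mul_one]

/-- With `p_r = 0` for `r > 1` only the first term of the exponent survives, so the kernel is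
`exp(aT)` with `a = -τ x / ((1 - q)(1 - τ))`. -/
theorem derivative_map_cauchyKernel : ∃ a : Polynomial RatFun2,
    PowerSeries.derivative (Polynomial RatFun2)
      (PowerSeries.map (linPart (Fin 1) RatFun2 : MultiSym (Fin 1) RatFun2 →+* _)
        (cauchyKernel 0 1 1)) =
    PowerSeries.C a * PowerSeries.map (linPart (Fin 1) RatFun2 : MultiSym (Fin 1) RatFun2 →+* _)
      (cauchyKernel 0 1 1) := by
  set q : RatFun2 := var 0 ^ 2
  set τ : RatFun2 := (var 1 ^ 2)⁻¹
  let b : Polynomial RatFun2 := Polynomial.C (-(1 - q)⁻¹ * (1 - τ)⁻¹) * Polynomial.X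
  let ψ : Sym RatFun2 →ₐ[RatFun2] Polynomial RatFun2 :=
    (linPart (Fin 1) RatFun2).comp ((rename fun s => ((0 : Fin 1), s)).comp
      (aeval (fun r : ℕ+ => C ((1 - τ ^ (r : ℕ))⁻¹) * (X r : Sym RatFun2))))
  have h1 : ∀ n, PowerSeries.coeff n
      (PowerSeries.map (linPart (Fin 1) RatFun2 : MultiSym (Fin 1) RatFun2 →+* _)
        (cauchyKernel 0 1 1)) = Polynomial.C (τ ^ n) *
          expCoeff RatFun2 (fun r => if r = 1 then b else 0) n := by
    intro n
    rw [PowerSeries.coeff_map, coeff_cauchyKernel]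
    change linPart (Fin 1) RatFun2 _ = _
    rw [map_mul, map_mul, rename_C, algHom_C, Polynomial.algebraMap_eq]
    congr 1
    change ψ (elemCoeff q n) = _
    rw [elemCoeff, map_expCoeff]
    refine expCoeff_congr (fun r hr => ?_) n
    have hr1 : r.toPNat' = 1 ↔ r = 1 := by
      rw [← PNat.coe_eq_one_iff, PNat.toPNat'_coe hr]
    simp only [ψ, AlgHom.comp_apply, map_mul, aeval_X, rename_X, algHom_C,
      Polynomial.algebraMap_eq, linPart, hr1, algebraMap_eq]
    split_ifs with h
    · subst h
      simp [b]
      ring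
    · simp
  refine ⟨Polynomial.C τ * b, PowerSeries.ext fun n => ?_⟩
  rw [PowerSeries.coeff_derivative, PowerSeries.coeff_C_mul, h1, h1, mul_assoc,
    smul_expCoeff_succ, Finset.sum_eq_single 0]
  · simp [pow_succ]
    ring
  · intro i _ hi
    rw [if_neg (by omega), zero_mul]
  · simp

theorem HH_eq_zero {n : ℕ} (hn : 1 < n) : HH 0 1 (fun _ : Fin 1 => ones n) = 0 := by
  rw [HH, Fin.prod_univ_one, completePart_ones]
  refine mul_eq_zero_of_right _ ?_
  -- Pairing with `p_1ⁿ` is the coefficient of `p_1ⁿ` times its square length.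
  refine (pairingLin_monomial _ _ _).trans (mul_eq_zero_of_left ?_ _)
  rw [plethLog, PowerSeries.coeff_mk, coeff_sum]
  refine Finset.sum_eq_zero fun d hd => ?_
  suffices hx : coeff (Finsupp.single ((0 : Fin 1), (1 : ℕ+)) n) (adams d.toPNat'
      (PowerSeries.coeff (n / d) (seriesLog (cauchyKernel 0 1 1)))) = 0 by
    exact (coeff_smul _ _ _).trans ((congrArg _ hx).trans (smul_zero _))
  rw [← coeff_linPart]
  have hd0 : 0 < d := Nat.pos_of_mem_divisors hd
  by_cases hd1 : d = 1
  · subst hd1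
    -- The term `d = 1` is the ordinary logarithm of an exponential of a linear function of `T`,
    -- which has no part of degree `n > 1`.
    rw [show Nat.toPNat' 1 = 1 from rfl, linPart_adams_one, Nat.div_one]
    obtain ⟨a, ha⟩ := derivative_map_cauchyKernel
    have h1 := map_seriesLog
      (linPart (Fin 1) RatFun2 : MultiSym (Fin 1) RatFun2 →+* Polynomial RatFun2)
      (cauchyKernel 0 1 1) n
    rw [coeff_seriesLog_eq_zero ?_ ha hn] at h1
    · change linPart (Fin 1) RatFun2 _ = 0 at h1
      rw [h1, Polynomial.map_zero, Polynomial.coeff_zero]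
    · rw [← PowerSeries.coeff_zero_eq_constantCoeff_apply, PowerSeries.coeff_map,
        coeff_cauchyKernel, elemCoeff, expCoeff]
      simp
  · refine coeff_linPart_adams ?_ _ (by omega)
    intro h
    exact hd1 (by rw [← PNat.toPNat'_coe hd0, h]; rfl)

end

end

end WildChar

theorem mainTheorem9 (n : ℕ) (hn : 1 < n) (ξ : GL (Fin n) ℂ) (hreg : IsRegularTorus ξ)
    (hgen : IsGeneric (Fin.append ![] fun _ : Fin 1 => ConjClasses.mk ξ)) :
    IsEmpty (wildVariety 0 ![] ![1] ![ξ]) ∧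
    HH 0 1 (fun _ : Fin 1 => ones n) = 0 ∧
    IsWH (wildVarietyMap 0 ![] ![1] ![ξ])
      (conjecturedWH 0 (![] : Fin 0 → n.Partition) ![1]) ∧
    IsWHc (wildVarietyMap 0 ![] ![1] ![ξ])
      (conjecturedWH 0 (![] : Fin 0 → n.Partition) ![1]) := by
  have hempty := isEmpty_wildVariety (isEmpty_solutionSet hn hreg)
  have hHH := HH_eq_zero hn
  rw [conjecturedWH_eq_zero hHH]
  exact ⟨hempty, hHH, isWH_of_isEmpty hempty _, isWHc_of_isEmpty hempty _⟩
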